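/- Let $M\ge 1$ and let $p_1,\dots,p_A$ satisfy $0<p_j<1$, $\sum_{j=1}^A p_j=1$ and $\sum_{j=1}^A p_j^2<1/M$. Let $\rho$ be the unique real number with $\sum_{j=1}^A p_j^{\rho}=1/M$. In the periodic case, where all ratios $\log p_i/\log p_j$ are rational, let $a>1$ be such that $p_j=a^{-e_j}$ with positive integers $e_j$ satisfying $\gcd(e_1,\dots,e_A)=1$; otherwise let $a=e$. Consider independent random labelings of the edges of the infinite rooted $M$-ary tree, in which all labels are independent and equal to the $j$-th letter of an $A$-letter alphabet with probability $p_j$. The G-trie built from $n$ labelings consists of all finite paths starting at the root of the $M$-ary tree, together with a labeling of the path by letters, that occur in at least two of the $n$ labelings. Let $S_n$ be its number of nodes; it is almost surely finite and has a finite second moment. (1) There is a unique continuous $1$-periodic function $P_E:\mathbb R\to\mathbb R$ with $$\mathbb E(S_n)=P_E(\log_a n)\,n^{\rho}+o(n^{\rho})\qquad(n\to\infty).$$ It is given by the absolutely convergent sum $$P_E(x)=\sum_{\beta}G_E(\beta)\,e^{(\beta-\rho)(\log a)x},\qquad G_E(s)=\frac{(1-s)\Gamma(-s)}{M\sum_{j=1}^A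 p_j^{s}\log p_j},$$ over all complex $\beta$ with $\Re\beta=\rho$ and $M\sum_{j=1}^A p_j^{\beta}=1$ (at $s=1$ the numerator is understood as its limit, $(1-s)\Gamma(-s)=-\Gamma(2-s)/s$). Moreover, $P_E(x)>0$ for all $x\in\mathbb R$. (2) If $p_j=1/A$ for all $j$ (the uniform case), or if $\rho=1$, then there is a unique continuous $1$-periodic function $P_V:\mathbb R\to\mathbb R$ with $$\mathrm{Var}(S_n)=P_V(\log_a n)\,n^{\rho}+o(n^{\rho})\qquad(n\to\infty),$$ and $P_V(x)>0$ for all $x\in\mathbb R$. -/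

import Mathlib

open MeasureTheory ProbabilityTheory Filter

noncomputable section

namespace GTrie

/-- The edges of the infinite rooted `M`-ary tree. A vertex is the list of directions leading to it
from the root, and `(v, i)` is the edge from `v` to its `i`-th child. -/
abbrev Edge (M : ℕ) : Type := List (Fin M) × Fin M

/-- An edge labeling of the `M`-ary tree by letters of an alphabet with `A` letters. -/
abbrev Labeling (M A : ℕ) : Type := Edge M → Fin A

/-- The restriction of a labeling to the `i`-th subtree of the root, itself an `M`-ary tree. -/
def Labeling.subtree {M A : ℕ} (l : Labeling M A) (i : Fin M) : Labeling M A :=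
  fun e => l (i :: e.1, e.2)

/-- A node of the infinite `M × A`-ary tree is a path from the root of the `M`-ary tree together
with the letters along it. It occurs in `l` if `l` puts exactly these letters on the path. -/
def Occurs {M A : ℕ} : Labeling M A → List (Fin M × Fin A) → Prop
  | _, [] => True
  | l, (i, j) :: w => l ([], i) = j ∧ Occurs (l.subtree i) w

/-- The nodes of the G-trie built from `n` labelings: the labeled paths that occur in at least two
of them. -/
def nodes {M A n : ℕ} (l : Fin n → Labeling M A) : Set (List (Fin M × Fin A)) :=
  {w | ∃ k k' : Fin n, k ≠ k' ∧ Occurs (l k) w ∧ Occurs (l k') w}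

/-- The nodes of the G-trie built from the first `n` of the random labelings `L 0, L 1, …`. -/
def randomNodes {Ω : Type*} {M A : ℕ} (L : ℕ → Edge M → Ω → Fin A) (n : ℕ) (ω : Ω) :
    Set (List (Fin M × Fin A)) :=
  nodes (fun (k : Fin n) (e : Edge M) => L k e ω)

/-- The size `S_n` of the random G-trie (used where the G-trie is finite). -/
def size {Ω : Type*} {M A : ℕ} (L : ℕ → Edge M → Ω → Fin A) (n : ℕ) (ω : Ω) : ℝ :=
  ((randomNodes L n ω).ncard : ℝ)

/-- All labels of all labelings are independent, and each is the letter `j` with probability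
`p j`. -/
structure IsRandomLabelings {Ω : Type*} [MeasurableSpace Ω] (μ : Measure Ω) {M A : ℕ}
    (p : Fin A → ℝ) (L : ℕ → Edge M → Ω → Fin A) : Prop where
  measurable : ∀ k e, Measurable (L k e)
  law : ∀ k e j, μ.real {ω | L k e ω = j} = p j
  indep : iIndepFun (fun (x : ℕ × Edge M) => L x.1 x.2) μ

/-- All ratios `log p_i / log p_j` are rational. -/
def PeriodicCase {A : ℕ} (p : Fin A → ℝ) : Prop :=
  ∀ i j, ∃ q : ℚ, Real.log (p i) / Real.log (p j) = q

/-- The base `a` of the logarithm in the asymptotics. In the periodic case, `p_j = a ^ (-e_j)` with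
positive integers `e_j` without a common factor; in the aperiodic case, `a` is Euler's number. -/
def IsBase {A : ℕ} (p : Fin A → ℝ) (a : ℝ) : Prop :=
  (PeriodicCase p ∧ 1 < a ∧ ∃ e : Fin A → ℕ, (∀ j, 0 < e j) ∧ Finset.univ.gcd e = 1 ∧
    ∀ j, p j = (a ^ e j)⁻¹) ∨
  (¬ PeriodicCase p ∧ a = Real.exp 1)

/-- The zeros of `1 - M ∑ p_j ^ s` on the line `Re s = ρ`. -/
def roots (M : ℕ) {A : ℕ} (p : Fin A → ℝ) (ρ : ℝ) : Set ℂ :=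
  {s | 1 - (M : ℂ) * ∑ j, (p j : ℂ) ^ s = 0 ∧ s.re = ρ}

/-- `G_E(s) = (1 - s) Γ(-s) / (M ∑ p_j ^ s log p_j)`. The numerator is written as
`-Γ(2 - s) / s`, which is the same function with the removable singularity at `s = 1` filled in. -/
def GE (M : ℕ) {A : ℕ} (p : Fin A → ℝ) (s : ℂ) : ℂ :=
  (-Complex.Gamma (2 - s) / s) / ((M : ℂ) * ∑ j, (p j : ℂ) ^ s * (Real.log (p j) : ℂ))

/-- `P` is continuous and `1`-periodic, and `u_n = P(log_a n) n ^ ρ + o(n ^ ρ)`. -/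
structure IsPeriodicFactor (a ρ : ℝ) (u : ℕ → ℝ) (P : ℝ → ℝ) : Prop where
  continuous : Continuous P
  periodic : Function.Periodic P 1
  asymptotics : (fun n : ℕ => u n - P (Real.logb a n) * (n : ℝ) ^ ρ) =o[atTop]
    (fun n : ℕ => (n : ℝ) ^ ρ)

end GTrie

end

/-! A labeled path is a word w over the M·A pairs (direction, letter). It occurs in one labeling
with probability π_w = `wt (letterP M p) w`, so E S_n is the sum over all words of P(Bin(n, π_w) ≥
2). The weights p_x^ρ sum to 1 over the pairs, so after division by n^ρ this sum is a renewal
function: mass p_x^ρ sits on the step -log p_x, and a function `gBin ρ τ n` is summed at the points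
log n + log π_w. If τ vanishes at 0 and 1 and grows at most like k^σ with σ < ρ < 2, then `gBin`
decays exponentially on both sides, uniformly in n, and converges locally uniformly to its Poisson
analogue `gLim`. The renewal theorem then yields a periodic limit (`isPeriodicFactor_tsum`).

The renewal theorem rests on two facts. First, a bounded approximate solution Z of Z(t) = ∑ q_i Z(t
- x_i) is asymptotically invariant under each shift x_i (`tendsto_sub_shift`), by a maximum
principle; hence it is invariant under the lattice span d, or under all shifts if the steps generate
a dense group. Second, an average of Z over windows of length x_i has increments given exactly by g,
so it equals a sum or an integral of g. By shift invariance this average is asymptotically a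
multiple of Z, which determines Z.

For τ = 1_{k ≥ 2} the Fourier transform of `gLim` is Γ(2-β)/β. The roots on the line Re s = ρ are ρ
+ 2πik/log a in the periodic case and only ρ otherwise. Poisson summation, respectively the plain
integral, turns the limit into the stated sum over roots (`hasSum_roots`).

For the variance V, splitting pairs of words at their first letters gives V(n) = T(n) + ∑_x E
V(Bin(n, p_x)), where T(n) is M times the variance of ∑_j E(N_j), with E the mean size and N
multinomial (`varSize_eq`). So V is again a sum over words, and it remains to bound a toll by n^σ
with σ < ρ. Second differences of E are O(n^(ρ-2)), hence E is linear near n p_j up to a remainder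
contributing variance O(n^(2ρ-2)) with 2ρ-2 < ρ. In the uniform case all slopes agree, so the linear
part is constant and T itself is small. If ρ = 1, the linear part contributes order n; adding n
d_n^2 to V, with d_n = E(n) - E(n-1), cancels it up to O(√n). The correction has its own periodic
factor, since n d_n is the word sum with toll 2·1_{k=2}. Positivity follows by comparison with the
word sum that keeps only T(2) > 0. -/

noncomputable section

namespace GTrie

open Topology

/-! ### Sums over words -/

section Lists

variable {ι : Type*}

/-- A list is empty or has a head and a tail. -/
def listEquiv (ι : Type*) : Unit ⊕ (ι × List ι) ≃ List ι where
  toFun x := Sum.elim (fun _ => []) (fun y => y.1 :: y.2) x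
  invFun w := match w with
    | [] => Sum.inl ()
    | i :: w => Sum.inr (i, w)
  left_inv x := by rcases x with x | x <;> rfl
  right_inv w := by cases w <;> rfl

theorem hasSum_list [Fintype ι] {f : List ι → ℝ} {s : ι → ℝ}
    (h : ∀ i, HasSum (fun w => f (i :: w)) (s i)) : HasSum f (f [] + ∑ i, s i) := by
  rw [← (listEquiv ι).hasSum_iff]
  refine HasSum.sum ?_ ?_
  · exact hasSum_unique _
  · classical
    rw [show (f ∘ listEquiv ι) ∘ Sum.inr =
        fun x : ι × List ι => ∑ i, (if x.1 = i then f (i :: x.2) else 0) by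
          funext x
          simp [listEquiv]]
    refine hasSum_sum fun i _ => ?_
    have hinj : Function.Injective (fun w : List ι => (i, w)) := Prod.mk_right_injective i
    refine (hinj.hasSum_iff ?_).1 ?_
    · rintro ⟨k, w⟩ hx
      rw [if_neg]
      rintro rfl
      exact hx ⟨w, rfl⟩
    · simpa [Function.comp_def] using h i

theorem summable_cons {f : List ι → ℝ} (hf : Summable f) (i : ι) :
    Summable (fun w => f (i :: w)) :=
  hf.comp_injective (List.cons_injective)

theorem tsum_list [Fintype ι] {f : List ι → ℝ} (hf : Summable f) :
    ∑' w, f w = f [] + ∑ i, ∑' w, f (i :: w) :=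
  (hasSum_list fun i => (summable_cons hf i).hasSum).tsum_eq

/-- A nonnegative family on words that is dominated, letter by letter, by a supersolution `Y` is
summable, with sum at most `Y`. -/
theorem summable_of_supersolution [Fintype ι] {S : Type*} {T : ι → S → S} {q : ι → ℝ}
    {f : S → List ι → ℝ} {Y : S → ℝ} (hq : ∀ i, 0 ≤ q i) (hf : ∀ s w, 0 ≤ f s w)
    (hY : ∀ s, 0 ≤ Y s) (hcons : ∀ s i w, f s (i :: w) = q i * f (T i s) w)
    (h : ∀ s, f s [] + ∑ i, q i * Y (T i s) ≤ Y s) (s : S) :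
    Summable (f s) ∧ ∑' w, f s w ≤ Y s := by
  -- Words of length below K give a finite sum, so the supersolution inequality can be iterated
  -- without assuming convergence.
  have key : ∀ K : ℕ, ∀ s, ∃ c ≤ Y s, HasSum (fun w => if w.length < K then f s w else 0) c := by
    intro K
    induction K with
    | zero => exact fun s => ⟨0, hY s, by simp⟩
    | succ K ih =>
      intro s
      choose c hc hs using ih
      refine ⟨f s [] + ∑ i, q i * c (T i s), ?_, ?_⟩
      · refine le_trans ?_ (h s)
        gcongr with i
        · exact hq i
        · exact hc _
      · have := hasSum_list (f := fun w : List ι => if w.length < K + 1 then f s w else 0)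
          (s := fun i => q i * c (T i s)) (fun i => by
            convert! (hs (T i s)).mul_left (q i) using 2 with w
            simp [hcons])
        simpa using this
  have hfin : ∀ t : Finset (List ι), ∑ w ∈ t, f s w ≤ Y s := by
    intro t
    obtain ⟨c, hc, hs⟩ := key (t.sup List.length + 1) s
    refine le_trans ?_ hc
    refine le_trans (le_of_eq ?_) (sum_le_hasSum t (fun w _ => ?_) hs)
    · refine Finset.sum_congr rfl fun w hw => ?_
      rw [if_pos (Nat.lt_succ_of_le (Finset.le_sup (f := List.length) hw))]
    · split_ifs
      exacts [hf _ _, le_rfl]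
  have hsum : Summable (f s) := summable_of_sum_le (hf s) hfin
  exact ⟨hsum, hsum.tsum_le_of_sum_le hfin⟩

/-- The multiplicative extension of a weight on letters to words. -/
def wt (c : ι → ℝ) (w : List ι) : ℝ := (w.map c).prod

@[simp] theorem wt_nil (c : ι → ℝ) : wt c [] = 1 := by simp [wt]

@[simp] theorem wt_cons (c : ι → ℝ) (i : ι) (w : List ι) : wt c (i :: w) = c i * wt c w := by
  simp [wt]

theorem wt_nonneg {c : ι → ℝ} (hc : ∀ i, 0 ≤ c i) (w : List ι) : 0 ≤ wt c w := by
  induction w with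
  | nil => simp
  | cons i w ih => simpa using mul_nonneg (hc i) ih

theorem wt_pos {c : ι → ℝ} (hc : ∀ i, 0 < c i) (w : List ι) : 0 < wt c w := by
  induction w with
  | nil => simp
  | cons i w ih => simpa using mul_pos (hc i) ih

theorem wt_le_one {c : ι → ℝ} (hc : ∀ i, 0 ≤ c i) (hc' : ∀ i, c i ≤ 1) (w : List ι) :
    wt c w ≤ 1 := by
  induction w with
  | nil => simp
  | cons i w ih => simpa using mul_le_one₀ (hc' i) (wt_nonneg hc w) ih

theorem wt_pow (c : ι → ℝ) (k : ℕ) (w : List ι) : wt (fun i => c i ^ k) w = wt c w ^ k := by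
  induction w with
  | nil => simp
  | cons i w ih => simp [ih, mul_pow]

theorem wt_rpow {c : ι → ℝ} (hc : ∀ i, 0 ≤ c i) (s : ℝ) (w : List ι) :
    wt (fun i => c i ^ s) w = wt c w ^ s := by
  induction w with
  | nil => simp
  | cons i w ih => simp [ih, Real.mul_rpow (hc i) (wt_nonneg hc w)]

/-- The geometric value (1 - ∑ c i)⁻¹ is a constant supersolution. -/
theorem summable_wt [Fintype ι] {c : ι → ℝ} (hc : ∀ i, 0 ≤ c i) (h1 : ∑ i, c i < 1) :
    Summable (wt c) := by
  have h0 : 0 < 1 - ∑ i, c i := by linarith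
  refine (summable_of_supersolution (T := fun _ (u : Unit) => u) (f := fun _ => wt c)
    (Y := fun _ => (1 - ∑ i, c i)⁻¹) hc (fun _ => wt_nonneg hc) (fun _ => by positivity)
    (fun _ i w => by simp) (fun _ => ?_) ()).1
  rw [← Finset.sum_mul, wt_nil]
  refine le_of_eq ?_
  field_simp
  ring

end Lists

/-! ### Uniform bounds for renewal sums -/

section Renewal

variable {ι : Type*} [Fintype ι]

/-- The length of a word whose letters have lengths `x`. -/
def len {ι : Type*} (x : ι → ℝ) (w : List ι) : ℝ := (w.map x).sum

@[simp] theorem len_nil {ι : Type*} (x : ι → ℝ) : len x [] = 0 := by simp [len]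

@[simp] theorem len_cons {ι : Type*} (x : ι → ℝ) (i : ι) (w : List ι) :
    len x (i :: w) = x i + len x w := by simp [len]

theorem len_nonneg {ι : Type*} {x : ι → ℝ} (hx : ∀ i, 0 ≤ x i) (w : List ι) : 0 ≤ len x w := by
  induction w with
  | nil => simp
  | cons i w ih => simpa using add_nonneg (hx i) ih

/-- The solution `Z` of the renewal equation `Z t = g t + ∑ i, q i * Z (t - x i)`. -/
def renewal {ι : Type*} (q x : ι → ℝ) (g : ℝ → ℝ) (t : ℝ) : ℝ :=
  ∑' w : List ι, wt q w * g (t - len x w)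

/-- A bounded increasing function with slope `δ * exp (-δ * |t|)`. -/
def ramp (δ t : ℝ) : ℝ := if t ≤ 0 then Real.exp (δ * t) else 2 - Real.exp (-(δ * t))

theorem ramp_nonneg {δ : ℝ} (hδ : 0 < δ) (t : ℝ) : 0 ≤ ramp δ t := by
  unfold ramp
  split_ifs with h
  · positivity
  · have : Real.exp (-(δ * t)) ≤ 1 := Real.exp_le_one_iff.2 (by nlinarith)
    linarith

theorem ramp_le_two {δ : ℝ} (hδ : 0 < δ) (t : ℝ) : ramp δ t ≤ 2 := by
  unfold ramp
  split_ifs with h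
  · have : Real.exp (δ * t) ≤ 1 := Real.exp_le_one_iff.2 (by nlinarith)
    linarith
  · have := Real.exp_pos (-(δ * t))
    linarith

/-- The drop of the ramp over a distance c dominates exp(-δ|t|). This makes a multiple of the ramp a
supersolution of the renewal inequality. -/
theorem ramp_sub_ramp_ge {δ : ℝ} (hδ : 0 < δ) {c : ℝ} (hc : 0 < c) (t : ℝ) :
    (1 - Real.exp (-(δ * c))) * Real.exp (-(δ * |t|)) ≤ ramp δ t - ramp δ (t - c) := by
  set u := Real.exp (-(δ * c)) with hu
  have hu0 : 0 < u := Real.exp_pos _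
  have hu1 : u < 1 := Real.exp_lt_one_iff.2 (by nlinarith)
  unfold ramp
  rcases le_or_gt t 0 with h | h
  · rw [if_pos h, if_pos (by linarith), abs_of_nonpos h,
      show δ * (t - c) = δ * t + -(δ * c) by ring, Real.exp_add, ← hu,
      show -(δ * -t) = δ * t by ring]
    nlinarith
  · rw [if_neg (by linarith), abs_of_pos h]
    set v := Real.exp (-(δ * t)) with hv
    have hv0 : 0 < v := Real.exp_pos _
    have hv1 : v < 1 := Real.exp_lt_one_iff.2 (by nlinarith)
    split_ifs with h2
    · have h3 : Real.exp (δ * (t - c)) * v = u := by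
        rw [hv, hu, ← Real.exp_add]; congr 1; ring
      have h4 : Real.exp (δ * (t - c)) ≤ 1 := Real.exp_le_one_iff.2 (by nlinarith)
      have h5 := Real.exp_pos (δ * (t - c))
      nlinarith
    · have h3 : Real.exp (-(δ * (t - c))) * u = v := by
        rw [hv, hu, ← Real.exp_add]; congr 1; ring
      have h5 := Real.exp_pos (-(δ * (t - c)))
      have h6 : 1 - u ≤ (1 - u) * (1 - u) + u * (1 - u) := by nlinarith
      nlinarith [mul_nonneg (sub_nonneg.2 hu1.le) (sub_nonneg.2 hu1.le), mul_pos h5 hu0,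
        mul_nonneg h5.le (mul_nonneg (sub_nonneg.2 hu1.le) (sub_nonneg.2 hu1.le))]

theorem ramp_mono {δ : ℝ} (hδ : 0 < δ) : Monotone (ramp δ) := by
  intro s t hst
  rcases hst.eq_or_lt with rfl | h
  · rfl
  have := ramp_sub_ramp_ge hδ (sub_pos.2 h) t
  have h1 : Real.exp (-(δ * (t - s))) ≤ 1 := Real.exp_le_one_iff.2 (by nlinarith)
  have h2 : 0 ≤ (1 - Real.exp (-(δ * (t - s)))) * Real.exp (-(δ * |t|)) :=
    mul_nonneg (by linarith) (Real.exp_pos _).le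
  rw [sub_sub_cancel] at this
  linarith

/-- Every step is at least c and the ramp increases, so averaging over steps lowers the ramp at
least as much as a shift by c does. As the ramp is bounded, the resulting bound is uniform in t. -/
theorem exists_renewal_bound {q x : ι → ℝ} (hq : ∀ i, 0 ≤ q i) (hq1 : ∑ i, q i = 1)
    (hx : ∀ i, 0 < x i) {δ : ℝ} (hδ : 0 < δ) :
    ∃ C > 0, ∀ t, Summable (fun w => wt q w * Real.exp (-(δ * |t - len x w|))) ∧
      ∑' w, wt q w * Real.exp (-(δ * |t - len x w|)) ≤ C := by
  obtain ⟨c, hc, hcx⟩ : ∃ c > 0, ∀ i, c ≤ x i := by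
    have hne : Nonempty ι := by
      by_contra h
      rw [not_nonempty_iff] at h
      simp at hq1
    obtain ⟨i, hi⟩ := Finite.exists_min x
    exact ⟨x i, hx i, hi⟩
  have hu1 : Real.exp (-(δ * c)) < 1 := Real.exp_lt_one_iff.2 (by nlinarith)
  set K := (1 - Real.exp (-(δ * c))) with hK
  have hK0 : 0 < K := by linarith
  refine ⟨2 / K, by positivity, fun t => ?_⟩
  have := summable_of_supersolution (T := fun i s => s - x i) (q := q)
    (f := fun t w => wt q w * Real.exp (-(δ * |t - len x w|))) (Y := fun t => ramp δ t / K) hq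
    (fun s w => mul_nonneg (wt_nonneg hq w) (Real.exp_pos _).le)
    (fun s => div_nonneg (ramp_nonneg hδ s) hK0.le) (fun s i w => by
      simp only [wt_cons, len_cons, sub_sub]; ring) (fun s => by
      have h1 : ∑ i, q i * (ramp δ (s - x i) / K) ≤ ramp δ (s - c) / K := by
        calc ∑ i, q i * (ramp δ (s - x i) / K) ≤ ∑ i, q i * (ramp δ (s - c) / K) := by
              gcongr with i
              · exact hq i
              · exact ramp_mono hδ (by linarith [hcx i])
          _ = _ := by rw [← Finset.sum_mul, hq1, one_mul]
      have h2 := ramp_sub_ramp_ge hδ hc s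
      rw [wt_nil, len_nil, one_mul, sub_zero]
      have h3 : Real.exp (-(δ * |s|)) ≤ ramp δ s / K - ramp δ (s - c) / K := by
        rw [← sub_div, le_div_iff₀ hK0]; linarith
      linarith) t
  refine ⟨this.1, this.2.trans ?_⟩
  gcongr
  exact ramp_le_two hδ t

end Renewal

end GTrie

end

noncomputable section

namespace GTrie

open Topology

/-! ### The renewal theorem: equation, bounds and behaviour at minus infinity -/

section RenewalTheorem

/-- Exponential decay on both sides. -/
def ExpBound (C δ : ℝ) (g : ℝ → ℝ) : Prop := ∀ s, |g s| ≤ C * Real.exp (-(δ * |s|))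

theorem ExpBound.nonneg {C δ : ℝ} {g : ℝ → ℝ} (hg : ExpBound C δ g) : 0 ≤ C := by
  simpa using (abs_nonneg _).trans (hg 0)

/-- Locally uniform convergence of functions with a common exponential bound is uniform with
respect to an exponential weight. -/
theorem eventually_expBound_sub {α : Type*} {l : Filter α} {F : α → ℝ → ℝ} {G : ℝ → ℝ} {C δ : ℝ}
    (hδ : 0 < δ) (hF : TendstoLocallyUniformly F G l) (hFb : ∀ᶠ a in l, ExpBound C δ (F a))
    (hG : ExpBound C δ G) {ε : ℝ} (hε : 0 < ε) :
    ∀ᶠ a in l, ExpBound ε (δ / 2) (fun s => F a s - G s) := by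
  have hlim : Tendsto (fun R : ℝ => 2 * C * Real.exp (-(δ / 2 * R))) atTop (𝓝 0) := by
    have h1 : Tendsto (fun R : ℝ => Real.exp (-(δ / 2 * R))) atTop (𝓝 0) :=
      Real.tendsto_exp_neg_atTop_nhds_zero.comp (tendsto_id.const_mul_atTop (half_pos hδ))
    simpa using h1.const_mul (2 * C)
  -- Half of the decay rate is spent on making the tails beyond R small; on [-R, R] uniform
  -- convergence suffices.
  obtain ⟨R, hR⟩ := (hlim.eventually (ge_mem_nhds hε)).exists
  have hc := (tendstoLocallyUniformlyOn_iff_tendstoUniformlyOn_of_compact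
    (isCompact_Icc (a := -R) (b := R))).1 hF.tendstoLocallyUniformlyOn
  have he : 0 < ε * Real.exp (-(δ / 2 * R)) := by positivity
  filter_upwards [Metric.tendstoUniformlyOn_iff.1 hc _ he, hFb] with a ha hab s
  have hexp : Real.exp (-(δ * |s|)) = Real.exp (-(δ / 2 * |s|)) * Real.exp (-(δ / 2 * |s|)) := by
    rw [← Real.exp_add]; congr 1; ring
  rcases le_or_gt |s| R with h | h
  · have h1 := ha s (abs_le.1 h)
    rw [Real.dist_eq, abs_sub_comm] at h1
    refine h1.le.trans ?_
    gcongr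
  · calc |F a s - G s| ≤ |F a s| + |G s| := abs_sub _ _
      _ ≤ 2 * C * Real.exp (-(δ / 2 * |s|)) * Real.exp (-(δ / 2 * |s|)) := by
          have := hab s
          have := hG s
          rw [hexp] at *
          linarith
      _ ≤ 2 * C * Real.exp (-(δ / 2 * R)) * Real.exp (-(δ / 2 * |s|)) := by
          have := hG.nonneg
          gcongr
      _ ≤ ε * Real.exp (-(δ / 2 * |s|)) := by gcongr

variable {ι : Type*} [Fintype ι] {q x : ι → ℝ}

section Basic

variable (hq : ∀ i, 0 ≤ q i) (hq1 : ∑ i, q i = 1) (hx : ∀ i, 0 < x i)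

include hq hq1 hx

theorem renewal_summable {C δ : ℝ} (hδ : 0 < δ) {g : ℝ → ℝ} (hg : ExpBound C δ g) (t : ℝ) :
    Summable (fun w : List ι => wt q w * g (t - len x w)) := by
  obtain ⟨K, -, hK⟩ := exists_renewal_bound hq hq1 hx hδ
  refine Summable.of_norm_bounded ((hK t).1.mul_left C) fun w => ?_
  rw [Real.norm_eq_abs, abs_mul, abs_of_nonneg (wt_nonneg hq w)]
  calc _ ≤ wt q w * (C * Real.exp (-(δ * |t - len x w|))) := by
        gcongr
        · exact wt_nonneg hq w
        · exact hg _
    _ = _ := by ring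

/-- The constant K depends on δ but not on g, so a perturbation of g that is small in the
exponential weight changes the renewal function little, uniformly in t. -/
theorem exists_abs_renewal_le {δ : ℝ} (hδ : 0 < δ) :
    ∃ K > 0, ∀ (C : ℝ) (g : ℝ → ℝ), ExpBound C δ g → ∀ t, |renewal q x g t| ≤ C * K := by
  obtain ⟨K, hK0, hK⟩ := exists_renewal_bound hq hq1 hx hδ
  refine ⟨K, hK0, fun C g hg t => ?_⟩
  have h1 : ∀ w : List ι, ‖wt q w * g (t - len x w)‖ ≤
      C * (wt q w * Real.exp (-(δ * |t - len x w|))) := by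
    intro w
    rw [Real.norm_eq_abs, abs_mul, abs_of_nonneg (wt_nonneg hq w)]
    calc _ ≤ wt q w * (C * Real.exp (-(δ * |t - len x w|))) := by
          gcongr
          · exact wt_nonneg hq w
          · exact hg _
      _ = _ := by ring
  refine (tsum_of_norm_bounded ((hK t).1.mul_left C).hasSum h1).trans ?_
  rw [tsum_mul_left]
  exact mul_le_mul_of_nonneg_left (hK t).2 hg.nonneg

theorem renewal_eq {C δ : ℝ} (hδ : 0 < δ) {g : ℝ → ℝ} (hg : ExpBound C δ g) (t : ℝ) :
    renewal q x g t = g t + ∑ i, q i * renewal q x g (t - x i) := by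
  unfold renewal
  rw [tsum_list (renewal_summable hq hq1 hx hδ hg t)]
  simp only [wt_nil, len_nil, one_mul, sub_zero, wt_cons, len_cons, ← tsum_mul_left, mul_assoc,
    sub_sub]

theorem renewal_sub {C δ C' δ' : ℝ} (hδ : 0 < δ) (hδ' : 0 < δ') {g f : ℝ → ℝ}
    (hg : ExpBound C δ g) (hf : ExpBound C' δ' f) (t : ℝ) :
    renewal q x (fun s => g s - f s) t = renewal q x g t - renewal q x f t := by
  unfold renewal
  rw [← (renewal_summable hq hq1 hx hδ hg t).tsum_sub (renewal_summable hq hq1 hx hδ' hf t)]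
  simp only [mul_sub]

/-- Lengths are nonnegative, so the value at t only involves g on (-∞, t]. For t ≤ 0 the restriction
of g to this ray satisfies an exponential bound at rate δ/2 with constant C exp(δt/2). -/
theorem renewal_tendsto_atBot {C δ : ℝ} (hδ : 0 < δ) {g : ℝ → ℝ} (hg : ExpBound C δ g) :
    Tendsto (renewal q x g) atBot (𝓝 0) := by
  obtain ⟨K, hK0, hK⟩ := exists_abs_renewal_le hq hq1 hx (half_pos hδ)
  have hlim : Tendsto (fun t => C * Real.exp (δ / 2 * t) * K) atBot (𝓝 0) := by
    have h1 : Tendsto (fun t : ℝ => Real.exp (δ / 2 * t)) atBot (𝓝 0) :=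
      Real.tendsto_exp_atBot.comp (tendsto_id.const_mul_atBot (half_pos hδ))
    simpa using (h1.const_mul C).mul_const K
  refine squeeze_zero_norm' ?_ hlim
  filter_upwards [eventually_le_atBot 0] with t ht
  have hb : ExpBound (C * Real.exp (δ / 2 * t)) (δ / 2) (fun s => if s ≤ t then g s else 0) := by
    intro s
    have hC := hg.nonneg
    beta_reduce
    split_ifs with h
    · refine (hg s).trans ?_
      rw [mul_assoc, ← Real.exp_add]
      gcongr
      rw [abs_of_nonpos (h.trans ht)]
      nlinarith
    · rw [abs_zero]; positivity
  have heq : renewal q x g t = renewal q x (fun s => if s ≤ t then g s else 0) t := by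
    refine tsum_congr fun w => ?_
    beta_reduce
    rw [if_pos]
    linarith [len_nonneg (fun i => (hx i).le) w]
  rw [heq]
  exact hK _ _ hb t

end Basic

/-! ### Asymptotic shift invariance -/

section Shift

/-- A maximum principle. The increment D(t) = Z(t) - Z(t - x i) also nearly satisfies the averaging
equation. If its limsup s were positive, then at a point where D is almost s the term D(t - x i)
would have to be almost s too, because the other terms hardly exceed s. Repeating this K times
produces increments that add up to more than the bounded function Z can vary. -/
theorem eventually_shift_lt (hq : ∀ i, 0 < q i) (hq1 : ∑ i, q i = 1) {Z : ℝ → ℝ} {B : ℝ}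
    (hB : ∀ t, |Z t| ≤ B)
    (h : Tendsto (fun t => Z t - ∑ j, q j * Z (t - x j)) atTop (𝓝 0)) (i : ι) {ε : ℝ}
    (hε : 0 < ε) : ∀ᶠ t in atTop, Z t - Z (t - x i) < ε := by
  classical
  set D : ℝ → ℝ := fun t => Z t - Z (t - x i) with hD
  have hDb : ∀ t, |D t| ≤ 2 * B := fun t => by
    have h1 := abs_le.1 (hB t)
    have h2 := abs_le.1 (hB (t - x i))
    exact abs_le.2 ⟨by simp only [hD]; linarith, by simp only [hD]; linarith⟩
  have hbdd : IsBoundedUnder (· ≤ ·) atTop D :=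
    isBoundedUnder_of ⟨2 * B, fun t => (abs_le.1 (hDb t)).2⟩
  have hbdd' : IsBoundedUnder (· ≥ ·) atTop D :=
    isBoundedUnder_of ⟨-(2 * B), fun t => (abs_le.1 (hDb t)).1⟩
  set s := limsup D atTop with hs
  by_contra hcon
  have hεs : ε ≤ s := by
    by_contra h2
    exact hcon (eventually_lt_of_limsup_lt (not_le.1 h2) hbdd)
  have hs0 : 0 < s := hε.trans_le hεs
  -- K increments of size s/2 exceed 2B, the largest possible variation of Z.
  obtain ⟨K, hK⟩ := exists_nat_gt (2 * B / (s / 2))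
  have hK2 : 2 * B < K * (s / 2) := (div_lt_iff₀ (half_pos hs0)).1 hK
  -- One step back enlarges the deficit below s by a factor at most 1/r. Starting from the deficit
  -- s/2 · r^K, it is still at most s/2 after K steps.
  set r := q i / 4 with hr
  have hqi1 : q i ≤ 1 := by
    rw [← hq1]
    exact Finset.single_le_sum (f := q) (fun j _ => (hq j).le) (Finset.mem_univ i)
  have hr0 : 0 < r := by have := hq i; positivity
  have hr1 : r ≤ 1 := by linarith [hq i]
  have hη : ∀ k, k ≤ K → s / 2 * r ^ K ≤ s / 2 * r ^ k := fun k hk => by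
    have := pow_le_pow_of_le_one hr0.le hr1 hk
    gcongr
  have hηpos : 0 < s / 2 * r ^ K := by positivity
  have hDeq : Tendsto (fun t => D t - ∑ j, q j * D (t - x j)) atTop (𝓝 0) := by
    have h2 : Tendsto (fun t => (Z t - ∑ j, q j * Z (t - x j)) -
        (Z (t - x i) - ∑ j, q j * Z (t - x i - x j))) atTop (𝓝 (0 - 0)) :=
      h.sub (h.comp (tendsto_atTop_add_const_right _ (-x i) tendsto_id))
    rw [sub_zero] at h2
    refine h2.congr fun t => ?_
    simp only [hD, mul_sub, Finset.sum_sub_distrib, sub_right_comm t (x i)]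
    ring
  have hev1 : ∀ᶠ t in atTop, D t < s + s / 2 * r ^ K :=
    eventually_lt_of_limsup_lt (by linarith) hbdd
  have hev2 : ∀ j, ∀ᶠ t in atTop, D (t - x j) < s + s / 2 * r ^ K := fun j =>
    (tendsto_atTop_add_const_right atTop (-x j) tendsto_id).eventually hev1
  have hev3 : ∀ᶠ t in atTop, D t - ∑ j, q j * D (t - x j) < s / 2 * r ^ K :=
    hDeq.eventually (gt_mem_nhds hηpos)
  obtain ⟨T, hT⟩ := eventually_atTop.1 ((eventually_all.2 hev2).and hev3)
  have hstep : ∀ t ≥ T, ∀ k < K, s - s / 2 * r ^ (k + 1) < D t →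
      s - s / 2 * r ^ k < D (t - x i) := by
    intro t ht k hk hDt
    obtain ⟨h1, h2⟩ := hT t ht
    have h3 : ∑ j, q j * D (t - x j) ≤
        q i * D (t - x i) + (1 - q i) * (s + s / 2 * r ^ K) := by
      rw [← Finset.add_sum_erase _ _ (Finset.mem_univ i)]
      gcongr
      have h4 : 1 - q i = ∑ j ∈ Finset.univ.erase i, q j := by
        rw [← hq1, ← Finset.add_sum_erase _ _ (Finset.mem_univ i)]; ring
      rw [h4, Finset.sum_mul]
      refine Finset.sum_le_sum fun j _ => ?_
      exact mul_le_mul_of_nonneg_left (h1 j).le (hq j).le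
    have h5 := hη (k + 1) hk
    have h6 : s / 2 * r ^ (k + 1) = s / 2 * r ^ k * (q i / 4) := by rw [pow_succ, hr]; ring
    have h7 : 0 < s / 2 * r ^ k := by positivity
    have h8 : q i * (s - s / 2 * r ^ k) < q i * D (t - x i) := by
      have h9 : 0 < q i * (s / 2 * r ^ K) := mul_pos (hq i) hηpos
      nlinarith
    exact lt_of_mul_lt_mul_left h8 (hq i).le
  have hfreq : ∃ᶠ t in atTop, s - s / 2 * r ^ K < D t :=
    frequently_lt_of_lt_limsup hbdd'.isCoboundedUnder_le (by linarith)
  obtain ⟨t, hDt, htT⟩ := (hfreq.and_eventually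
    (eventually_ge_atTop (T + K * |x i|))).exists
  have hall : ∀ k ≤ K, s - s / 2 * r ^ (K - k) < D (t - k * x i) := by
    intro k
    induction k with
    | zero => intro _; simpa using hDt
    | succ k ih =>
      intro hk
      have h1 := ih (by omega)
      have h2 : K - k = K - (k + 1) + 1 := by omega
      rw [h2] at h1
      have h3 : t - k * x i ≥ T := by
        have h4 : (k : ℝ) * x i ≤ K * |x i| := by
          have : (k : ℝ) ≤ K := by exact_mod_cast (by omega)
          exact (mul_le_mul_of_nonneg_left (le_abs_self _) (by positivity)).trans (by gcongr)
        linarith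
      have h5 := hstep _ h3 _ (by omega) h1
      rwa [show t - (k : ℝ) * x i - x i = t - ((k + 1 : ℕ) : ℝ) * x i by push_cast; ring] at h5
  have hsum : ∑ k ∈ Finset.range K, D (t - k * x i) = Z t - Z (t - K * x i) := by
    have := Finset.sum_range_sub' (fun k : ℕ => Z (t - k * x i)) K
    simp only [Nat.cast_zero, zero_mul, sub_zero] at this
    rw [← this]
    refine Finset.sum_congr rfl fun k _ => ?_
    simp only [hD]
    congr 2
    push_cast
    ring
  have hge : (K : ℝ) * (s / 2) ≤ ∑ k ∈ Finset.range K, D (t - k * x i) := by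
    have : ∑ k ∈ Finset.range K, s / 2 ≤ ∑ k ∈ Finset.range K, D (t - k * x i) := by
      refine Finset.sum_le_sum fun k hk => ?_
      refine le_trans ?_ (hall k (Finset.mem_range.1 hk).le).le
      have := pow_le_one₀ hr0.le hr1 (n := K - k)
      nlinarith
    simpa using this
  have h1 := abs_le.1 (hB t)
  have h2 := abs_le.1 (hB (t - K * x i))
  linarith

/-- Bounded approximate solutions of `Z t = ∑ q i * Z (t - x i)` are asymptotically invariant
under the shifts `x i`. -/
theorem tendsto_sub_shift (hq : ∀ i, 0 < q i) (hq1 : ∑ i, q i = 1) {Z : ℝ → ℝ} {B : ℝ}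
    (hB : ∀ t, |Z t| ≤ B)
    (h : Tendsto (fun t => Z t - ∑ j, q j * Z (t - x j)) atTop (𝓝 0)) (i : ι) :
    Tendsto (fun t => Z t - Z (t - x i)) atTop (𝓝 0) := by
  rw [Metric.tendsto_nhds]
  intro ε hε
  have h2 : Tendsto (fun t => -Z t - ∑ j, q j * -Z (t - x j)) atTop (𝓝 0) := by
    simpa [neg_add_eq_sub] using h.neg
  filter_upwards [eventually_shift_lt hq hq1 hB h i hε,
    eventually_shift_lt (Z := fun t => -Z t) hq hq1 (by simpa using hB) h2 i hε] with t h3 h4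
  rw [Real.dist_eq, sub_zero, abs_lt]
  constructor <;> linarith

/-- The shifts under which `Z` is asymptotically invariant. -/
def shiftGroup (Z : ℝ → ℝ) : AddSubgroup ℝ where
  carrier := {h | Tendsto (fun t => Z t - Z (t - h)) atTop (𝓝 0)}
  zero_mem' := by simp
  add_mem' {a b} ha hb := by
    have h1 : Tendsto (fun t => (Z t - Z (t - a)) + (Z (t - a) - Z (t - a - b))) atTop
        (𝓝 (0 + 0)) :=
      Tendsto.add ha (Tendsto.comp hb (tendsto_atTop_add_const_right atTop (-a) tendsto_id))
    simpa [sub_sub] using h1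
  neg_mem' {a} ha := by
    have h1 : Tendsto (fun t => -(Z (t + a) - Z (t + a - a))) atTop (𝓝 (-0)) :=
      (Tendsto.comp ha (tendsto_atTop_add_const_right atTop a tendsto_id)).neg
    simpa using h1

theorem mem_shiftGroup {Z : ℝ → ℝ} {h : ℝ} :
    h ∈ shiftGroup Z ↔ Tendsto (fun t => Z t - Z (t - h)) atTop (𝓝 0) := Iff.rfl

end Shift

/-! ### The lattice case -/

section Lattice

theorem ExpBound.tendsto_atTop {C δ : ℝ} {g : ℝ → ℝ} (hδ : 0 < δ) (hg : ExpBound C δ g) :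
    Tendsto g atTop (𝓝 0) := by
  have h1 : Tendsto (fun s : ℝ => C * Real.exp (-(δ * |s|))) atTop (𝓝 0) := by
    have : Tendsto (fun s : ℝ => Real.exp (-(δ * |s|))) atTop (𝓝 0) :=
      Real.tendsto_exp_neg_atTop_nhds_zero.comp (tendsto_abs_atTop_atTop.const_mul_atTop hδ)
    simpa using this.const_mul C
  exact squeeze_zero_norm hg h1

theorem tendsto_renewal_sub (hq : ∀ i, 0 < q i) (hq1 : ∑ i, q i = 1) (hx : ∀ i, 0 < x i)
    {C δ : ℝ} (hδ : 0 < δ) {g : ℝ → ℝ} (hg : ExpBound C δ g) (i : ι) :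
    x i ∈ shiftGroup (renewal q x g) := by
  obtain ⟨K, hK0, hK⟩ := exists_abs_renewal_le (fun i => (hq i).le) hq1 hx hδ
  refine tendsto_sub_shift hq hq1 (hK C g hg) ?_ i
  refine (hg.tendsto_atTop hδ).congr fun t => ?_
  rw [renewal_eq (fun i => (hq i).le) hq1 hx hδ hg t]
  ring

theorem summable_exp_neg_nat {c : ℝ} (hc : 0 < c) :
    Summable (fun k : ℕ => Real.exp (-(c * k))) := by
  have : (fun k : ℕ => Real.exp (-(c * k))) = fun k : ℕ => Real.exp (-c) ^ k := by
    funext k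
    rw [← Real.exp_nat_mul]
    congr 1
    ring
  rw [this]
  exact summable_geometric_of_lt_one (Real.exp_pos _).le (Real.exp_lt_one_iff.2 (by linarith))

theorem ExpBound.summable_int {C δ d : ℝ} (hδ : 0 < δ) (hd : 0 < d) {g : ℝ → ℝ}
    (hg : ExpBound C δ g) (t : ℝ) : Summable (fun m : ℤ => g (t - m * d)) := by
  have hb : ∀ k : ℤ, ‖g (t - k * d)‖ ≤
      C * Real.exp (δ * |t|) * Real.exp (-(δ * d * |(k : ℝ)|)) := by
    intro k
    refine (hg _).trans ?_
    rw [mul_assoc, ← Real.exp_add]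
    have := hg.nonneg
    gcongr
    have h1 : |(k : ℝ) * d| - |t| ≤ |t - k * d| := by
      rw [abs_sub_comm]; exact abs_sub_abs_le_abs_sub _ _
    rw [abs_mul, abs_of_pos hd] at h1
    nlinarith
  refine Summable.of_norm_bounded (Summable.mul_left _ ?_) hb
  refine Summable.of_nat_of_neg ?_ ?_
  · simpa using summable_exp_neg_nat (mul_pos hδ hd)
  · simpa using summable_exp_neg_nat (mul_pos hδ hd)

/-- The integers k with k·d in H form a cyclic group; its generator divides every e i, hence is a
unit. -/
theorem mem_of_gcd_mul_mem {H : AddSubgroup ℝ} {d : ℝ} {e : ι → ℕ}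
    (hgcd : Finset.univ.gcd e = 1) (h : ∀ i, (e i : ℝ) * d ∈ H) : d ∈ H := by
  obtain ⟨a, ha⟩ := Int.subgroup_cyclic (H.comap (zmultiplesHom ℝ d))
  have h1 : ∀ i, a.natAbs ∣ e i := by
    intro i
    have : (e i : ℤ) ∈ H.comap (zmultiplesHom ℝ d) := by simpa using h i
    rw [ha, AddSubgroup.mem_closure_singleton] at this
    obtain ⟨n, hn⟩ := this
    rw [← Int.natCast_dvd_natCast, Int.natAbs_dvd]
    exact ⟨n, by rw [← hn]; simp [mul_comm]⟩
  have h2 : a.natAbs = 1 := Nat.dvd_one.1 (hgcd ▸ Finset.dvd_gcd fun i _ => h1 i)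
  have h3 : (1 : ℤ) ∈ H.comap (zmultiplesHom ℝ d) := by
    rw [ha, AddSubgroup.mem_closure_singleton]
    rcases Int.natAbs_eq a with h4 | h4
    · exact ⟨1, by rw [h4, h2]; simp⟩
    · exact ⟨-1, by rw [h4, h2]; simp⟩
  simpa using h3

/-- The renewal theorem in the lattice case. -/
theorem renewal_lattice (hq : ∀ i, 0 < q i) (hq1 : ∑ i, q i = 1) {d : ℝ} (hd : 0 < d)
    {e : ι → ℕ} (he : ∀ i, 0 < e i) (hgcd : Finset.univ.gcd e = 1) (hxe : ∀ i, x i = e i * d)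
    {C δ : ℝ} (hδ : 0 < δ) {g : ℝ → ℝ} (hg : ExpBound C δ g) :
    Tendsto (fun t => renewal q x g t - d / (∑ i, q i * x i) * ∑' m : ℤ, g (t - m * d)) atTop
      (𝓝 0) := by
  have hx : ∀ i, 0 < x i := fun i => by
    have := he i
    rw [hxe i]
    positivity
  have hq0 : ∀ i, 0 ≤ q i := fun i => (hq i).le
  set Z := renewal q x g with hZ
  have hdZ : d ∈ shiftGroup Z := mem_of_gcd_mul_mem hgcd fun i => by
    rw [← hxe i]; exact tendsto_renewal_sub hq hq1 hx hδ hg i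
  have hkd : ∀ k : ℕ, Tendsto (fun t => Z t - Z (t - k * d)) atTop (𝓝 0) := fun k => by
    have := (shiftGroup Z).nsmul_mem hdZ k
    rw [nsmul_eq_mul] at this
    exact this
  -- The inner sums telescope under a shift by d to Z(t) - Z(t - x i), so the renewal equation
  -- becomes J(t) = g(t) + J(t - d). Iteration gives J(t) as the sum of g(t - kd) over k ≥ 0.
  set J : ℝ → ℝ := fun t => ∑ i, q i * ∑ k ∈ Finset.range (e i), Z (t - k * d) with hJ
  have hJstep : ∀ t, J t = g t + J (t - d) := by
    intro t
    have h1 : ∀ i, ∑ k ∈ Finset.range (e i), Z (t - k * d) =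
        Z t - Z (t - x i) + ∑ k ∈ Finset.range (e i), Z (t - d - k * d) := by
      intro i
      have := Finset.sum_range_sub' (fun k : ℕ => Z (t - k * d)) (e i)
      rw [Finset.sum_sub_distrib] at this
      simp only [Nat.cast_zero, zero_mul, sub_zero, ← hxe] at this
      rw [← this]
      have h2 : ∀ k : ℕ, t - d - k * d = t - ((k + 1 : ℕ) : ℝ) * d := fun k => by
        push_cast; ring
      simp only [h2]
      ring
    simp only [hJ, h1, mul_add, mul_sub, Finset.sum_add_distrib, Finset.sum_sub_distrib]
    rw [← Finset.sum_mul, hq1, hZ, renewal_eq hq0 hq1 hx hδ hg t]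
    ring
  have hJn : ∀ (n : ℕ) t, J t = ∑ k ∈ Finset.range n, g (t - k * d) + J (t - n * d) := by
    intro n t
    induction n with
    | zero => simp
    | succ n ih =>
      rw [ih, Finset.sum_range_succ, hJstep (t - n * d)]
      push_cast
      rw [show t - (n : ℝ) * d - d = t - ((n : ℝ) + 1) * d by ring]
      ring
  have hsub : ∀ c : ℝ, Tendsto (fun n : ℕ => c - n * d) atTop atBot := fun c => by
    have : Tendsto (fun n : ℕ => (n : ℝ) * d) atTop atTop :=
      tendsto_natCast_atTop_atTop.atTop_mul_const hd
    simpa [sub_eq_add_neg] using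
      tendsto_atBot_add_const_left atTop c (tendsto_neg_atTop_atBot.comp this)
  have hJbot : ∀ t, Tendsto (fun n : ℕ => J (t - n * d)) atTop (𝓝 0) := by
    intro t
    have : Tendsto (fun n : ℕ => J (t - n * d)) atTop
        (𝓝 (∑ i, q i * ∑ k ∈ Finset.range (e i), 0)) := by
      refine tendsto_finsetSum _ fun i _ => Tendsto.const_mul _ (tendsto_finsetSum _ fun k _ => ?_)
      have h1 := (renewal_tendsto_atBot hq0 hq1 hx hδ hg).comp (hsub (t - k * d))
      refine h1.congr fun n => ?_
      simp only [Function.comp, sub_right_comm, hZ]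
    simpa using this
  have hgsum : ∀ t, Summable (fun m : ℤ => g (t - m * d)) := hg.summable_int hδ hd
  have hJsum : ∀ t, ∑' k : ℕ, g (t - k * d) = J t := by
    intro t
    have hs : Summable (fun k : ℕ => g (t - k * d)) := by
      simpa [Function.comp_def] using (hgsum t).comp_injective Nat.cast_injective
    refine tendsto_nhds_unique hs.hasSum.tendsto_sum_nat ?_
    have : Tendsto (fun n : ℕ => J t - J (t - n * d)) atTop (𝓝 (J t - 0)) :=
      tendsto_const_nhds.sub (hJbot t)
    rw [sub_zero] at this
    refine this.congr fun n => ?_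
    rw [hJn n t]
    ring
  -- The two-sided sum differs from J(t) only by values of g beyond t, which vanish in the limit.
  have htail : Tendsto (fun t => ∑' k : ℕ, g (t + (k + 1) * d)) atTop (𝓝 0) := by
    have hlim : Tendsto (fun t : ℝ => C * Real.exp (-(δ * t)) *
        ∑' k : ℕ, Real.exp (-(δ * d * k))) atTop (𝓝 0) := by
      have h1 : Tendsto (fun t : ℝ => Real.exp (-(δ * t))) atTop (𝓝 0) :=
        Real.tendsto_exp_neg_atTop_nhds_zero.comp (tendsto_id.const_mul_atTop hδ)
      simpa using (h1.const_mul C).mul_const (∑' k : ℕ, Real.exp (-(δ * d * k)))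
    refine squeeze_zero_norm' ?_ hlim
    filter_upwards [eventually_ge_atTop 0] with t ht
    rw [← tsum_mul_left]
    refine tsum_of_norm_bounded
      ((summable_exp_neg_nat (mul_pos hδ hd)).mul_left _).hasSum fun k => ?_
    refine (hg _).trans ?_
    rw [mul_assoc, ← Real.exp_add]
    have := hg.nonneg
    gcongr
    rw [abs_of_nonneg (by positivity)]
    nlinarith [mul_pos hδ hd]
  -- Invariance under multiples of d replaces every Z(t - kd) in J by Z(t).
  have hmid : Tendsto (fun t => (∑ i, q i * e i) * Z t - J t) atTop (𝓝 0) := by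
    have : Tendsto (fun t => ∑ i, q i * ∑ k ∈ Finset.range (e i), (Z t - Z (t - k * d))) atTop
        (𝓝 (∑ i, q i * ∑ k ∈ Finset.range (e i), 0)) :=
      tendsto_finsetSum _ fun i _ => Tendsto.const_mul _ (tendsto_finsetSum _ fun k _ => hkd k)
    simp only [Finset.sum_const_zero, mul_zero] at this
    refine this.congr fun t => ?_
    simp only [hJ, Finset.sum_sub_distrib, Finset.sum_const, Finset.card_range, nsmul_eq_mul,
      mul_sub, Finset.sum_mul, mul_assoc]
  have hm : 0 < ∑ i, q i * e i := by
    have hne : (Finset.univ : Finset ι).Nonempty := by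
      by_contra h
      rw [Finset.not_nonempty_iff_eq_empty] at h
      simp [h] at hq1
    exact Finset.sum_pos (fun i _ => mul_pos (hq i) (by exact_mod_cast he i)) hne
  have hmu : ∑ i, q i * x i = (∑ i, q i * e i) * d := by
    rw [Finset.sum_mul]
    exact Finset.sum_congr rfl fun i _ => by rw [hxe]; ring
  have hfin := (hmid.sub htail).const_mul (∑ i, q i * e i)⁻¹
  simp only [sub_zero, mul_zero] at hfin
  refine hfin.congr fun t => ?_
  have hsplit : ∑' m : ℤ, g (t - m * d) = J t + ∑' k : ℕ, g (t + (k + 1) * d) := by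
    have := (HasSum.of_nat_of_neg_add_one (f := fun m : ℤ => g (t - m * d))
      (m := J t) (m' := ∑' k : ℕ, g (t + (k + 1) * d)) ?_ ?_).tsum_eq
    · exact this
    · rw [← hJsum t]
      have hs : Summable (fun k : ℕ => g (t - k * d)) := by
        simpa [Function.comp_def] using (hgsum t).comp_injective Nat.cast_injective
      simpa using hs.hasSum
    · have hinj : Function.Injective (fun k : ℕ => -((k : ℤ) + 1)) := fun a b hab => by
        simpa using hab
      have hs := ((hgsum t).comp_injective hinj).hasSum
      have h2 : (fun m : ℤ => g (t - m * d)) ∘ (fun k : ℕ => -((k : ℤ) + 1)) =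
          fun k : ℕ => g (t + (k + 1) * d) := by
        funext k
        simp only [Function.comp]
        congr 1
        push_cast
        ring
      rw [h2] at hs
      convert! hs using 2 with k
      exact congrFun h2 k
  rw [hsplit, hmu, div_mul_cancel_right₀ hd.ne']
  rw [sub_sub, mul_sub, inv_mul_cancel_left₀ hm.ne']

end Lattice

/-! ### The nonlattice case -/

section NonLattice

theorem ExpBound.integrable {C δ : ℝ} (hδ : 0 < δ) {g : ℝ → ℝ} (hgc : Continuous g)
    (hg : ExpBound C δ g) : Integrable g := by
  have h : Integrable (fun s : ℝ => C * Real.exp (-(δ * |s|))) := by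
    refine Integrable.const_mul ?_ C
    have h1 : IntegrableOn (fun s : ℝ => Real.exp (-(δ * |s|))) (Set.Ioi 0) := by
      refine (exp_neg_integrableOn_Ioi 0 hδ).congr_fun (fun s hs => ?_) measurableSet_Ioi
      beta_reduce
      rw [abs_of_pos (Set.mem_Ioi.1 hs), neg_mul]
    have h2 : IntegrableOn (fun s : ℝ => Real.exp (-(δ * |s|))) (Set.Iic 0) := by
      refine (integrableOn_exp_mul_Iic hδ 0).congr_fun (fun s hs => ?_) measurableSet_Iic
      rw [abs_of_nonpos (Set.mem_Iic.1 hs)]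
      ring_nf
    rw [← integrableOn_univ, ← Set.Iic_union_Ioi (a := (0 : ℝ))]
    exact h2.union h1
  exact h.mono' hgc.aestronglyMeasurable (Eventually.of_forall hg)

/-- Small translates of g are close to g in an exponential weight, so the renewal function is
uniformly continuous on the whole line. -/
theorem exists_renewal_modulus (hq : ∀ i, 0 ≤ q i) (hq1 : ∑ i, q i = 1) (hx : ∀ i, 0 < x i)
    {C δ : ℝ} (hδ : 0 < δ) {g : ℝ → ℝ} (hgc : Continuous g) (hg : ExpBound C δ g) {ε : ℝ}
    (hε : 0 < ε) :
    ∀ᶠ h in 𝓝 0, ∀ t, |renewal q x g (t + h) - renewal q x g t| ≤ ε := by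
  obtain ⟨K, hK0, hK⟩ := exists_abs_renewal_le hq hq1 hx (half_pos hδ)
  have hb1 : ∀ h : ℝ, |h| ≤ 1 → ExpBound (C * Real.exp δ) δ (fun s => g (s + h)) := by
    intro h hh s
    refine (hg _).trans ?_
    rw [mul_assoc, ← Real.exp_add]
    have := hg.nonneg
    gcongr
    have : |s| ≤ |s + h| + |h| := by
      simpa using abs_sub (s + h) h
    nlinarith
  have hloc : TendstoLocallyUniformly (fun h s => g (s + h)) g (𝓝 (0 : ℝ)) := by
    rw [tendstoLocallyUniformly_iff_forall_tendsto]
    intro s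
    have h1 : Tendsto (fun y : ℝ × ℝ => g (y.2 + y.1)) (𝓝 0 ×ˢ 𝓝 s) (𝓝 (g (s + 0))) := by
      have : Continuous (fun y : ℝ × ℝ => g (y.2 + y.1)) := by fun_prop
      rw [← nhds_prod_eq]
      exact this.tendsto (0, s)
    have h2 : Tendsto (fun y : ℝ × ℝ => g y.2) (𝓝 0 ×ˢ 𝓝 s) (𝓝 (g s)) :=
      (hgc.tendsto s).comp tendsto_snd
    rw [add_zero] at h1
    exact (h2.prodMk_nhds h1).mono_right (nhds_le_uniformity _)
  have hsmall : ∀ᶠ h in 𝓝 (0 : ℝ), |h| ≤ 1 := by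
    filter_upwards [Metric.ball_mem_nhds (0 : ℝ) one_pos] with h hh
    have := Metric.mem_ball.1 hh
    rw [Real.dist_eq, sub_zero] at this
    exact this.le
  have h0 := hb1 0 (by simp)
  simp only [add_zero] at h0
  filter_upwards [eventually_expBound_sub hδ hloc (hsmall.mono hb1) h0
    (show 0 < ε / K by positivity), hsmall] with h hh h1 t
  have h2 := hK _ _ hh t
  rw [renewal_sub hq hq1 hx hδ hδ (hb1 h h1) hg, div_mul_cancel₀ _ hK0.ne'] at h2
  convert h2 using 3
  unfold renewal
  refine tsum_congr fun w => ?_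
  beta_reduce
  rw [sub_add_eq_add_sub]

/-- The renewal theorem in the nonlattice case. -/
theorem renewal_nonlattice (hq : ∀ i, 0 < q i) (hq1 : ∑ i, q i = 1) (hx : ∀ i, 0 < x i)
    (hdense : Dense (AddSubgroup.closure (Set.range x) : Set ℝ))
    {C δ : ℝ} (hδ : 0 < δ) {g : ℝ → ℝ} (hgc : Continuous g) (hg : ExpBound C δ g) :
    Tendsto (renewal q x g) atTop (𝓝 ((∑ i, q i * x i)⁻¹ * ∫ s, g s)) := by
  have hq0 : ∀ i, 0 ≤ q i := fun i => (hq i).le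
  set Z := renewal q x g with hZ
  obtain ⟨K, hK0, hK⟩ := exists_abs_renewal_le hq0 hq1 hx hδ
  have hZb : ∀ t, |Z t| ≤ C * K := hK C g hg
  have hmod := fun ε (hε : 0 < ε) => exists_renewal_modulus hq0 hq1 hx hδ hgc hg hε
  have hZc : Continuous Z := by
    rw [continuous_iff_continuousAt]
    intro t
    rw [ContinuousAt, Metric.tendsto_nhds]
    intro ε hε
    have h1 : Tendsto (fun s => s - t) (𝓝 t) (𝓝 0) := by
      have : Continuous (fun s : ℝ => s - t) := by fun_prop
      simpa using this.tendsto t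
    filter_upwards [h1.eventually (hmod (ε / 2) (half_pos hε))] with s hs
    have := hs t
    rw [add_sub_cancel] at this
    rw [Real.dist_eq]
    linarith
  -- The steps generate a dense group of admissible shifts; uniform continuity passes from a nearby
  -- group element k to an arbitrary h.
  have hshift : ∀ h, Tendsto (fun t => Z t - Z (t - h)) atTop (𝓝 0) := by
    intro h
    have hsub : (AddSubgroup.closure (Set.range x)) ≤ shiftGroup Z := by
      rw [AddSubgroup.closure_le]
      rintro _ ⟨i, rfl⟩
      exact tendsto_renewal_sub hq hq1 hx hδ hg i
    rw [Metric.tendsto_nhds]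
    intro ε hε
    have h1 : Tendsto (fun s => h - s) (𝓝 h) (𝓝 0) := by
      have : Continuous (fun s : ℝ => h - s) := by fun_prop
      simpa using this.tendsto h
    obtain ⟨U, hU, hUo, hhU⟩ := eventually_nhds_iff.1
      (h1.eventually (hmod (ε / 2) (half_pos hε)))
    obtain ⟨k, hkU, hk⟩ := hdense.inter_open_nonempty U hUo ⟨h, hhU⟩
    have h2 := mem_shiftGroup.1 (hsub hk)
    filter_upwards [Metric.tendsto_nhds.1 h2 (ε / 2) (half_pos hε)] with t ht
    have h3 := hU k hkU (t - h)
    rw [sub_add_sub_cancel] at h3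
    rw [Real.dist_eq, sub_zero] at ht ⊢
    have : Z t - Z (t - h) = (Z t - Z (t - k)) + (Z (t - k) - Z (t - h)) := by ring
    rw [this]
    exact (abs_add_le _ _).trans_lt (by linarith)
  -- The continuous analogue of the telescoping average: the renewal equation gives I' = g, and I
  -- vanishes at minus infinity, so I(t) is the integral of g over (-∞, t].
  set I : ℝ → ℝ := fun t => ∑ i, q i * ∫ s in (t - x i)..t, Z s with hI
  have hI2 : ∀ t, I t = ∑ i, q i * ∫ s in (0 : ℝ)..x i, Z (t - s) := by
    intro t
    simp only [hI, intervalIntegral.integral_comp_sub_left, sub_zero]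
  have hderiv : ∀ t, HasDerivAt I (g t) t := by
    intro t
    have h1 : HasDerivAt I (∑ i, q i * (Z t - Z (t - x i))) t := by
      refine HasDerivAt.fun_sum fun i _ => HasDerivAt.const_mul _ ?_
      have h2 : ∀ s, ∫ u in (s - x i)..s, Z u =
          (∫ u in (0 : ℝ)..s, Z u) - ∫ u in (0 : ℝ)..(s - x i), Z u := by
        intro s
        rw [intervalIntegral.integral_interval_sub_left] <;> exact hZc.intervalIntegrable _ _
      simp only [h2]
      have h3 : ∀ s, HasDerivAt (fun s => ∫ u in (0 : ℝ)..s, Z u) (Z s) s := fun s =>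
        intervalIntegral.integral_hasDerivAt_right (hZc.intervalIntegrable _ _)
          hZc.aestronglyMeasurable.stronglyMeasurableAtFilter hZc.continuousAt
      exact (h3 t).sub ((h3 (t - x i)).comp_sub_const t (x i))
    convert h1 using 1
    simp only [mul_sub, Finset.sum_sub_distrib, ← Finset.sum_mul, hq1, one_mul]
    rw [hZ, renewal_eq hq0 hq1 hx hδ hg t]
    ring
  have hbot : Tendsto I atBot (𝓝 0) := by
    have : Tendsto I atBot (𝓝 (∑ i, q i * ∫ s in (0 : ℝ)..x i, (0 : ℝ))) := by
      rw [show I = fun t => _ from funext hI2]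
      refine tendsto_finsetSum _ fun i _ => Tendsto.const_mul _ ?_
      refine intervalIntegral.tendsto_integral_filter_of_dominated_convergence (fun _ => C * K)
        (Eventually.of_forall fun t => (hZc.comp (by fun_prop)).aestronglyMeasurable)
        (Eventually.of_forall fun t => Eventually.of_forall fun s _ => hZb _)
        intervalIntegrable_const (Eventually.of_forall fun s _ => ?_)
      exact (renewal_tendsto_atBot hq0 hq1 hx hδ hg).comp
        (tendsto_atBot_add_const_right atBot (-s) tendsto_id)
    simpa using this
  have hIeq : ∀ t, I t = ∫ s in Set.Iic t, g s := by
    intro t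
    have h1 := intervalIntegral_tendsto_integral_Iic t (hg.integrable hδ hgc).integrableOn
      (tendsto_id (α := ℝ) (x := atBot))
    refine tendsto_nhds_unique ?_ h1
    have h2 : Tendsto (fun s => I t - I s) atBot (𝓝 (I t - 0)) := tendsto_const_nhds.sub hbot
    rw [sub_zero] at h2
    refine h2.congr fun s => ?_
    rw [intervalIntegral.integral_eq_sub_of_hasDerivAt (fun u _ => hderiv u)
      (hgc.intervalIntegrable _ _)]
    rfl
  have htop : Tendsto I atTop (𝓝 (∫ s, g s)) := by
    rw [show I = fun t => ∫ s in Set.Iic t, g s from funext hIeq]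
    have := (aecover_Iic (μ := volume) (tendsto_id (α := ℝ) (x := atTop))).integral_tendsto_of_countably_generated
      (hg.integrable hδ hgc)
    simpa using this
  -- By shift invariance and dominated convergence, each window integral of length x i is
  -- asymptotically x i · Z(t).
  have hmid : Tendsto (fun t => (∑ i, q i * x i) * Z t - I t) atTop (𝓝 0) := by
    have : Tendsto (fun t => ∑ i, q i * ∫ s in (0 : ℝ)..x i, (Z t - Z (t - s))) atTop
        (𝓝 (∑ i, q i * ∫ s in (0 : ℝ)..x i, (0 : ℝ))) := by
      refine tendsto_finsetSum _ fun i _ => Tendsto.const_mul _ ?_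
      refine intervalIntegral.tendsto_integral_filter_of_dominated_convergence
        (fun _ => C * K + C * K)
        (Eventually.of_forall fun t =>
          (continuous_const.sub (hZc.comp (by fun_prop))).aestronglyMeasurable)
        (Eventually.of_forall fun t => Eventually.of_forall fun s _ => ?_)
        intervalIntegrable_const (Eventually.of_forall fun s _ => hshift s)
      exact (abs_sub _ _).trans (add_le_add (hZb _) (hZb _))
    simp only [intervalIntegral.integral_zero, mul_zero, Finset.sum_const_zero] at this
    refine this.congr fun t => ?_
    rw [hI2, Finset.sum_mul, ← Finset.sum_sub_distrib]
    refine Finset.sum_congr rfl fun i _ => ?_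
    have hc : Continuous fun s => Z (t - s) := hZc.comp (by fun_prop)
    rw [intervalIntegral.integral_sub intervalIntegrable_const (hc.intervalIntegrable _ _),
      intervalIntegral.integral_const]
    simp only [sub_zero, smul_eq_mul]
    ring
  have hm : 0 < ∑ i, q i * x i := by
    have hne : (Finset.univ : Finset ι).Nonempty := by
      by_contra h
      rw [Finset.not_nonempty_iff_eq_empty] at h
      simp [h] at hq1
    exact Finset.sum_pos (fun i _ => mul_pos (hq i) (hx i)) hne
  have := (hmid.add htop).const_mul (∑ i, q i * x i)⁻¹
  rw [zero_add] at this
  refine this.congr fun t => ?_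
  field_simp
  ring

end NonLattice

end RenewalTheorem

end GTrie

end

noncomputable section

namespace GTrie

open Topology

/-! ### Binomial means -/

section BinomMean

/-- The mean of `τ` under the binomial distribution with parameters `n` and `p`. -/
def binomMean (p : ℝ) : (ℕ → ℝ) → ℕ → ℝ
  | τ, 0 => τ 0
  | τ, n + 1 => p * binomMean p (fun k => τ (k + 1)) n + (1 - p) * binomMean p τ n

@[simp] theorem binomMean_zero (p : ℝ) (τ : ℕ → ℝ) : binomMean p τ 0 = τ 0 := rfl

theorem binomMean_succ (p : ℝ) (τ : ℕ → ℝ) (n : ℕ) : binomMean p τ (n + 1) =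
    p * binomMean p (fun k => τ (k + 1)) n + (1 - p) * binomMean p τ n := rfl

theorem binomMean_add (p : ℝ) (τ σ : ℕ → ℝ) (n : ℕ) :
    binomMean p (fun k => τ k + σ k) n = binomMean p τ n + binomMean p σ n := by
  induction n generalizing τ σ with
  | zero => rfl
  | succ n ih => simp only [binomMean_succ, ih]; ring

theorem binomMean_const_mul (p c : ℝ) (τ : ℕ → ℝ) (n : ℕ) :
    binomMean p (fun k => c * τ k) n = c * binomMean p τ n := by
  induction n generalizing τ with
  | zero => rfl
  | succ n ih => simp only [binomMean_succ, ih]; ring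

theorem binomMean_sub (p : ℝ) (τ σ : ℕ → ℝ) (n : ℕ) :
    binomMean p (fun k => τ k - σ k) n = binomMean p τ n - binomMean p σ n := by
  induction n generalizing τ σ with
  | zero => rfl
  | succ n ih => simp only [binomMean_succ, ih]; ring

theorem binomMean_const (p c : ℝ) (n : ℕ) : binomMean p (fun _ => c) n = c := by
  induction n with
  | zero => rfl
  | succ n ih => simp only [binomMean_succ, ih]; ring

theorem binomMean_one (τ : ℕ → ℝ) (n : ℕ) : binomMean 1 τ n = τ n := by
  induction n generalizing τ with
  | zero => rfl
  | succ n ih => simp [binomMean_succ, ih]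

theorem binomMean_le {p : ℝ} (h0 : 0 ≤ p) (h1 : p ≤ 1) {τ σ : ℕ → ℝ} {n : ℕ}
    (h : ∀ k ≤ n, τ k ≤ σ k) : binomMean p τ n ≤ binomMean p σ n := by
  induction n generalizing τ σ with
  | zero => exact h 0 le_rfl
  | succ n ih =>
    simp only [binomMean_succ]
    have h2 := ih (fun k hk => h (k + 1) (by omega))
    have h3 := ih (τ := τ) (σ := σ) (fun k hk => h k (by omega))
    have : 0 ≤ 1 - p := by linarith
    gcongr

theorem binomMean_congr {p : ℝ} {τ σ : ℕ → ℝ} {n : ℕ}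
    (h : ∀ k ≤ n, τ k = σ k) : binomMean p τ n = binomMean p σ n := by
  induction n generalizing τ σ with
  | zero => exact h 0 le_rfl
  | succ n ih =>
    simp only [binomMean_succ]
    rw [ih (τ := τ) (σ := σ) (fun k hk => h k (by omega)),
      ih (τ := fun k => τ (k + 1)) (σ := fun k => σ (k + 1)) (fun k hk => h (k + 1) (by omega))]

theorem binomMean_nonneg {p : ℝ} (h0 : 0 ≤ p) (h1 : p ≤ 1) {τ : ℕ → ℝ} {n : ℕ}
    (h : ∀ k ≤ n, 0 ≤ τ k) : 0 ≤ binomMean p τ n := by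
  simpa [binomMean_const] using binomMean_le h0 h1 (τ := fun _ => 0) h

theorem abs_binomMean_le {p : ℝ} (h0 : 0 ≤ p) (h1 : p ≤ 1) {τ σ : ℕ → ℝ} {n : ℕ}
    (h : ∀ k ≤ n, |τ k| ≤ σ k) : |binomMean p τ n| ≤ binomMean p σ n := by
  rw [abs_le]
  constructor
  · have := binomMean_le h0 h1 (τ := fun k => -1 * σ k) (σ := τ) (n := n)
      (fun k hk => by have := (abs_le.1 (h k hk)).1; linarith)
    rw [binomMean_const_mul] at this
    linarith
  · exact binomMean_le h0 h1 fun k hk => (abs_le.1 (h k hk)).2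

/-- Thinning twice is thinning once. -/
theorem binomMean_binomMean (p q : ℝ) (τ : ℕ → ℝ) (n : ℕ) :
    binomMean p (binomMean q τ) n = binomMean (p * q) τ n := by
  induction n generalizing τ with
  | zero => rfl
  | succ n ih =>
    rw [binomMean_succ, binomMean_succ, ← ih, ← ih]
    simp only [binomMean_succ, binomMean_add, binomMean_const_mul]
    change _ = p * q * binomMean p (fun k => binomMean q (fun k => τ (k + 1)) k) n + _
    ring

theorem binomMean_succ_sub (p : ℝ) (τ : ℕ → ℝ) (n : ℕ) :
    binomMean p τ (n + 1) - binomMean p τ n = p * binomMean p (fun k => τ (k + 1) - τ k) n := by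
  rw [binomMean_succ, binomMean_sub]; ring

theorem hasSum_binomMean {α : Type*} {f : ℕ → α → ℝ} {s : ℕ → ℝ} (p : ℝ)
    (h : ∀ k, HasSum (f k) (s k)) (n : ℕ) :
    HasSum (fun w => binomMean p (fun k => f k w) n) (binomMean p s n) := by
  induction n generalizing f s with
  | zero => exact h 0
  | succ n ih =>
    simp only [binomMean_succ]
    exact ((ih fun k => h (k + 1)).mul_left p).add ((ih h).mul_left (1 - p))

theorem binomMean_single (p : ℝ) (j n : ℕ) :
    binomMean p (fun k => if k = j then 1 else 0) n = n.choose j * p ^ j * (1 - p) ^ (n - j) := by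
  induction n generalizing j with
  | zero => rcases j with _ | j <;> simp
  | succ n ih =>
    rw [binomMean_succ]
    rcases j with _ | j
    · have := binomMean_const p 0 n
      simp only [Nat.add_eq_zero_iff, one_ne_zero, and_false, if_false, this]
      rw [ih 0]
      simp [pow_succ]
      ring
    · simp only [Nat.add_right_cancel_iff]
      rw [ih j, ih (j + 1), Nat.choose_succ_succ, Nat.add_sub_add_right]
      push_cast
      rcases lt_or_ge n (j + 1) with h | h
      · rw [Nat.choose_eq_zero_of_lt h]
        simp
        ring
      · rw [show n - j = n - (j + 1) + 1 by omega, pow_succ (1 - p)]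
        ring

theorem binomMean_eq_sum (p : ℝ) (τ : ℕ → ℝ) (n : ℕ) : binomMean p τ n =
    ∑ k ∈ Finset.range (n + 1), n.choose k * p ^ k * (1 - p) ^ (n - k) * τ k := by
  have h1 : ∀ m, binomMean p (fun k => ∑ j ∈ Finset.range m, τ j * if k = j then 1 else 0) n =
      ∑ j ∈ Finset.range m, n.choose j * p ^ j * (1 - p) ^ (n - j) * τ j := by
    intro m
    induction m with
    | zero => simpa using binomMean_const p 0 n
    | succ m ih =>
      simp only [Finset.sum_range_succ, binomMean_add, ih, binomMean_const_mul, binomMean_single]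
      ring
  rw [← h1 (n + 1)]
  refine binomMean_congr fun k hk => ?_
  simp [Finset.mem_range, Nat.lt_succ_of_le hk]

/-- The free shift z closes the induction: a success in one trial only replaces z by z + 1. -/
theorem binomMean_add_sq (p z : ℝ) (n : ℕ) :
    binomMean p (fun k => ((k : ℝ) + z) ^ 2) n = (n * p + z) ^ 2 + n * p * (1 - p) := by
  induction n generalizing z with
  | zero => simp
  | succ n ih =>
    rw [binomMean_succ, ih]
    have : (fun k : ℕ => (((k + 1 : ℕ) : ℝ) + z) ^ 2) = fun k : ℕ => ((k : ℝ) + (z + 1)) ^ 2 := by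
      funext k; push_cast; ring
    rw [this, ih]
    push_cast
    ring

theorem binomMean_add_pow_four (p z : ℝ) (n : ℕ) :
    binomMean p (fun k => ((k : ℝ) + z) ^ 4) n = (n * p + z) ^ 4
      + 6 * (n * p * (1 - p)) * (n * p + z) ^ 2
      + 4 * (n * p * (1 - p) * (1 - 2 * p)) * (n * p + z)
      + n * p * (1 - p) * (1 + 3 * (n - 2) * p * (1 - p)) := by
  induction n generalizing z with
  | zero => simp
  | succ n ih =>
    rw [binomMean_succ, ih]
    have : (fun k : ℕ => (((k + 1 : ℕ) : ℝ) + z) ^ 4) = fun k : ℕ => ((k : ℝ) + (z + 1)) ^ 4 := by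
      funext k; push_cast; ring
    rw [this, ih]
    push_cast
    ring

theorem binomMean_mul_sub_one (p : ℝ) (n : ℕ) :
    binomMean p (fun k => (k : ℝ) * (k - 1)) n = n * (n - 1) * p ^ 2 := by
  have h : (fun k : ℕ => (k : ℝ) * (k - 1)) =
      fun k : ℕ => ((k : ℝ) + (-1 / 2)) ^ 2 - 1 / 4 := by funext k; ring
  rw [h, binomMean_sub, binomMean_add_sq, binomMean_const]
  ring

/-- Functions vanishing at `0` and `1` have small mean for small `p`. -/
theorem abs_binomMean_le_sq {p : ℝ} (h0 : 0 ≤ p) (h1 : p ≤ 1) {τ : ℕ → ℝ} (t0 : τ 0 = 0)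
    (t1 : τ 1 = 0) {n : ℕ} {C : ℝ} (h : ∀ k ≤ n, |τ k| ≤ C) :
    |binomMean p τ n| ≤ C * n ^ 2 * p ^ 2 := by
  have hC : 0 ≤ C := (abs_nonneg _).trans (h 0 (Nat.zero_le _))
  have h2 : |binomMean p τ n| ≤ binomMean p (fun k => C * ((k : ℝ) * (k - 1))) n := by
    refine abs_binomMean_le h0 h1 fun k hk => ?_
    rcases k with _ | _ | k
    · simp [t0]
    · simp [t1]
    · refine (h _ hk).trans ?_
      push_cast
      refine le_mul_of_one_le_right hC ?_
      have : (0 : ℝ) ≤ k := Nat.cast_nonneg k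
      nlinarith
  refine h2.trans ?_
  rw [binomMean_const_mul, binomMean_mul_sub_one]
  have hn : (0 : ℝ) ≤ n := Nat.cast_nonneg n
  have h3 : (n : ℝ) * (n - 1) * p ^ 2 ≤ n ^ 2 * p ^ 2 := by
    gcongr
    nlinarith
  nlinarith

end BinomMean

/-! ### Means of functions of two correlated counts -/

section PairMean

/-- The mean of `φ N N'`, where `(N, N')` is a sum of `n` independent copies of a random element of
`{0, 1} × {0, 1}` with masses `a` at `(1, 1)`, `b` at `(1, 0)` and `c` at `(0, 1)`. -/
def pairMean (a b c : ℝ) : (ℕ → ℕ → ℝ) → ℕ → ℝ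
  | φ, 0 => φ 0 0
  | φ, n + 1 => a * pairMean a b c (fun k l => φ (k + 1) (l + 1)) n
      + b * pairMean a b c (fun k l => φ (k + 1) l) n
      + c * pairMean a b c (fun k l => φ k (l + 1)) n
      + (1 - a - b - c) * pairMean a b c φ n

@[simp] theorem pairMean_zero (a b c : ℝ) (φ : ℕ → ℕ → ℝ) : pairMean a b c φ 0 = φ 0 0 := rfl

theorem pairMean_succ (a b c : ℝ) (φ : ℕ → ℕ → ℝ) (n : ℕ) : pairMean a b c φ (n + 1) =
    a * pairMean a b c (fun k l => φ (k + 1) (l + 1)) n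
      + b * pairMean a b c (fun k l => φ (k + 1) l) n
      + c * pairMean a b c (fun k l => φ k (l + 1)) n
      + (1 - a - b - c) * pairMean a b c φ n := rfl

theorem pairMean_add (a b c : ℝ) (φ ψ : ℕ → ℕ → ℝ) (n : ℕ) :
    pairMean a b c (fun k l => φ k l + ψ k l) n = pairMean a b c φ n + pairMean a b c ψ n := by
  induction n generalizing φ ψ with
  | zero => rfl
  | succ n ih => simp only [pairMean_succ, ih]; ring

theorem pairMean_const_mul (a b c r : ℝ) (φ : ℕ → ℕ → ℝ) (n : ℕ) :
    pairMean a b c (fun k l => r * φ k l) n = r * pairMean a b c φ n := by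
  induction n generalizing φ with
  | zero => rfl
  | succ n ih => simp only [pairMean_succ, ih]; ring

theorem hasSum_pairMean {α : Type*} {f : ℕ → ℕ → α → ℝ} {s : ℕ → ℕ → ℝ} (a b c : ℝ)
    (h : ∀ k l, HasSum (f k l) (s k l)) (n : ℕ) :
    HasSum (fun w => pairMean a b c (fun k l => f k l w) n) (pairMean a b c s n) := by
  induction n generalizing f s with
  | zero => exact h 0 0
  | succ n ih =>
    simp only [pairMean_succ]
    exact ((((ih fun k l => h (k + 1) (l + 1)).mul_left a).add
      ((ih fun k l => h (k + 1) l).mul_left b)).add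
      ((ih fun k l => h k (l + 1)).mul_left c)).add ((ih h).mul_left (1 - a - b - c))

/-- Each trial first survives with probability q and only then feeds the two counts. This handles
two paths with a common first letter. -/
theorem pairMean_thin (q a b c : ℝ) (φ : ℕ → ℕ → ℝ) (n : ℕ) :
    pairMean (q * a) (q * b) (q * c) φ n = binomMean q (pairMean a b c φ) n := by
  induction n generalizing φ with
  | zero => rfl
  | succ n ih =>
    rw [pairMean_succ, binomMean_succ, ih, ih, ih, ih]
    simp only [pairMean_succ, binomMean_add, binomMean_const_mul]
    ring_nf

/-- With mass p·p' at (1, 1), the two indicators in each trial are independent, and so are the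
counts. -/
theorem pairMean_indep (p p' : ℝ) (φ ψ : ℕ → ℝ) (n : ℕ) :
    pairMean (p * p') (p - p * p') (p' - p * p') (fun k l => φ k * ψ l) n =
      binomMean p φ n * binomMean p' ψ n := by
  induction n generalizing φ ψ with
  | zero => rfl
  | succ n ih =>
    rw [pairMean_succ, binomMean_succ, binomMean_succ, ih, ih φ, ih, ih]
    ring

/-- Two exclusive classes of trials are thinned separately. This handles two paths that put
different letters on the same first edge. -/
theorem pairMean_excl (q q' p p' : ℝ) (φ ψ : ℕ → ℝ) (n : ℕ) :
    pairMean 0 (q * p) (q' * p') (fun k l => φ k * ψ l) n =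
      pairMean 0 q q' (fun k l => binomMean p φ k * binomMean p' ψ l) n := by
  induction n generalizing φ ψ with
  | zero => rfl
  | succ n ih =>
    rw [pairMean_succ, pairMean_succ, ih (fun k => φ (k + 1)) ψ, ih φ, ih φ ψ]
    simp only [binomMean_succ, add_mul, mul_add, pairMean_add, zero_mul, zero_add]
    have h1 : ∀ (f : ℕ → ℕ → ℝ) (r : ℝ), (pairMean 0 q q' (fun k l => r * f k l) n) =
      r * pairMean 0 q q' f n := fun f r => pairMean_const_mul _ _ _ _ _ _
    simp only [mul_assoc, mul_left_comm (binomMean p φ _), h1]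
    ring

end PairMean

/-! ### Multinomial means and variances -/

section MultMean

variable {ι : Type*} [Fintype ι] [DecidableEq ι]

/-- The mean of `τ` under the multinomial distribution with parameters `n` and `p`. -/
def multMean (p : ι → ℝ) : ((ι → ℕ) → ℝ) → ℕ → ℝ
  | τ, 0 => τ 0
  | τ, n + 1 => ∑ i, p i * multMean p (fun x => τ (x + Pi.single i 1)) n

@[simp] theorem multMean_zero (p : ι → ℝ) (τ : (ι → ℕ) → ℝ) : multMean p τ 0 = τ 0 := rfl

theorem multMean_succ (p : ι → ℝ) (τ : (ι → ℕ) → ℝ) (n : ℕ) : multMean p τ (n + 1) =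
    ∑ i, p i * multMean p (fun x => τ (x + Pi.single i 1)) n := rfl

theorem multMean_add (p : ι → ℝ) (τ σ : (ι → ℕ) → ℝ) (n : ℕ) :
    multMean p (fun x => τ x + σ x) n = multMean p τ n + multMean p σ n := by
  induction n generalizing τ σ with
  | zero => rfl
  | succ n ih => simp only [multMean_succ, ih, mul_add, Finset.sum_add_distrib]

theorem multMean_const_mul (p : ι → ℝ) (c : ℝ) (τ : (ι → ℕ) → ℝ) (n : ℕ) :
    multMean p (fun x => c * τ x) n = c * multMean p τ n := by
  induction n generalizing τ with
  | zero => rfl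
  | succ n ih => simp only [multMean_succ, ih, mul_left_comm _ c, Finset.mul_sum]

theorem multMean_sum (p : ι → ℝ) {α : Type*} (s : Finset α) (τ : α → (ι → ℕ) → ℝ) (n : ℕ) :
    multMean p (fun x => ∑ a ∈ s, τ a x) n = ∑ a ∈ s, multMean p (τ a) n := by
  induction n generalizing τ with
  | zero => rfl
  | succ n ih =>
    simp only [multMean_succ, ih, Finset.mul_sum]
    exact Finset.sum_comm

theorem multMean_const {p : ι → ℝ} (hp : ∑ i, p i = 1) (c : ℝ) (n : ℕ) :
    multMean p (fun _ => c) n = c := by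
  induction n with
  | zero => rfl
  | succ n ih => simp only [multMean_succ, ih, ← Finset.sum_mul, hp, one_mul]

theorem multMean_le {p : ι → ℝ} (h0 : ∀ i, 0 ≤ p i) {τ σ : (ι → ℕ) → ℝ} {n : ℕ}
    (h : ∀ x, ∑ i, x i = n → τ x ≤ σ x) : multMean p τ n ≤ multMean p σ n := by
  induction n generalizing τ σ with
  | zero => exact h 0 (by simp)
  | succ n ih =>
    simp only [multMean_succ]
    refine Finset.sum_le_sum fun i _ => mul_le_mul_of_nonneg_left (ih fun x hx => h _ ?_) (h0 i)
    simp [Finset.sum_add_distrib, hx]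

theorem multMean_congr {p : ι → ℝ} (h0 : ∀ i, 0 ≤ p i) {τ σ : (ι → ℕ) → ℝ} {n : ℕ}
    (h : ∀ x, ∑ i, x i = n → τ x = σ x) : multMean p τ n = multMean p σ n :=
  le_antisymm (multMean_le h0 fun x hx => (h x hx).le) (multMean_le h0 fun x hx => (h x hx).ge)

theorem multMean_apply {p : ι → ℝ} (hp : ∑ i, p i = 1) (j : ι) (τ : ℕ → ℝ) (n : ℕ) :
    multMean p (fun x => τ (x j)) n = binomMean (p j) τ n := by
  induction n generalizing τ with
  | zero => rfl
  | succ n ih =>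
    rw [multMean_succ, binomMean_succ, ← Finset.add_sum_erase _ _ (Finset.mem_univ j)]
    congr 1
    · simp only [Pi.add_apply, Pi.single_eq_same]
      rw [ih (fun k => τ (k + 1))]
    · rw [← hp, ← Finset.add_sum_erase _ _ (Finset.mem_univ j), add_sub_cancel_left,
        Finset.sum_mul]
      refine Finset.sum_congr rfl fun i hi => ?_
      have : j ≠ i := (Finset.ne_of_mem_erase hi).symm
      simp only [Pi.add_apply, Pi.single_eq_of_ne this, add_zero, ih]

/-- One trial never increases two different coordinates, hence the mass 0 at (1, 1). -/
theorem multMean_apply₂ {p : ι → ℝ} (hp : ∑ i, p i = 1) {j j' : ι} (hj : j ≠ j')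
    (φ : ℕ → ℕ → ℝ) (n : ℕ) :
    multMean p (fun x => φ (x j) (x j')) n = pairMean 0 (p j) (p j') φ n := by
  induction n generalizing φ with
  | zero => rfl
  | succ n ih =>
    have hj' : j' ∈ Finset.univ.erase j := Finset.mem_erase.2 ⟨hj.symm, Finset.mem_univ _⟩
    rw [multMean_succ, pairMean_succ, ← Finset.add_sum_erase _ _ (Finset.mem_univ j),
      ← Finset.add_sum_erase _ _ hj']
    have h3 : 1 - 0 - p j - p j' = ∑ i ∈ (Finset.univ.erase j).erase j', p i := by
      rw [← hp, ← Finset.add_sum_erase _ _ (Finset.mem_univ j), ← Finset.add_sum_erase _ _ hj']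
      ring
    have h4 : ∑ i ∈ (Finset.univ.erase j).erase j',
        p i * multMean p (fun x : ι → ℕ =>
          φ ((x + Pi.single i 1 : ι → ℕ) j) ((x + Pi.single i 1 : ι → ℕ) j')) n =
        (1 - 0 - p j - p j') * pairMean 0 (p j) (p j') φ n := by
      rw [h3, Finset.sum_mul]
      refine Finset.sum_congr rfl fun i hi => ?_
      have h5 : j' ≠ i := (Finset.ne_of_mem_erase hi).symm
      have h6 : j ≠ i := (Finset.ne_of_mem_erase (Finset.mem_of_mem_erase hi)).symm
      simp only [Pi.add_apply, Pi.single_eq_of_ne h5, Pi.single_eq_of_ne h6, add_zero, ih]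
    rw [h4]
    simp only [Pi.add_apply, Pi.single_eq_same, Pi.single_eq_of_ne hj, Pi.single_eq_of_ne hj.symm,
      add_zero]
    rw [ih (fun k l => φ (k + 1) l), ih (fun k l => φ k (l + 1))]
    ring

theorem multMean_linear_sq {p : ι → ℝ} (hp : ∑ i, p i = 1) (D : ι → ℝ) (z : ℝ) (n : ℕ) :
    multMean p (fun x => (∑ j, D j * x j + z) ^ 2) n =
      (n * (∑ j, p j * D j) + z) ^ 2
        + n * (∑ j, p j * D j ^ 2 - (∑ j, p j * D j) ^ 2) := by
  induction n generalizing z with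
  | zero => simp
  | succ n ih =>
    rw [multMean_succ]
    have h1 : ∀ i, (fun x : ι → ℕ => (∑ j, D j * ((x + Pi.single i 1 : ι → ℕ) j : ℝ) + z) ^ 2) =
        fun x : ι → ℕ => (∑ j, D j * x j + (z + D i)) ^ 2 := by
      intro i
      funext x
      congr 1
      simp only [Pi.add_apply, Nat.cast_add, mul_add, Finset.sum_add_distrib, Pi.single_apply,
        Nat.cast_ite, Nat.cast_one, Nat.cast_zero, mul_ite, mul_one, mul_zero,
        Finset.sum_ite_eq', Finset.mem_univ, if_true]
      ring
    simp only [h1, ih]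
    set m := ∑ j, p j * D j with hm
    set v := ∑ j, p j * D j ^ 2 with hv
    have h2 : ∀ i, p i * ((n * m + (z + D i)) ^ 2 + n * (v - m ^ 2)) =
        p i * ((n * m + z) ^ 2 + n * (v - m ^ 2)) + (2 * (n * m + z)) * (p i * D i)
          + p i * D i ^ 2 := fun i => by ring
    simp only [h2, Finset.sum_add_distrib, ← Finset.sum_mul, ← Finset.mul_sum, hp, ← hm, ← hv]
    push_cast
    ring

/-- The second-moment formulas for the shifts z and z + 1 differ by an affine function of the mean.
-/
theorem multMean_linear {p : ι → ℝ} (hp : ∑ i, p i = 1) (D : ι → ℝ) (z : ℝ) (n : ℕ) :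
    multMean p (fun x => ∑ j, D j * x j + z) n = n * (∑ j, p j * D j) + z := by
  have h1 := multMean_linear_sq hp D (z + 1) n
  have h2 := multMean_linear_sq hp D z n
  have h3 : (fun x : ι → ℕ => (∑ j, D j * x j + (z + 1)) ^ 2) =
    fun x : ι → ℕ => (∑ j, D j * x j + z) ^ 2 + (2 * (∑ j, D j * x j + z) + 1) := by
    funext x; ring
  rw [h3, multMean_add, h2, multMean_add, multMean_const hp, multMean_const_mul] at h1
  linarith

/-- The variance of `τ` under the multinomial distribution. -/
def multVar (p : ι → ℝ) (τ : (ι → ℕ) → ℝ) (n : ℕ) : ℝ :=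
  multMean p (fun x => τ x ^ 2) n - multMean p τ n ^ 2

theorem multMean_sub_sq {p : ι → ℝ} (hp : ∑ i, p i = 1) (τ : (ι → ℕ) → ℝ) (c : ℝ) (n : ℕ) :
    multMean p (fun x => (τ x - c) ^ 2) n =
      multVar p τ n + (multMean p τ n - c) ^ 2 := by
  have : (fun x => (τ x - c) ^ 2) = fun x => (τ x ^ 2 + ((-2 * c) * τ x + c ^ 2)) := by
    funext x; ring
  rw [this, multMean_add, multMean_add, multMean_const hp, multMean_const_mul, multVar]
  ring

theorem multVar_nonneg {p : ι → ℝ} (h0 : ∀ i, 0 ≤ p i) (hp : ∑ i, p i = 1)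
    (τ : (ι → ℕ) → ℝ) (n : ℕ) : 0 ≤ multVar p τ n := by
  have h1 := multMean_sub_sq hp τ (multMean p τ n) n
  have h2 : multMean p (fun _ => 0) n ≤ multMean p (fun x => (τ x - multMean p τ n) ^ 2) n :=
    multMean_le h0 fun x _ => sq_nonneg _
  rw [multMean_const hp, h1] at h2
  simpa using h2

theorem multVar_le {p : ι → ℝ} (hp : ∑ i, p i = 1)
    (τ : (ι → ℕ) → ℝ) (c : ℝ) (n : ℕ) :
    multVar p τ n ≤ multMean p (fun x => (τ x - c) ^ 2) n := by
  rw [multMean_sub_sq hp]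
  linarith [sq_nonneg (multMean p τ n - c)]

theorem multVar_add_const {p : ι → ℝ} (hp : ∑ i, p i = 1)
    (τ : (ι → ℕ) → ℝ) (c : ℝ) (n : ℕ) :
    multVar p (fun x => τ x + c) n = multVar p τ n := by
  have : (fun x => (τ x + c) ^ 2) = fun x => (τ x ^ 2 + ((2 * c) * τ x + c ^ 2)) := by
    funext x; ring
  rw [multVar, multVar, this, multMean_add, multMean_add, multMean_add, multMean_const hp,
    multMean_const hp, multMean_const_mul]
  ring

theorem multVar_congr {p : ι → ℝ} (h0 : ∀ i, 0 ≤ p i) {τ σ : (ι → ℕ) → ℝ} {n : ℕ}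
    (h : ∀ x, ∑ i, x i = n → τ x = σ x) : multVar p τ n = multVar p σ n := by
  rw [multVar, multVar, multMean_congr h0 h,
    multMean_congr h0 (τ := fun x => τ x ^ 2) (σ := fun x => σ x ^ 2) fun x hx => by
      rw [h x hx]]

/-- Adding a function of small variance changes the variance little. -/
theorem abs_multVar_add_sub_le {p : ι → ℝ} (h0 : ∀ i, 0 ≤ p i) (hp : ∑ i, p i = 1)
    (τ σ : (ι → ℕ) → ℝ) (n : ℕ) {r : ℝ} (hr : 0 < r) :
    |multVar p (fun x => τ x + σ x) n - multVar p τ n| ≤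
      r⁻¹ * multVar p τ n + (r + 1) * multVar p σ n := by
  have hexp : ∀ c d : ℝ, multVar p (fun x => c * τ x + d * σ x) n =
      c ^ 2 * multVar p τ n + c * d * (multVar p (fun x => τ x + σ x) n - multVar p τ n
        - multVar p σ n) + d ^ 2 * multVar p σ n := by
    intro c d
    have h1 : (fun x => (c * τ x + d * σ x) ^ 2) =
        fun x => c ^ 2 * τ x ^ 2 + ((2 * c * d) * (τ x * σ x) + d ^ 2 * σ x ^ 2) := by
      funext x; ring
    have h2 : (fun x => (τ x + σ x) ^ 2) = fun x => τ x ^ 2 + (2 * (τ x * σ x) + σ x ^ 2) := by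
      funext x; ring
    simp only [multVar, h1, h2, multMean_add, multMean_const_mul]
    ring
  -- The variances of s⁻¹τ + sσ and s⁻¹τ - sσ are nonnegative; this bounds twice the covariance by
  -- r⁻¹ Var τ + r Var σ.
  set s := Real.sqrt r with hs
  have hs0 : 0 < s := Real.sqrt_pos.2 hr
  have hss : s ^ 2 = r := Real.sq_sqrt hr.le
  have h1 := hexp s⁻¹ s
  have h2 := hexp s⁻¹ (-s)
  have h3 := multVar_nonneg h0 hp (fun x => s⁻¹ * τ x + s * σ x) n
  have h4 := multVar_nonneg h0 hp (fun x => s⁻¹ * τ x + -s * σ x) n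
  have h5 := multVar_nonneg h0 hp σ n
  have h6 := multVar_nonneg h0 hp τ n
  rw [h1, inv_pow, hss, inv_mul_cancel₀ hs0.ne'] at h3
  rw [h2, inv_pow, neg_sq, hss, mul_neg, inv_mul_cancel₀ hs0.ne'] at h4
  rw [abs_le]
  constructor <;> nlinarith

end MultMean

end GTrie

end

noncomputable section

namespace GTrie

open Topology

/-! ### Poisson limits and bounds for binomial means -/

section Poisson

/-- The mean of `τ` under the Poisson distribution with parameter `y`. -/
def poissonMean (τ : ℕ → ℝ) (y : ℝ) : ℝ :=
  ∑' k : ℕ, Real.exp (-y) * y ^ k / k.factorial * τ k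

/-- The limit is joint in n and y, as local uniformity will require. The upper bound is exp(-y). The
lower bound combines Bernoulli's inequality for (1 - y²/n²)^n with 1 + y/n ≤ exp(y/n). -/
theorem tendsto_one_sub_div_pow (y₀ : ℝ) (h0 : 0 < y₀) :
    Tendsto (fun z : ℕ × ℝ => (1 - z.2 / z.1) ^ z.1) (atTop ×ˢ 𝓝 y₀) (𝓝 (Real.exp (-y₀))) := by
  have hn : Tendsto (fun z : ℕ × ℝ => (z.1 : ℝ)) (atTop ×ˢ 𝓝 y₀) atTop :=
    tendsto_natCast_atTop_atTop.comp tendsto_fst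
  have hy : Tendsto (fun z : ℕ × ℝ => z.2) (atTop ×ˢ 𝓝 y₀) (𝓝 y₀) := tendsto_snd
  have hexp : Tendsto (fun z : ℕ × ℝ => Real.exp (-z.2)) (atTop ×ˢ 𝓝 y₀) (𝓝 (Real.exp (-y₀))) :=
    (Real.continuous_exp.tendsto _).comp hy.neg
  have hlow : Tendsto (fun z : ℕ × ℝ => Real.exp (-z.2) * (1 - z.2 ^ 2 / z.1)) (atTop ×ˢ 𝓝 y₀)
      (𝓝 (Real.exp (-y₀))) := by
    have := hexp.mul (tendsto_const_nhds (x := (1 : ℝ)).sub ((hy.pow 2).div_atTop hn))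
    simpa using this
  have hev : ∀ᶠ z : ℕ × ℝ in atTop ×ˢ 𝓝 y₀, 0 < z.2 ∧ z.2 ≤ z.1 ∧ (1 : ℝ) ≤ z.1 := by
    filter_upwards [hy.eventually (lt_mem_nhds h0), hy.eventually (gt_mem_nhds (lt_add_one y₀)),
      hn.eventually (eventually_ge_atTop (y₀ + 1))] with z h1 h2 h3
    exact ⟨h1, by linarith, by linarith⟩
  refine tendsto_of_tendsto_of_tendsto_of_le_of_le' hlow hexp ?_ ?_
  · filter_upwards [hev] with z hz
    obtain ⟨h1, h2, h3⟩ := hz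
    set n := z.1
    set y := z.2
    have hn0 : (0 : ℝ) < n := by linarith
    have hyn : y / n ≤ 1 := (div_le_one hn0).2 h2
    have hyn0 : 0 < y / n := by positivity
    have h4 : 1 + (n : ℝ) * (-(y / n) ^ 2) ≤ (1 + (-(y / n) ^ 2)) ^ n :=
      one_add_mul_le_pow (by nlinarith) n
    have h5 : (1 + (-(y / n) ^ 2)) ^ n ≤ ((1 - y / n) * Real.exp (y / n)) ^ n := by
      refine pow_le_pow_left₀ (by nlinarith) ?_ n
      have := Real.add_one_le_exp (y / n)
      nlinarith
    have h6 : Real.exp (y / n) ^ n = Real.exp y := by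
      rw [← Real.exp_nat_mul, mul_div_cancel₀ _ hn0.ne']
    rw [mul_pow, h6] at h5
    have h7 : 1 - y ^ 2 / n ≤ (1 - y / n) ^ n * Real.exp y := by
      refine le_trans (le_of_eq ?_) (h4.trans h5)
      field_simp
      ring
    calc Real.exp (-y) * (1 - y ^ 2 / n) ≤ Real.exp (-y) * ((1 - y / n) ^ n * Real.exp y) := by
          gcongr
      _ = (1 - y / n) ^ n * (Real.exp (-y) * Real.exp y) := by ring
      _ = (1 - y / n) ^ n := by rw [← Real.exp_add]; simp
  · filter_upwards [hev] with z hz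
    exact Real.one_sub_div_pow_le_exp_neg hz.2.1

theorem tendsto_choose_mul_pow (k : ℕ) (y₀ : ℝ) (h0 : 0 < y₀) :
    Tendsto (fun z : ℕ × ℝ => (z.1.choose k : ℝ) * (z.2 / z.1) ^ k * (1 - z.2 / z.1) ^ (z.1 - k))
      (atTop ×ˢ 𝓝 y₀) (𝓝 (Real.exp (-y₀) * y₀ ^ k / k.factorial)) := by
  have hn : Tendsto (fun z : ℕ × ℝ => (z.1 : ℝ)) (atTop ×ˢ 𝓝 y₀) atTop :=
    tendsto_natCast_atTop_atTop.comp tendsto_fst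
  have hy : Tendsto (fun z : ℕ × ℝ => z.2) (atTop ×ˢ 𝓝 y₀) (𝓝 y₀) := tendsto_snd
  have hch : Tendsto (fun z : ℕ × ℝ => (z.1.choose k : ℝ) * (1 / z.1) ^ k) (atTop ×ˢ 𝓝 y₀)
      (𝓝 (1 ^ k / k.factorial)) := by
    refine (ProbabilityTheory.tendsto_choose_mul_pow_atTop (p := fun n => 1 / n) (r := 1) k
      ?_).comp tendsto_fst
    refine tendsto_const_nhds.congr' ?_
    filter_upwards [eventually_ge_atTop 1] with n hn
    field_simp
  have hdiv : Tendsto (fun z : ℕ × ℝ => 1 - z.2 / z.1) (atTop ×ˢ 𝓝 y₀) (𝓝 (1 - 0)) :=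
    tendsto_const_nhds.sub (hy.div_atTop hn)
  have hmain := ((hch.mul (hy.pow k)).mul (tendsto_one_sub_div_pow y₀ h0)).mul
    ((hdiv.pow k).inv₀ (by simp))
  have hlim : (1 : ℝ) ^ k / k.factorial * y₀ ^ k * Real.exp (-y₀) * ((1 - 0) ^ k)⁻¹ =
      Real.exp (-y₀) * y₀ ^ k / k.factorial := by
    simp; ring
  rw [hlim] at hmain
  refine hmain.congr' ?_
  have hev : ∀ᶠ z : ℕ × ℝ in atTop ×ˢ 𝓝 y₀, (1 : ℝ) / 2 < 1 - z.2 / z.1 :=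
    hdiv.eventually (lt_mem_nhds (by norm_num))
  filter_upwards [hev, tendsto_fst.eventually (eventually_ge_atTop k)] with z h1 h2
  rw [pow_sub₀ _ (by linarith) h2, div_pow, div_pow, one_pow]
  ring

variable {τ : ℕ → ℝ} {C σ : ℝ}

theorem abs_le_mul_four_pow (hσ2 : σ ≤ 2) (hC : 0 ≤ C) (t0 : τ 0 = 0)
    (hτ : ∀ k : ℕ, |τ k| ≤ C * (k : ℝ) ^ σ) (k : ℕ) : |τ k| ≤ C * 4 ^ k := by
  rcases k with _ | k
  · simpa [t0] using hC
  refine (hτ _).trans ?_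
  have h1 : ((k + 1 : ℕ) : ℝ) ^ σ ≤ ((k + 1 : ℕ) : ℝ) ^ (2 : ℝ) :=
    Real.rpow_le_rpow_of_exponent_le (by exact_mod_cast Nat.succ_le_succ (Nat.zero_le k)) hσ2
  have h2 : ((k + 1 : ℕ) : ℝ) ≤ 2 ^ (k + 1) := by exact_mod_cast (Nat.lt_two_pow_self).le
  rw [Real.rpow_two] at h1
  have h3 : ((k + 1 : ℕ) : ℝ) ^ 2 ≤ 4 ^ (k + 1) := by
    calc ((k + 1 : ℕ) : ℝ) ^ 2 ≤ (2 ^ (k + 1)) ^ 2 := by gcongr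
      _ = 4 ^ (k + 1) := by rw [← pow_mul, mul_comm, pow_mul]; norm_num
  gcongr
  exact h1.trans h3

theorem summable_poisson_bound (R : ℝ) : Summable (fun k : ℕ => R ^ k / k.factorial * (C * 4 ^ k)) := by
  have := (Real.summable_pow_div_factorial (R * 4)).mul_left C
  refine this.congr fun k => ?_
  rw [mul_pow]
  ring

/-- Dominated convergence over k: near y₀ the weights are at most (y₀ + 1)^k / k!, which absorbs the
crude bound C·4^k for τ. -/
theorem tendsto_binomMean_poissonMean (hσ2 : σ ≤ 2) (hC : 0 ≤ C) (t0 : τ 0 = 0)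
    (hτ : ∀ k : ℕ, |τ k| ≤ C * (k : ℝ) ^ σ) (y₀ : ℝ) (h0 : 0 < y₀) :
    Tendsto (fun z : ℕ × ℝ => binomMean (z.2 / z.1) τ z.1) (atTop ×ˢ 𝓝 y₀)
      (𝓝 (poissonMean τ y₀)) := by
  have hb := abs_le_mul_four_pow hσ2 hC t0 hτ
  have h1 : ∀ z : ℕ × ℝ, binomMean (z.2 / z.1) τ z.1 =
      ∑' k : ℕ, (z.1.choose k : ℝ) * (z.2 / z.1) ^ k * (1 - z.2 / z.1) ^ (z.1 - k) * τ k := by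
    intro z
    rw [binomMean_eq_sum, tsum_eq_sum]
    intro k hk
    rw [Nat.choose_eq_zero_of_lt (by simpa using hk)]
    simp
  simp only [h1]
  refine tendsto_tsum_of_dominated_convergence
    (summable_poisson_bound (C := C) (y₀ + 1))
    (fun k => (tendsto_choose_mul_pow k y₀ h0).mul_const (τ k)) ?_
  have hn : Tendsto (fun z : ℕ × ℝ => (z.1 : ℝ)) (atTop ×ˢ 𝓝 y₀) atTop :=
    tendsto_natCast_atTop_atTop.comp tendsto_fst
  have hy : Tendsto (fun z : ℕ × ℝ => z.2) (atTop ×ˢ 𝓝 y₀) (𝓝 y₀) := tendsto_snd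
  filter_upwards [hy.eventually (lt_mem_nhds h0), hy.eventually (gt_mem_nhds (lt_add_one y₀)),
      hn.eventually (eventually_ge_atTop (y₀ + 1))] with z h2 h3 h4 k
  have hz : (0 : ℝ) < z.1 := by linarith
  have h5 : z.2 / z.1 ≤ 1 := (div_le_one hz).2 (by linarith)
  have h6 : 0 ≤ z.2 / z.1 := by positivity
  rw [Real.norm_eq_abs, abs_mul, abs_of_nonneg (by
    have : 0 ≤ 1 - z.2 / z.1 := by linarith
    positivity)]
  have h7 : (z.1.choose k : ℝ) * (z.2 / z.1) ^ k ≤ (y₀ + 1) ^ k / k.factorial := by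
    calc (z.1.choose k : ℝ) * (z.2 / z.1) ^ k ≤ (z.1 : ℝ) ^ k / k.factorial * (z.2 / z.1) ^ k := by
          gcongr
          exact Nat.choose_le_pow_div k z.1
      _ = z.2 ^ k / k.factorial := by rw [div_pow]; field_simp
      _ ≤ _ := by gcongr
  have h8 : (1 - z.2 / z.1) ^ (z.1 - k) ≤ 1 := pow_le_one₀ (by linarith) (by linarith)
  have h9 : 0 ≤ (1 - z.2 / z.1) ^ (z.1 - k) := pow_nonneg (by linarith) _
  refine mul_le_mul ?_ (hb k) (abs_nonneg _) (by positivity)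
  calc _ ≤ (y₀ + 1) ^ k / k.factorial * 1 := by gcongr
    _ = _ := mul_one _

theorem summable_poissonMean (hσ2 : σ ≤ 2) (hC : 0 ≤ C) (t0 : τ 0 = 0)
    (hτ : ∀ k : ℕ, |τ k| ≤ C * (k : ℝ) ^ σ) {y : ℝ} (hy : 0 ≤ y) :
    Summable (fun k : ℕ => Real.exp (-y) * y ^ k / k.factorial * τ k) := by
  have hb := abs_le_mul_four_pow hσ2 hC t0 hτ
  refine Summable.of_norm_bounded (summable_poisson_bound (C := C) y) fun k => ?_
  rw [Real.norm_eq_abs, abs_mul, abs_of_nonneg (by positivity)]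
  refine mul_le_mul ?_ (hb k) (abs_nonneg _) (by positivity)
  gcongr
  have : Real.exp (-y) ≤ 1 := Real.exp_le_one_iff.2 (by linarith)
  have h2 : 0 ≤ y ^ k := by positivity
  nlinarith

theorem continuousAt_poissonMean (hσ2 : σ ≤ 2) (hC : 0 ≤ C) (t0 : τ 0 = 0)
    (hτ : ∀ k : ℕ, |τ k| ≤ C * (k : ℝ) ^ σ) {y₀ : ℝ} (h0 : 0 < y₀) :
    ContinuousAt (poissonMean τ) y₀ := by
  have hb := abs_le_mul_four_pow hσ2 hC t0 hτ
  refine tendsto_tsum_of_dominated_convergence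
    (summable_poisson_bound (C := C) (y₀ + 1)) (fun k => ?_) ?_
  · have : Continuous (fun y : ℝ => Real.exp (-y) * y ^ k / k.factorial * τ k) := by fun_prop
    exact this.tendsto y₀
  filter_upwards [lt_mem_nhds h0, gt_mem_nhds (lt_add_one y₀)] with y h1 h2 k
  rw [Real.norm_eq_abs, abs_mul, abs_of_nonneg (by positivity)]
  refine mul_le_mul ?_ (hb k) (abs_nonneg _) (by positivity)
  have h3 : Real.exp (-y) ≤ 1 := Real.exp_le_one_iff.2 (by linarith)
  have h4 : y ^ k ≤ (y₀ + 1) ^ k := by gcongr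
  have h5 : 0 ≤ y ^ k := by positivity
  gcongr
  nlinarith

theorem poissonMean_pos (hσ2 : σ ≤ 2) (hC : 0 ≤ C) (t0 : τ 0 = 0)
    (hτ : ∀ k : ℕ, |τ k| ≤ C * (k : ℝ) ^ σ) (hpos : ∀ k, 0 ≤ τ k) (h2 : 0 < τ 2) {y : ℝ}
    (hy : 0 < y) : 0 < poissonMean τ y :=
  (summable_poissonMean hσ2 hC t0 hτ hy.le).tsum_pos
    (fun k => mul_nonneg (by positivity) (hpos k)) 2 (mul_pos (by positivity) h2)

/-- Useful for small np: as τ vanishes at 0 and 1, it is dominated by the second factorial moment,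
using k^σ ≤ k² ≤ 2k(k-1) for k ≥ 2. -/
theorem abs_binomMean_le_mul_sq (hσ2 : σ ≤ 2) (hC : 0 ≤ C) (t0 : τ 0 = 0) (t1 : τ 1 = 0)
    (hτ : ∀ k : ℕ, |τ k| ≤ C * (k : ℝ) ^ σ) {p : ℝ} (hp0 : 0 ≤ p) (hp1 : p ≤ 1) (n : ℕ) :
    |binomMean p τ n| ≤ 3 * C * (n * p) ^ 2 := by
  have h2 : |binomMean p τ n| ≤ binomMean p (fun k => 2 * C * ((k : ℝ) * (k - 1))) n := by
    refine abs_binomMean_le hp0 hp1 fun k _ => ?_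
    rcases k with _ | _ | k
    · simp [t0]
    · simp [t1]
    · refine (hτ _).trans ?_
      have h1 : ((k + 1 + 1 : ℕ) : ℝ) ^ σ ≤ ((k + 1 + 1 : ℕ) : ℝ) ^ (2 : ℝ) :=
        Real.rpow_le_rpow_of_exponent_le (by push_cast; linarith [Nat.cast_nonneg (α := ℝ) k]) hσ2
      rw [Real.rpow_two] at h1
      have hk : (0 : ℝ) ≤ k := Nat.cast_nonneg k
      calc _ ≤ C * ((k + 1 + 1 : ℕ) : ℝ) ^ 2 := by gcongr
        _ ≤ C * (2 * (((k + 1 + 1 : ℕ) : ℝ) * (((k + 1 + 1 : ℕ) : ℝ) - 1))) := by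
          gcongr
          push_cast
          nlinarith
        _ = _ := by ring
  refine h2.trans ?_
  rw [binomMean_const_mul, binomMean_mul_sub_one]
  have hn : (0 : ℝ) ≤ n := Nat.cast_nonneg n
  have h3 : (n : ℝ) * (n - 1) * p ^ 2 ≤ (n * p) ^ 2 := by
    rw [mul_pow]
    gcongr
    nlinarith
  nlinarith [sq_nonneg ((n : ℝ) * p), mul_nonneg hC (sq_nonneg ((n : ℝ) * p))]

/-- Useful for large y = np: k^σ ≤ y^(σ-2)·k² + y^σ, by distinguishing k ≤ y from k > y, and the
second moment is at most 2y². -/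
theorem abs_binomMean_le_mul_rpow (hσ0 : 0 ≤ σ) (hσ2 : σ ≤ 2) (hC : 0 ≤ C)
    (hτ : ∀ k : ℕ, |τ k| ≤ C * (k : ℝ) ^ σ) {p : ℝ} (hp0 : 0 ≤ p) (hp1 : p ≤ 1) {n : ℕ}
    (hnp : 1 ≤ n * p) :
    |binomMean p τ n| ≤ 3 * C * (n * p) ^ σ := by
  set y : ℝ := n * p with hy
  have hy0 : 0 < y := by linarith
  have h2 : |binomMean p τ n| ≤
      binomMean p (fun k => C * (y ^ (σ - 2) * ((k : ℝ) + 0) ^ 2 + y ^ σ)) n := by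
    refine abs_binomMean_le hp0 hp1 fun k _ => (hτ k).trans ?_
    gcongr
    rw [add_zero]
    rcases le_or_gt (k : ℝ) y with h | h
    · have h3 : (k : ℝ) ^ σ ≤ y ^ σ := Real.rpow_le_rpow (Nat.cast_nonneg k) h hσ0
      have : 0 ≤ y ^ (σ - 2) * (k : ℝ) ^ 2 := by positivity
      linarith
    · have hk : (0 : ℝ) < k := hy0.trans h
      have h3 : (k : ℝ) ^ (σ - 2) ≤ y ^ (σ - 2) :=
        Real.rpow_le_rpow_of_nonpos hy0 h.le (by linarith)
      have h4 : (k : ℝ) ^ σ = (k : ℝ) ^ (σ - 2) * (k : ℝ) ^ 2 := by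
        rw [← Real.rpow_two, ← Real.rpow_add hk]; congr 1; ring
      have : 0 ≤ y ^ σ := by positivity
      have h5 : (k : ℝ) ^ (σ - 2) * (k : ℝ) ^ 2 ≤ y ^ (σ - 2) * (k : ℝ) ^ 2 := by gcongr
      linarith
  refine h2.trans ?_
  rw [binomMean_const_mul, binomMean_add, binomMean_const, binomMean_const_mul,
    binomMean_add_sq, add_zero, ← hy]
  have h6 : y ^ 2 + y * (1 - p) ≤ 2 * y ^ 2 := by nlinarith
  have h7 : y ^ (σ - 2) * y ^ 2 = y ^ σ := by
    rw [← Real.rpow_two, ← Real.rpow_add hy0]; congr 1; ring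
  have h8 : y ^ (σ - 2) * (y ^ 2 + y * (1 - p)) ≤ 2 * y ^ σ := by
    calc _ ≤ y ^ (σ - 2) * (2 * y ^ 2) := by gcongr
      _ = 2 * y ^ σ := by rw [← h7]; ring
  nlinarith

end Poisson

end GTrie

end

noncomputable section

namespace GTrie

open Topology

/-! ### The functions to which the renewal theorem is applied -/

section Scaled

/-- The Poisson mean of `τ` on the logarithmic scale, normalised by `exp (ρ * s)`. -/
def gLim (ρ : ℝ) (τ : ℕ → ℝ) (s : ℝ) : ℝ := Real.exp (-(ρ * s)) * poissonMean τ (Real.exp s)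

/-- The binomial mean of `τ` on the logarithmic scale, normalised by `exp (ρ * s)`. -/
def gBin (ρ : ℝ) (τ : ℕ → ℝ) (n : ℕ) (s : ℝ) : ℝ :=
  if Real.exp s ≤ n then Real.exp (-(ρ * s)) * binomMean (Real.exp s / n) τ n else 0

variable {ρ σ C : ℝ} {τ : ℕ → ℝ}

/-- On the left, the quadratic bound for small means leaves the rate 2 - ρ; on the right, growth of
order σ leaves the rate ρ - σ. Nothing depends on n. -/
theorem expBound_gBin (hρ2 : ρ < 2) (hσ0 : 0 ≤ σ) (hσρ : σ < ρ) (hC : 0 ≤ C) (t0 : τ 0 = 0)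
    (t1 : τ 1 = 0) (hτ : ∀ k : ℕ, |τ k| ≤ C * (k : ℝ) ^ σ) (n : ℕ) :
    ExpBound (3 * C) (min (2 - ρ) (ρ - σ)) (gBin ρ τ n) := by
  intro s
  unfold gBin
  split_ifs with h
  swap
  · rw [abs_zero]; positivity
  have hn : (0 : ℝ) < n := (Real.exp_pos s).trans_le h
  have hp0 : 0 ≤ Real.exp s / n := by positivity
  have hp1 : Real.exp s / n ≤ 1 := (div_le_one hn).2 h
  have hnp : (n : ℝ) * (Real.exp s / n) = Real.exp s := mul_div_cancel₀ _ hn.ne'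
  have hσ2 : σ ≤ 2 := by linarith
  rw [abs_mul, abs_of_pos (Real.exp_pos _)]
  rcases le_total s 0 with hs | hs
  · have h1 := abs_binomMean_le_mul_sq hσ2 hC t0 t1 hτ hp0 hp1 n
    rw [hnp] at h1
    calc _ ≤ Real.exp (-(ρ * s)) * (3 * C * Real.exp s ^ 2) := by gcongr
      _ = 3 * C * Real.exp ((2 - ρ) * s) := by
          rw [← Real.exp_nat_mul, mul_left_comm, ← Real.exp_add]; congr 2; push_cast; ring
      _ ≤ _ := by
          gcongr
          rw [abs_of_nonpos hs]
          nlinarith [min_le_left (2 - ρ) (ρ - σ)]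
  · have h1 := abs_binomMean_le_mul_rpow hσ0 hσ2 hC hτ hp0 hp1 (n := n)
      (by rw [hnp]; exact Real.one_le_exp hs)
    rw [hnp, ← Real.exp_mul] at h1
    calc _ ≤ Real.exp (-(ρ * s)) * (3 * C * Real.exp (s * σ)) := by gcongr
      _ = 3 * C * Real.exp (-((ρ - σ) * s)) := by
          rw [mul_left_comm, ← Real.exp_add]; congr 2; ring
      _ ≤ _ := by
          rw [abs_of_nonneg hs]
          gcongr
          exact min_le_right _ _

theorem continuous_gLim (hσ2 : σ ≤ 2) (hC : 0 ≤ C) (t0 : τ 0 = 0)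
    (hτ : ∀ k : ℕ, |τ k| ≤ C * (k : ℝ) ^ σ) : Continuous (gLim ρ τ) := by
  refine Continuous.mul (by fun_prop) (continuous_iff_continuousAt.2 fun s => ?_)
  exact (continuousAt_poissonMean hσ2 hC t0 hτ (Real.exp_pos s)).comp
    Real.continuous_exp.continuousAt

theorem tendsto_gBin (hσ2 : σ ≤ 2) (hC : 0 ≤ C) (t0 : τ 0 = 0)
    (hτ : ∀ k : ℕ, |τ k| ≤ C * (k : ℝ) ^ σ) (s₀ : ℝ) :
    Tendsto (fun z : ℕ × ℝ => gBin ρ τ z.1 z.2) (atTop ×ˢ 𝓝 s₀) (𝓝 (gLim ρ τ s₀)) := by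
  have hy : Tendsto (fun z : ℕ × ℝ => Real.exp z.2) (atTop ×ˢ 𝓝 s₀) (𝓝 (Real.exp s₀)) :=
    (Real.continuous_exp.tendsto _).comp tendsto_snd
  have h1 : Tendsto (fun z : ℕ × ℝ => Real.exp (-(ρ * z.2))) (atTop ×ˢ 𝓝 s₀)
      (𝓝 (Real.exp (-(ρ * s₀)))) := by
    have : Continuous fun s : ℝ => Real.exp (-(ρ * s)) := by fun_prop
    exact (this.tendsto s₀).comp tendsto_snd
  have h2 : Tendsto (fun z : ℕ × ℝ => binomMean (Real.exp z.2 / z.1) τ z.1) (atTop ×ˢ 𝓝 s₀)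
      (𝓝 (poissonMean τ (Real.exp s₀))) :=
    (tendsto_binomMean_poissonMean hσ2 hC t0 hτ _ (Real.exp_pos s₀)).comp
      (tendsto_fst.prodMk hy)
  refine (h1.mul h2).congr' ?_
  have hn : Tendsto (fun z : ℕ × ℝ => (z.1 : ℝ)) (atTop ×ˢ 𝓝 s₀) atTop :=
    tendsto_natCast_atTop_atTop.comp tendsto_fst
  filter_upwards [hy.eventually (gt_mem_nhds (lt_add_one _)),
    hn.eventually (eventually_ge_atTop (Real.exp s₀ + 1))] with z h3 h4
  rw [gBin, if_pos (by linarith)]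

theorem tendstoLocallyUniformly_gBin (hσ2 : σ ≤ 2) (hC : 0 ≤ C) (t0 : τ 0 = 0)
    (hτ : ∀ k : ℕ, |τ k| ≤ C * (k : ℝ) ^ σ) :
    TendstoLocallyUniformly (gBin ρ τ) (gLim ρ τ) atTop := by
  rw [tendstoLocallyUniformly_iff_forall_tendsto]
  intro s
  have h2 : Tendsto (fun y : ℕ × ℝ => gLim ρ τ y.2) (atTop ×ˢ 𝓝 s) (𝓝 (gLim ρ τ s)) :=
    ((continuous_gLim hσ2 hC t0 hτ).tendsto s).comp tendsto_snd
  exact (h2.prodMk_nhds (tendsto_gBin hσ2 hC t0 hτ s)).mono_right (nhds_le_uniformity _)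

theorem expBound_gLim (hρ2 : ρ < 2) (hσ0 : 0 ≤ σ) (hσρ : σ < ρ) (hC : 0 ≤ C) (t0 : τ 0 = 0)
    (t1 : τ 1 = 0) (hτ : ∀ k : ℕ, |τ k| ≤ C * (k : ℝ) ^ σ) :
    ExpBound (3 * C) (min (2 - ρ) (ρ - σ)) (gLim ρ τ) := by
  intro s
  have hσ2 : σ ≤ 2 := by linarith
  have h1 : Tendsto (fun n : ℕ => |gBin ρ τ n s|) atTop (𝓝 |gLim ρ τ s|) :=
    ((tendsto_gBin hσ2 hC t0 hτ s).comp
      (tendsto_id.prodMk (tendsto_const_nhds (x := s)))).abs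
  exact le_of_tendsto h1 (Eventually.of_forall fun n =>
    expBound_gBin hρ2 hσ0 hσρ hC t0 t1 hτ n s)

end Scaled

/-- The standing assumptions on the parameters. -/
structure IsSetting (M : ℕ) {A : ℕ} (p : Fin A → ℝ) (ρ a : ℝ) : Prop where
  hM : 1 ≤ M
  hp : ∀ j, 0 < p j ∧ p j < 1
  hsum : ∑ j, p j = 1
  hne : ∑ j, p j ^ 2 < 1 / (M : ℝ)
  hρ : ∑ j, p j ^ ρ = 1 / (M : ℝ)
  ha : IsBase p a

/-- The probability of a letter of the alphabet `Fin M × Fin A`. -/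
def letterP (M : ℕ) {A : ℕ} (p : Fin A → ℝ) (x : Fin M × Fin A) : ℝ := p x.2

/-- The mean step of the associated renewal process. -/
def drift (M : ℕ) {A : ℕ} (p : Fin A → ℝ) (ρ : ℝ) : ℝ :=
  ∑ x : Fin M × Fin A, letterP M p x ^ ρ * -Real.log (letterP M p x)

theorem drift_eq (M : ℕ) {A : ℕ} (p : Fin A → ℝ) (ρ : ℝ) :
    drift M p ρ = -(M * ∑ j, p j ^ ρ * Real.log (p j)) := by
  simp [drift, letterP, Fintype.sum_prod_type]

open Classical in
/-- The periodic function in the asymptotics of a renewal function. -/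
def limitFn (M : ℕ) {A : ℕ} (p : Fin A → ℝ) (ρ a : ℝ) (g : ℝ → ℝ) (x : ℝ) : ℝ :=
  if PeriodicCase p then
    Real.log a / drift M p ρ * ∑' m : ℤ, g (x * Real.log a - m * Real.log a)
  else (drift M p ρ)⁻¹ * ∫ s, g s

theorem periodic_limitFn (M : ℕ) {A : ℕ} (p : Fin A → ℝ) (ρ a : ℝ) (g : ℝ → ℝ) :
    Function.Periodic (limitFn M p ρ a g) 1 := by
  intro x
  unfold limitFn
  split_ifs
  swap
  · rfl
  congr 1
  rw [← (Equiv.addRight (1 : ℤ)).tsum_eq]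
  refine tsum_congr fun m => ?_
  congr 1
  simp only [Equiv.coe_addRight]
  push_cast
  ring

/-! ### Word sums as renewal functions and their first-order asymptotics -/

namespace IsSetting

variable {M A : ℕ} {p : Fin A → ℝ} {ρ a : ℝ} (h : IsSetting M p ρ a)

include h

theorem M_pos : (0 : ℝ) < M := by exact_mod_cast h.hM

theorem letterP_pos (x : Fin M × Fin A) : 0 < letterP M p x := (h.hp _).1

theorem letterP_lt_one (x : Fin M × Fin A) : letterP M p x < 1 := (h.hp _).2

theorem univ_nonempty : (Finset.univ : Finset (Fin A)).Nonempty := by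
  by_contra h2
  rw [Finset.not_nonempty_iff_eq_empty] at h2
  have := h.hsum
  simp [h2] at this

/-- As 0 < p j < 1, the sum of p j ^ s decreases in s, and at s = 1 it is 1 ≥ 1/M. -/
theorem one_le_rho : 1 ≤ ρ := by
  by_contra h2
  push Not at h2
  have h3 : ∑ j, p j < ∑ j, p j ^ ρ := by
    refine Finset.sum_lt_sum_of_nonempty h.univ_nonempty fun j _ => ?_
    conv_lhs => rw [← Real.rpow_one (p j)]
    exact Real.rpow_lt_rpow_of_exponent_gt (h.hp j).1 (h.hp j).2 h2
  rw [h.hsum, h.hρ, lt_div_iff₀ h.M_pos] at h3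
  have : (1 : ℝ) ≤ M := by exact_mod_cast h.hM
  linarith

theorem rho_lt_two : ρ < 2 := by
  by_contra h2
  push Not at h2
  have h3 : ∑ j, p j ^ ρ ≤ ∑ j, p j ^ 2 := by
    refine Finset.sum_le_sum fun j _ => ?_
    rw [← Real.rpow_two]
    exact Real.rpow_le_rpow_of_exponent_ge (h.hp j).1 (h.hp j).2.le h2
  have := h.hne
  linarith [h.hρ]

theorem M_eq_one (h1 : ρ = 1) : M = 1 := by
  have h2 := h.hρ
  simp only [h1, Real.rpow_one, h.hsum] at h2
  rw [eq_div_iff h.M_pos.ne', one_mul] at h2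
  exact_mod_cast h2

theorem sum_letterP_rpow : ∑ x : Fin M × Fin A, letterP M p x ^ ρ = 1 := by
  simp only [letterP, Fintype.sum_prod_type, h.hρ, Finset.sum_const, Finset.card_univ,
    Fintype.card_fin, nsmul_eq_mul]
  exact mul_one_div_cancel h.M_pos.ne'

theorem sum_letterP_sq : ∑ x : Fin M × Fin A, letterP M p x ^ 2 < 1 := by
  simp only [letterP, Fintype.sum_prod_type, Finset.sum_const, Finset.card_univ,
    Fintype.card_fin, nsmul_eq_mul]
  have := h.hne
  rw [lt_div_iff₀ h.M_pos] at this
  linarith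

theorem summable_wt_sq : Summable (fun w => wt (letterP M p) w ^ 2) := by
  have := summable_wt (c := fun x => letterP M p x ^ 2) (fun x => sq_nonneg _) h.sum_letterP_sq
  exact this.congr fun w => wt_pow _ _ _

theorem wt_pos (w : List (Fin M × Fin A)) : 0 < wt (letterP M p) w := GTrie.wt_pos h.letterP_pos w

theorem wt_le_one (w : List (Fin M × Fin A)) : wt (letterP M p) w ≤ 1 :=
  GTrie.wt_le_one (fun x => (h.letterP_pos x).le) (fun x => (h.letterP_lt_one x).le) w

theorem log_neg (x : Fin M × Fin A) : 0 < -Real.log (letterP M p x) := by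
  have := Real.log_neg (h.letterP_pos x) (h.letterP_lt_one x)
  linarith

theorem q_pos (x : Fin M × Fin A) : 0 < letterP M p x ^ ρ :=
  Real.rpow_pos_of_pos (h.letterP_pos x) ρ

theorem len_eq (w : List (Fin M × Fin A)) :
    len (fun x => -Real.log (letterP M p x)) w = -Real.log (wt (letterP M p) w) := by
  induction w with
  | nil => simp
  | cons x w ih =>
    rw [len_cons, wt_cons, ih, Real.log_mul (h.letterP_pos x).ne' (h.wt_pos w).ne']
    ring

theorem drift_pos : 0 < drift M p ρ := by
  obtain ⟨j, -⟩ := h.univ_nonempty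
  have : Nonempty (Fin M × Fin A) := ⟨(⟨0, h.hM⟩, j)⟩
  exact Finset.sum_pos (fun x _ => mul_pos (h.q_pos x) (h.log_neg x)) Finset.univ_nonempty

theorem log_a_pos : 0 < Real.log a := by
  rcases h.ha with h1 | h1
  · exact Real.log_pos h1.2.1
  · rw [h1.2, Real.log_exp]; exact one_pos

theorem one_lt_a : 1 < a := by
  rcases h.ha with h1 | h1
  · exact h1.2.1
  · rw [h1.2]; exact Real.one_lt_exp_iff.2 one_pos

theorem summable_binomMean {τ : ℕ → ℝ} (t0 : τ 0 = 0) (t1 : τ 1 = 0) (n : ℕ) :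
    Summable (fun w => binomMean (wt (letterP M p) w) τ n) := by
  obtain ⟨C, hC⟩ : ∃ C, ∀ k ≤ n, |τ k| ≤ C :=
    ⟨∑ k ∈ Finset.range (n + 1), |τ k|, fun k hk =>
      Finset.single_le_sum (f := fun k => |τ k|) (fun i _ => abs_nonneg _)
        (Finset.mem_range.2 (Nat.lt_succ_of_le hk))⟩
  refine Summable.of_norm_bounded (h.summable_wt_sq.mul_left (C * n ^ 2)) fun w => ?_
  exact abs_binomMean_le_sq (h.wt_pos w).le (h.wt_le_one w) t0 t1 hC

/-- The factor n^ρ π_w^ρ cancels the normalisation of `gBin` at log(n π_w) = log n - len w. The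
cutoff in `gBin` is inactive because π_w ≤ 1. -/
theorem tsum_binomMean_eq_renewal {τ : ℕ → ℝ} {n : ℕ} (hn : 1 ≤ n) :
    ∑' w, binomMean (wt (letterP M p) w) τ n =
      (n : ℝ) ^ ρ * renewal (fun x => letterP M p x ^ ρ) (fun x => -Real.log (letterP M p x))
        (gBin ρ τ n) (Real.log n) := by
  have hn0 : (0 : ℝ) < n := by exact_mod_cast hn
  rw [renewal, ← tsum_mul_left]
  refine tsum_congr fun w => ?_
  have hw := h.wt_pos w
  rw [h.len_eq, sub_neg_eq_add, ← Real.log_mul hn0.ne' hw.ne', gBin,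
    Real.exp_log (mul_pos hn0 hw), if_pos (mul_le_of_le_one_right hn0.le (h.wt_le_one w)),
    mul_div_cancel_left₀ _ hn0.ne', wt_rpow (fun x => (h.letterP_pos x).le),
    Real.log_mul hn0.ne' hw.ne', mul_add, neg_add, Real.exp_add]
  rw [Real.rpow_def_of_pos hn0, Real.rpow_def_of_pos hw, Real.exp_neg, Real.exp_neg,
    mul_comm ρ (Real.log n), mul_comm ρ (Real.log (wt _ w))]
  have h1 := (Real.exp_pos (Real.log n * ρ)).ne'
  have h2 := (Real.exp_pos (Real.log (wt (letterP M p) w) * ρ)).ne'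
  field_simp

theorem tendsto_renewal {C δ : ℝ} (hδ : 0 < δ) {g : ℝ → ℝ} (hgc : Continuous g)
    (hg : ExpBound C δ g) :
    Tendsto (fun t => renewal (fun x => letterP M p x ^ ρ)
      (fun x => -Real.log (letterP M p x)) g t - limitFn M p ρ a g (t / Real.log a)) atTop
      (𝓝 0) := by
  have hla := h.log_a_pos
  by_cases hper : PeriodicCase p
  · rcases h.ha with h1 | h1
    swap
    · exact absurd hper h1.1
    obtain ⟨-, ha1, e, he, hgcd, hpe⟩ := h1
    have hgcd' : Finset.univ.gcd (fun x : Fin M × Fin A => e x.2) = 1 := by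
      refine Nat.dvd_one.1 (hgcd ▸ Finset.dvd_gcd fun j _ => ?_)
      exact Finset.gcd_dvd (f := fun x : Fin M × Fin A => e x.2)
        (Finset.mem_univ ((⟨0, h.hM⟩, j) : Fin M × Fin A))
    have := renewal_lattice (d := Real.log a) (e := fun x : Fin M × Fin A => e x.2)
      (x := fun x => -Real.log (letterP M p x)) h.q_pos
      h.sum_letterP_rpow hla (fun x => he _) hgcd' (fun x => by
        rw [letterP, hpe, Real.log_inv, Real.log_pow, neg_neg]) hδ hg
    refine this.congr fun t => ?_
    rw [limitFn, if_pos hper, div_mul_cancel₀ _ hla.ne', drift]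
  · simp only [limitFn, if_neg hper]
    have hdense : Dense (AddSubgroup.closure
        (Set.range fun x : Fin M × Fin A => -Real.log (letterP M p x)) : Set ℝ) := by
      -- A cyclic group would make all -log p_j integer multiples of one number, hence their ratios
      -- rational.
      refine (AddSubgroup.dense_or_cyclic _).resolve_right ?_
      rintro ⟨c, hc⟩
      refine hper fun i j => ?_
      have h1 : ∀ j, ∃ k : ℤ, -Real.log (p j) = k * c := by
        intro j
        have : -Real.log (p j) ∈ AddSubgroup.closure
            (Set.range fun x : Fin M × Fin A => -Real.log (letterP M p x)) :=
          AddSubgroup.subset_closure ⟨(⟨0, h.hM⟩, j), rfl⟩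
        rw [hc, AddSubgroup.mem_closure_singleton] at this
        obtain ⟨k, hk⟩ := this
        exact ⟨k, by rw [← hk]; simp⟩
      obtain ⟨k, hk⟩ := h1 i
      obtain ⟨l, hl⟩ := h1 j
      have hc0 : c ≠ 0 := by
        rintro rfl
        have := Real.log_neg (h.hp j).1 (h.hp j).2
        rw [mul_zero] at hl
        linarith
      refine ⟨k / l, ?_⟩
      rw [← neg_div_neg_eq, hk, hl, mul_div_mul_right _ _ hc0]
      push_cast
      rfl
    have := renewal_nonlattice h.q_pos h.sum_letterP_rpow h.log_neg hdense hδ hgc hg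
    have h2 := this.sub_const ((drift M p ρ)⁻¹ * ∫ s, g s)
    simpa [drift] using h2

theorem continuous_limitFn {C δ : ℝ} (hδ : 0 < δ) {g : ℝ → ℝ} (hgc : Continuous g)
    (hg : ExpBound C δ g) : Continuous (limitFn M p ρ a g) := by
  have hla := h.log_a_pos
  unfold limitFn
  split_ifs
  swap
  · exact continuous_const
  refine continuous_const.mul (continuous_iff_continuousAt.2 fun x₀ => ?_)
  set R := |x₀| + 1 with hR
  have hnhds : Set.Icc (-R) R ∈ 𝓝 x₀ := by
    refine Icc_mem_nhds ?_ ?_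
    · linarith [neg_abs_le x₀]
    · linarith [le_abs_self x₀]
  refine ContinuousOn.continuousAt (s := Set.Icc (-R) R) ?_ hnhds
  have hexp : ExpBound 1 δ (fun s => Real.exp (-(δ * |s|))) := fun s => by
    rw [abs_of_pos (Real.exp_pos _), one_mul]
  have hsum := (hexp.summable_int hδ hla 0).mul_left (C * Real.exp (δ * (R * Real.log a)))
  refine continuousOn_tsum (fun m => (hgc.comp (by fun_prop)).continuousOn) hsum ?_
  intro m x hx
  refine (hg _).trans ?_
  rw [mul_assoc, ← Real.exp_add]
  have := hg.nonneg
  gcongr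
  have h1 : |x * Real.log a| ≤ R * Real.log a := by
    rw [abs_mul, abs_of_pos hla]
    have : |x| ≤ R := abs_le.2 hx
    gcongr
  have h2 : |0 - (m : ℝ) * Real.log a| - |x * Real.log a| ≤
      |x * Real.log a - m * Real.log a| := by
    have := abs_sub_abs_le_abs_sub (0 - (m : ℝ) * Real.log a) (-(x * Real.log a))
    rw [abs_neg] at this
    refine this.trans (le_of_eq ?_)
    congr 1
    ring
  nlinarith

theorem limitFn_pos {C δ : ℝ} (hδ : 0 < δ) {g : ℝ → ℝ} (hgc : Continuous g)
    (hg : ExpBound C δ g) (hpos : ∀ s, 0 < g s) (x : ℝ) : 0 < limitFn M p ρ a g x := by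
  have hla := h.log_a_pos
  have hdr := h.drift_pos
  unfold limitFn
  split_ifs
  · have := (hg.summable_int hδ hla (x * Real.log a)).tsum_pos (fun m => (hpos _).le) 0 (hpos _)
    positivity
  · have : 0 < ∫ s, g s := by
      rw [integral_pos_iff_support_of_nonneg (fun s => (hpos s).le) (hg.integrable hδ hgc)]
      have : Function.support g = Set.univ := by
        ext s; simp [(hpos s).ne']
      rw [this]
      simp
    positivity

/-- Sums of binomial means over all words, to first order. -/
theorem isPeriodicFactor_tsum {τ : ℕ → ℝ} {C σ : ℝ} (hσ0 : 0 ≤ σ) (hσρ : σ < ρ) (hC : 0 ≤ C)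
    (t0 : τ 0 = 0) (t1 : τ 1 = 0) (hτ : ∀ k : ℕ, |τ k| ≤ C * (k : ℝ) ^ σ) :
    IsPeriodicFactor a ρ (fun n => ∑' w, binomMean (wt (letterP M p) w) τ n)
      (limitFn M p ρ a (gLim ρ τ)) := by
  have hρ2 := h.rho_lt_two
  have hσ2 : σ ≤ 2 := by linarith
  set δ := min (2 - ρ) (ρ - σ) with hδdef
  have hδ : 0 < δ := lt_min (by linarith) (by linarith)
  have hg : ExpBound (3 * C) δ (gLim ρ τ) := expBound_gLim hρ2 hσ0 hσρ hC t0 t1 hτ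
  have hgc : Continuous (gLim ρ τ) := continuous_gLim hσ2 hC t0 hτ
  refine ⟨h.continuous_limitFn hδ hgc hg, periodic_limitFn M p ρ a _, ?_⟩
  have hq : ∀ x : Fin M × Fin A, 0 ≤ letterP M p x ^ ρ := fun x => (h.q_pos x).le
  set Z := renewal (fun x => letterP M p x ^ ρ) (fun x => -Real.log (letterP M p x)) with hZ
  have hlog : Tendsto (fun n : ℕ => Real.log n) atTop atTop :=
    Real.tendsto_log_atTop.comp tendsto_natCast_atTop_atTop
  have h1 := (h.tendsto_renewal hδ hgc hg).comp hlog
  -- Both the function and the argument depend on n; the bound on renewal functions is uniform in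
  -- the argument, so weighted convergence of `gBin` to `gLim` suffices.
  have h2 : Tendsto (fun n : ℕ => Z (gBin ρ τ n) (Real.log n) - Z (gLim ρ τ) (Real.log n))
      atTop (𝓝 0) := by
    obtain ⟨K, hK0, hK⟩ := exists_abs_renewal_le hq h.sum_letterP_rpow h.log_neg (half_pos hδ)
    rw [Metric.tendsto_nhds]
    intro ε hε
    have hb := fun n => expBound_gBin hρ2 hσ0 hσρ hC t0 t1 hτ n
    filter_upwards [eventually_expBound_sub hδ (tendstoLocallyUniformly_gBin hσ2 hC t0 hτ)
      (Eventually.of_forall hb) hg (show 0 < ε / (2 * K) by positivity)] with n hn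
    have h3 := hK _ _ hn (Real.log n)
    rw [renewal_sub hq h.sum_letterP_rpow h.log_neg hδ hδ (hb n) hg] at h3
    rw [Real.dist_eq, sub_zero]
    refine h3.trans_lt ?_
    rw [show ε / (2 * K) * K = ε / 2 by field_simp]
    linarith
  have h3 := h2.add h1
  rw [add_zero] at h3
  rw [Asymptotics.isLittleO_iff_tendsto']
  · refine h3.congr' ?_
    filter_upwards [eventually_ge_atTop 1] with n hn
    have hn0 : (0 : ℝ) < n := by exact_mod_cast hn
    rw [h.tsum_binomMean_eq_renewal hn, Real.logb, mul_comm ((n : ℝ) ^ ρ), ← sub_mul,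
      mul_div_cancel_right₀ _ (Real.rpow_pos_of_pos hn0 ρ).ne']
    simp only [Function.comp, ← hZ]
    ring
  · filter_upwards [eventually_ge_atTop 1] with n hn h0
    have hn0 : (0 : ℝ) < n := by exact_mod_cast hn
    exact absurd h0 (Real.rpow_pos_of_pos hn0 ρ).ne'

theorem limitFn_gLim_pos {τ : ℕ → ℝ} {C σ : ℝ} (hσ0 : 0 ≤ σ) (hσρ : σ < ρ) (hC : 0 ≤ C)
    (t0 : τ 0 = 0) (t1 : τ 1 = 0) (hτ : ∀ k : ℕ, |τ k| ≤ C * (k : ℝ) ^ σ)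
    (hpos : ∀ k, 0 ≤ τ k) (h2 : 0 < τ 2) (x : ℝ) : 0 < limitFn M p ρ a (gLim ρ τ) x := by
  have hρ2 := h.rho_lt_two
  have hσ2 : σ ≤ 2 := by linarith
  exact h.limitFn_pos (lt_min (by linarith) (by linarith)) (continuous_gLim hσ2 hC t0 hτ)
    (expBound_gLim hρ2 hσ0 hσρ hC t0 t1 hτ) (fun s => mul_pos (Real.exp_pos _)
      (poissonMean_pos hσ2 hC t0 hτ hpos h2 (Real.exp_pos s))) x

/-- The solution of `W n = τ n + ∑ x, E W (Bin (n, p x))` is a sum over words. -/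
theorem hasSum_of_recursion {W τ : ℕ → ℝ} (w0 : W 0 = 0) (w1 : W 1 = 0)
    (hrec : ∀ n, W n = τ n + ∑ x, binomMean (letterP M p x) W n) (n : ℕ) :
    HasSum (fun w => binomMean (wt (letterP M p) w) τ n) (W n) := by
  have hs := h.summable_binomMean w0 w1 n
  -- The recursion writes τ as W minus its one-letter means. The sum over words therefore telescopes
  -- and leaves only the term of the empty word, which is W n.
  have h1 : ∀ w, binomMean (wt (letterP M p) w) τ n = binomMean (wt (letterP M p) w) W n
      - ∑ x, binomMean (wt (letterP M p) (x :: w)) W n := by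
    intro w
    have h2 : ∀ s : Finset (Fin M × Fin A), binomMean (wt (letterP M p) w)
        (fun k => ∑ x ∈ s, binomMean (letterP M p x) W k) n =
        ∑ x ∈ s, binomMean (wt (letterP M p) (x :: w)) W n := by
      classical
      intro s
      induction s using Finset.induction_on with
      | empty => simpa using binomMean_const _ 0 n
      | insert x s hx ih =>
        simp only [Finset.sum_insert hx, binomMean_add, ih, wt_cons]
        rw [mul_comm (letterP M p x), ← binomMean_binomMean]
    rw [← h2 Finset.univ, ← binomMean_sub]
    congr 1
    funext k
    rw [hrec k]
    ring
  have h3 : HasSum (fun w => ∑ x, binomMean (wt (letterP M p) (x :: w)) W n)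
      (∑ x, ∑' w, binomMean (wt (letterP M p) (x :: w)) W n) :=
    hasSum_sum fun x _ => (summable_cons hs x).hasSum
  have h4 := hs.hasSum.sub h3
  rw [tsum_list hs, wt_nil, binomMean_one, add_sub_cancel_right] at h4
  exact h4.congr_fun h1

end IsSetting

end GTrie

end

noncomputable section

namespace GTrie

open Topology

/-! ### The Gamma integral on the logarithmic scale -/

section GammaIntegral

theorem expBound_exp_mul_exp_neg_exp (c : ℝ) :
    ExpBound 6 (min c (3 - c)) (fun s => Real.exp (c * s) * Real.exp (-Real.exp s)) := by
  intro s
  beta_reduce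
  rw [abs_of_pos (by positivity)]
  rcases le_total s 0 with hs | hs
  · have h1 : Real.exp (-Real.exp s) ≤ 1 := Real.exp_le_one_iff.2 (by linarith [Real.exp_pos s])
    have h2 : Real.exp (c * s) ≤ Real.exp (-(min c (3 - c) * |s|)) := by
      rw [Real.exp_le_exp, abs_of_nonpos hs]
      nlinarith [min_le_left c (3 - c)]
    nlinarith [Real.exp_pos (c * s), Real.exp_pos (-Real.exp s)]
  -- The cubic term of the exponential series, with 6 = 3!; it handles every exponent below 3.
  · have h1 : Real.exp (-Real.exp s) ≤ 6 * Real.exp (-(3 * s)) := by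
      have h2 := Real.pow_div_factorial_le_exp (Real.exp s) (Real.exp_pos s).le 3
      rw [Real.exp_neg, Real.exp_neg, ← div_eq_mul_inv, inv_eq_one_div,
        div_le_div_iff₀ (Real.exp_pos _) (Real.exp_pos _), ← Real.exp_nat_mul] at *
      norm_num [Nat.factorial] at h2
      linarith
    calc _ ≤ Real.exp (c * s) * (6 * Real.exp (-(3 * s))) := by gcongr
      _ = 6 * Real.exp (-((3 - c) * s)) := by rw [mul_left_comm, ← Real.exp_add]; congr 2; ring
      _ ≤ _ := by
          rw [abs_of_nonneg hs]
          gcongr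
          exact min_le_right _ _

theorem norm_cexp_mul_cexp_neg_exp (z : ℂ) (s : ℝ) :
    ‖Complex.exp (z * s) * Complex.exp (-Real.exp s : ℝ)‖ =
      Real.exp (z.re * s) * Real.exp (-Real.exp s) := by
  rw [norm_mul, Complex.norm_exp, Complex.norm_exp, Complex.ofReal_re, Complex.re_mul_ofReal]

theorem integrable_cexp_mul_cexp_neg_exp {z : ℂ} (hz0 : 0 < z.re) (hz3 : z.re < 3) :
    Integrable (fun s : ℝ => Complex.exp (z * s) * Complex.exp (-Real.exp s : ℝ)) := by
  refine Integrable.mono' ((expBound_exp_mul_exp_neg_exp z.re).integrable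
    (lt_min hz0 (by linarith)) (by fun_prop)) ?_ ?_
  · exact Continuous.aestronglyMeasurable (by fun_prop)
  · exact Eventually.of_forall fun s => (norm_cexp_mul_cexp_neg_exp z s).le

/-- The substitution x = exp(s) in Euler's integral, obtained from the Fourier form of the Mellin
transform. -/
theorem integral_cexp_mul_cexp_neg_exp {z : ℂ} (hz0 : 0 < z.re) :
    ∫ s : ℝ, Complex.exp (z * s) * Complex.exp (-Real.exp s : ℝ) = Complex.Gamma z := by
  rw [Complex.Gamma_eq_integral hz0, Complex.GammaIntegral_eq_mellin, mellin_eq_fourier,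
    Real.fourier_real_eq_integral_exp_smul, ← integral_neg_eq_self]
  refine integral_congr_ae (Eventually.of_forall fun s => ?_)
  simp only [smul_eq_mul, Complex.real_smul]
  simp only [Complex.ofReal_exp, ← Complex.exp_add]
  congr 1
  have hz : z = z.re + z.im * Complex.I := (Complex.re_add_im z).symm
  conv_lhs => rw [hz]
  have hpi : (Real.pi : ℂ) ≠ 0 := by exact_mod_cast Real.pi_ne_zero
  push_cast
  field_simp
  ring

theorem norm_Gamma_le_integral {z : ℂ} (hz0 : 0 < z.re) :
    ‖Complex.Gamma z‖ ≤ ∫ s : ℝ, Real.exp (z.re * s) * Real.exp (-Real.exp s) := by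
  rw [← integral_cexp_mul_cexp_neg_exp hz0]
  refine (norm_integral_le_integral_norm _).trans (le_of_eq ?_)
  simp only [norm_cexp_mul_cexp_neg_exp]

end GammaIntegral

/-- The indicator of `k ≥ 2`. -/
def atLeastTwo (k : ℕ) : ℝ := if 2 ≤ k then 1 else 0

@[simp] theorem atLeastTwo_zero : atLeastTwo 0 = 0 := by simp [atLeastTwo]

@[simp] theorem atLeastTwo_one : atLeastTwo 1 = 0 := by simp [atLeastTwo]

theorem atLeastTwo_nonneg (k : ℕ) : 0 ≤ atLeastTwo k := by
  unfold atLeastTwo; split_ifs <;> norm_num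

theorem atLeastTwo_le_one (k : ℕ) : atLeastTwo k ≤ 1 := by
  unfold atLeastTwo; split_ifs <;> norm_num

theorem abs_atLeastTwo_le (k : ℕ) : |atLeastTwo k| ≤ 1 * (k : ℝ) ^ (0 : ℝ) := by
  rw [abs_of_nonneg (atLeastTwo_nonneg k), Real.rpow_zero, mul_one]
  exact atLeastTwo_le_one k

theorem poissonMean_atLeastTwo (y : ℝ) :
    poissonMean atLeastTwo y = 1 - (1 + y) * Real.exp (-y) := by
  have h1 : HasSum (fun k : ℕ => y ^ k / k.factorial) (Real.exp y) := by
    rw [Real.exp_eq_exp_ℝ]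
    exact NormedSpace.expSeries_div_hasSum_exp y
  have h2 := (hasSum_nat_add_iff' 2).2 h1
  have h3 := h2.mul_left (Real.exp (-y))
  have h4 : HasSum (fun k : ℕ => Real.exp (-y) * y ^ k / k.factorial * atLeastTwo k)
      (Real.exp (-y) * (Real.exp y - (1 + y))) := by
    rw [← hasSum_nat_add_iff' 2]
    convert! h3 using 1
    · funext k
      have h5 : 2 ≤ k + 2 := by omega
      simp [atLeastTwo, mul_div_assoc]
    · simp [Finset.sum_range_succ]
  rw [poissonMean, h4.tsum_eq, mul_sub, ← Real.exp_add]
  simp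
  ring

theorem hasDerivAt_one_sub_exp (s : ℝ) :
    HasDerivAt (fun s : ℝ => 1 - (1 + Real.exp s) * Real.exp (-Real.exp s))
      (Real.exp (2 * s) * Real.exp (-Real.exp s)) s := by
  have h1 : HasDerivAt (fun s : ℝ => 1 + Real.exp s) (Real.exp s) s :=
    (Real.hasDerivAt_exp s).const_add 1
  have h2 : HasDerivAt (fun s : ℝ => Real.exp (-Real.exp s))
      (Real.exp (-Real.exp s) * -Real.exp s) s := (Real.hasDerivAt_exp s).neg.exp
  refine ((h1.mul h2).const_sub 1).congr_deriv ?_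
  rw [show 2 * s = s + s by ring, Real.exp_add]
  ring

/-! ### The Fourier transform of the limiting function -/

section Fourier

variable {ρ : ℝ}

theorem expBound_gLim_atLeastTwo (hρ0 : 0 < ρ) (hρ2 : ρ < 2) :
    ExpBound (3 * 1) (min (2 - ρ) (ρ - 0)) (gLim ρ atLeastTwo) :=
  expBound_gLim hρ2 le_rfl hρ0 zero_le_one atLeastTwo_zero atLeastTwo_one abs_atLeastTwo_le

theorem continuous_gLim_atLeastTwo : Continuous (gLim ρ atLeastTwo) :=
  continuous_gLim (σ := 0) (by norm_num) zero_le_one atLeastTwo_zero abs_atLeastTwo_le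

theorem ExpBound.tendsto_atBot {C δ : ℝ} {g : ℝ → ℝ} (hδ : 0 < δ) (hg : ExpBound C δ g) :
    Tendsto g atBot (𝓝 0) := by
  have h1 : Tendsto (fun s : ℝ => C * Real.exp (-(δ * |s|))) atBot (𝓝 0) := by
    have : Tendsto (fun s : ℝ => Real.exp (-(δ * |s|))) atBot (𝓝 0) :=
      Real.tendsto_exp_neg_atTop_nhds_zero.comp (tendsto_abs_atBot_atTop.const_mul_atTop hδ)
    simpa using this.const_mul C
  exact squeeze_zero_norm hg h1

/-- The integrand F satisfies F' = -βF + exp((2-β)s) exp(-exp s) and vanishes at both ends.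
Integrating gives β∫F = Γ(2-β). -/
theorem integral_gLim_atLeastTwo (hρ0 : 0 < ρ) (hρ2 : ρ < 2) (t : ℝ) :
    ∫ s : ℝ, Complex.exp (-(t * Complex.I) * s) * gLim ρ atLeastTwo s =
      Complex.Gamma (2 - (ρ + t * Complex.I)) / (ρ + t * Complex.I) := by
  set β : ℂ := ρ + t * Complex.I with hβ
  have hβre : β.re = ρ := by simp [hβ]
  have hβ0 : β ≠ 0 := fun h => by
    rw [h] at hβre; simp at hβre; linarith
  have hδ : 0 < min (2 - ρ) (ρ - 0) := lt_min (by linarith) (by linarith)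
  have hb := expBound_gLim_atLeastTwo hρ0 hρ2
  set F : ℝ → ℂ := fun s => Complex.exp (-(t * Complex.I) * s) * gLim ρ atLeastTwo s with hF
  have hFeq : ∀ s : ℝ, F s = Complex.exp (-β * s) *
      ((1 - (1 + Real.exp s) * Real.exp (-Real.exp s) : ℝ) : ℂ) := by
    intro s
    simp only [hF, gLim, poissonMean_atLeastTwo]
    rw [Complex.ofReal_mul, ← mul_assoc, Complex.ofReal_exp, ← Complex.exp_add]
    congr 2
    rw [hβ]
    push_cast
    ring
  have hnorm : ∀ s, ‖F s‖ = |gLim ρ atLeastTwo s| := by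
    intro s
    rw [hF, norm_mul, Complex.norm_real, Real.norm_eq_abs, Complex.norm_exp]
    simp
  have hFint : Integrable F := by
    refine Integrable.mono' (hb.integrable hδ continuous_gLim_atLeastTwo).abs ?_
      (Eventually.of_forall fun s => (hnorm s).le)
    have := continuous_gLim_atLeastTwo (ρ := ρ)
    exact Continuous.aestronglyMeasurable (by fun_prop)
  have hz : (2 - β).re = 2 - ρ := by simp [hβre]
  have hKint := integrable_cexp_mul_cexp_neg_exp (z := 2 - β) (by rw [hz]; linarith)
    (by rw [hz]; linarith)
  have hderiv : ∀ s : ℝ, HasDerivAt F (-β * F s +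
      Complex.exp ((2 - β) * s) * Complex.exp (-Real.exp s : ℝ)) s := by
    intro s
    have h1 : HasDerivAt (fun s : ℝ => Complex.exp (-β * s)) (Complex.exp (-β * s) * -β) s := by
      have : HasDerivAt (fun s : ℝ => -β * (s : ℂ)) (-β * 1) s :=
        (Complex.ofRealCLM.hasDerivAt (x := s)).const_mul (-β)
      simpa using this.cexp
    have h2 := (hasDerivAt_one_sub_exp s).ofReal_comp
    have h3 := h1.mul h2
    rw [show F = fun s : ℝ => _ from funext hFeq]
    refine h3.congr_deriv ?_
    rw [show (2 - β) * (s : ℂ) = -β * s + (2 * s : ℝ) by push_cast; ring, Complex.exp_add]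
    push_cast
    ring
  have hlim0 : ∀ l : Filter ℝ, Tendsto (gLim ρ atLeastTwo) l (𝓝 0) → Tendsto F l (𝓝 0) := by
    intro l hl
    rw [tendsto_zero_iff_norm_tendsto_zero]
    simp only [hnorm]
    simpa using hl.abs
  have h0 := integral_of_hasDerivAt_of_tendsto hderiv ((hFint.const_mul _).add hKint)
    (hlim0 _ (hb.tendsto_atBot hδ)) (hlim0 _ (hb.tendsto_atTop hδ))
  rw [integral_add (hFint.const_mul _) hKint, integral_const_mul,
    integral_cexp_mul_cexp_neg_exp (by rw [hz]; linarith)] at h0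
  rw [eq_div_iff hβ0]
  linear_combination -h0

/-- Writing Γ(2-β) = Γ(3-β)/(2-β), with Γ(3-β) bounded on the vertical line, makes the terms O(k⁻²).
-/
theorem summable_Gamma_div (hρ2 : ρ < 2) {d : ℝ} (hd : 0 < d) :
    Summable (fun k : ℤ => Complex.Gamma (2 - (ρ + (2 * Real.pi * k / d : ℝ) * Complex.I)) /
      (ρ + (2 * Real.pi * k / d : ℝ) * Complex.I)) := by
  set B : ℝ := ∫ s : ℝ, Real.exp ((3 - ρ) * s) * Real.exp (-Real.exp s) with hB
  have hpi := Real.pi_pos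
  refine Summable.of_norm_bounded_eventually (g := fun k : ℤ =>
    B * (d / (2 * Real.pi)) ^ 2 * (1 / (k : ℝ) ^ 2)) ?_ ?_
  · exact (Real.summable_one_div_int_pow.2 (by norm_num)).mul_left _
  · have hfin : {k : ℤ | k = 0}.Finite := Set.finite_singleton 0
    refine hfin.subset fun k hk => ?_
    by_contra hk0
    refine hk ?_
    set t : ℝ := 2 * Real.pi * k / d with ht
    have hk1 : (k : ℝ) ≠ 0 := by exact_mod_cast hk0
    have ht0 : t ≠ 0 := by positivity
    set β : ℂ := ρ + t * Complex.I with hβ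
    have hβim : β.im = t := by simp [hβ]
    have hβre : β.re = ρ := by simp [hβ]
    have h1 : |t| ≤ ‖β‖ := by rw [← hβim]; exact Complex.abs_im_le_norm β
    have h2 : |t| ≤ ‖2 - β‖ := by
      have := Complex.abs_im_le_norm (2 - β)
      simpa [hβim] using this
    have htp : 0 < |t| := abs_pos.2 ht0
    have h20 : 2 - β ≠ 0 := norm_pos_iff.1 (htp.trans_le h2)
    have h3 : Complex.Gamma (2 - β) = Complex.Gamma (3 - β) / (2 - β) := by
      rw [eq_div_iff h20, mul_comm, ← Complex.Gamma_add_one _ h20]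
      congr 1
      ring
    have h4 : ‖Complex.Gamma (3 - β)‖ ≤ B := by
      have hre : (3 - β).re = 3 - ρ := by simp [hβre]
      have := norm_Gamma_le_integral (z := 3 - β) (by rw [hre]; linarith)
      rwa [hre] at this
    change ‖Complex.Gamma (2 - β) / β‖ ≤ B * (d / (2 * Real.pi)) ^ 2 * (1 / (k : ℝ) ^ 2)
    rw [h3, norm_div, norm_div, div_div]
    have h5 : |t| * |t| = (2 * Real.pi / d) ^ 2 * (k : ℝ) ^ 2 := by
      rw [abs_mul_abs_self, ht]; ring
    calc _ ≤ B / (|t| * |t|) := by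
          have : 0 ≤ B := (norm_nonneg _).trans h4
          gcongr
      _ = _ := by
          rw [h5]
          field_simp

end Fourier

end GTrie

end

noncomputable section

namespace GTrie

open Topology

/-! ### Expansion of the periodic function over the roots -/

namespace IsSetting

variable {M A : ℕ} {p : Fin A → ℝ} {ρ a : ℝ} (h : IsSetting M p ρ a)

include h

/-- Equality in the triangle inequality: the terms have modulus p j ^ ρ and their real parts must
add up to the sum of these moduli, so each term is real and positive. -/
theorem cpow_eq_of_mem_roots {s : ℂ} (hs : s ∈ roots M p ρ) (j : Fin A) :
    (p j : ℂ) ^ s = ((p j ^ ρ : ℝ) : ℂ) := by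
  have hnorm : ∀ j, ‖(p j : ℂ) ^ s‖ = p j ^ ρ := fun j => by
    rw [Complex.norm_cpow_eq_rpow_re_of_pos (h.hp j).1, hs.2]
  have hsum : ∑ j, ((p j : ℂ) ^ s).re = ∑ j, p j ^ ρ := by
    have h1 : (M : ℂ) * ∑ j, (p j : ℂ) ^ s = 1 := (sub_eq_zero.1 hs.1).symm
    have h2 := congrArg Complex.re h1
    rw [← Complex.ofReal_natCast, Complex.re_ofReal_mul, Complex.re_sum, Complex.one_re] at h2
    rw [h.hρ, eq_div_iff h.M_pos.ne']
    linarith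
  have hle : ∀ j ∈ Finset.univ, ((p j : ℂ) ^ s).re ≤ p j ^ ρ := fun j _ =>
    (Complex.re_le_norm _).trans (hnorm j).le
  have h3 := (Finset.sum_eq_sum_iff_of_le hle).1 hsum j (Finset.mem_univ j)
  have h4 : ((p j : ℂ) ^ s).re = ‖(p j : ℂ) ^ s‖ := by rw [h3, hnorm]
  rw [Complex.ext_iff]
  refine ⟨by rw [h3, Complex.ofReal_re], ?_⟩
  rw [Complex.ofReal_im]
  exact (Complex.nonneg_iff.1 (Complex.re_eq_norm.1 h4)).2.symm

theorem exists_int_of_mem_roots {s : ℂ} (hs : s ∈ roots M p ρ) (j : Fin A) :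
    ∃ k : ℤ, s.im * Real.log (p j) = k * (2 * Real.pi) := by
  have h1 := h.cpow_eq_of_mem_roots hs j
  have hp0 : (p j : ℂ) ≠ 0 := by exact_mod_cast (h.hp j).1.ne'
  rw [Real.rpow_def_of_pos (h.hp j).1, Complex.cpow_def_of_ne_zero hp0, Complex.ofReal_exp,
    ← Complex.ofReal_log (h.hp j).1.le, Complex.exp_eq_exp_iff_exists_int] at h1
  obtain ⟨k, hk⟩ := h1
  refine ⟨k, ?_⟩
  have h2 := congrArg Complex.im hk
  simp at h2
  linarith

/-- Since p j ^ s takes the same value at every root, so does the denominator: it is minus the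
drift. -/
theorem GE_eq_of_mem_roots {s : ℂ} (hs : s ∈ roots M p ρ) :
    GE M p s = (drift M p ρ : ℂ)⁻¹ * (Complex.Gamma (2 - s) / s) := by
  have h1 : (M : ℂ) * ∑ j, (p j : ℂ) ^ s * (Real.log (p j) : ℂ) = -(drift M p ρ : ℂ) := by
    rw [drift_eq]
    push_cast
    simp only [h.cpow_eq_of_mem_roots hs]
    ring
  rw [GE, h1, neg_div, neg_div_neg_eq, div_eq_inv_mul]

theorem rho_mem_roots : (ρ : ℂ) ∈ roots M p ρ := by
  refine ⟨?_, Complex.ofReal_re ρ⟩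
  have h1 : ∑ j, (p j : ℂ) ^ (ρ : ℂ) = ((∑ j, p j ^ ρ : ℝ) : ℂ) := by
    push_cast
    exact Finset.sum_congr rfl fun j _ => (Complex.ofReal_cpow (h.hp j).1.le ρ).symm
  rw [h1, h.hρ]
  have := h.M_pos.ne'
  push_cast
  rw [mul_one_div_cancel (by exact_mod_cast this), sub_self]

theorem hasSum_roots_of_not_periodic (hper : ¬ PeriodicCase p) (x : ℝ) :
    HasSum (fun β : roots M p ρ =>
        GE M p β * Complex.exp (((β : ℂ) - ρ) * Real.log a * x))
      (limitFn M p ρ a (gLim ρ atLeastTwo) x : ℂ) := by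
  have hρ1 := h.one_le_rho
  have hρ2 := h.rho_lt_two
  -- At a root with nonzero imaginary part, every Im(s)·log p_j is an integer multiple of 2π, which
  -- would make all ratios of logarithms rational.
  have huniq : ∀ β : roots M p ρ, β = ⟨ρ, h.rho_mem_roots⟩ := by
    rintro ⟨s, hs⟩
    rw [Subtype.mk.injEq]
    rw [Complex.ext_iff]
    refine ⟨hs.2, ?_⟩
    rw [Complex.ofReal_im]
    by_contra him
    refine hper fun i j => ?_
    obtain ⟨k, hk⟩ := h.exists_int_of_mem_roots hs i
    obtain ⟨l, hl⟩ := h.exists_int_of_mem_roots hs j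
    refine ⟨k / l, ?_⟩
    rw [← mul_div_mul_left _ _ him, hk, hl, mul_div_mul_right _ _ (by positivity)]
    push_cast
    rfl
  have h1 := hasSum_single (f := fun β : roots M p ρ =>
        GE M p β * Complex.exp (((β : ℂ) - ρ) * Real.log a * x)) ⟨ρ, h.rho_mem_roots⟩
        (fun β hβ => absurd (huniq β) hβ)
  convert! h1 using 1
  have h2 := integral_gLim_atLeastTwo (ρ := ρ) (by linarith) hρ2 0
  simp only [Complex.ofReal_zero, zero_mul, neg_zero, Complex.exp_zero, one_mul, add_zero] at h2
  rw [integral_complex_ofReal] at h2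
  rw [h.GE_eq_of_mem_roots h.rho_mem_roots, ← h2, limitFn, if_neg hper]
  simp

/-- The roots are ρ + 2πik/log a, and the sum over them is the Fourier side of Poisson summation for
y ↦ `gLim` at y·log a. -/
theorem hasSum_roots_of_periodic (hper : PeriodicCase p) (x : ℝ) :
    HasSum (fun β : roots M p ρ =>
        GE M p β * Complex.exp (((β : ℂ) - ρ) * Real.log a * x))
      (limitFn M p ρ a (gLim ρ atLeastTwo) x : ℂ) := by
  have hρ1 := h.one_le_rho
  have hρ2 := h.rho_lt_two
  have hρ0 : 0 < ρ := by linarith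
  set d := Real.log a with hd_def
  have hd : 0 < d := h.log_a_pos
  have hpi := Real.pi_pos
  obtain ⟨e, he, hgcd, hpe⟩ : ∃ e : Fin A → ℕ, (∀ j, 0 < e j) ∧ Finset.univ.gcd e = 1 ∧
      ∀ j, Real.log (p j) = -(e j * d) := by
    rcases h.ha with h1 | h1
    · obtain ⟨-, -, e, he, hgcd, hpe⟩ := h1
      exact ⟨e, he, hgcd, fun j => by rw [hpe, Real.log_inv, Real.log_pow]⟩
    · exact absurd hper h1.1
  set b : ℤ → ℂ := fun k => ρ + (2 * Real.pi * k / d : ℝ) * Complex.I with hb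
  have hbmem : ∀ k, b k ∈ roots M p ρ := by
    intro k
    refine ⟨?_, by simp [hb]⟩
    rw [← h.rho_mem_roots.1]
    congr 2
    refine Finset.sum_congr rfl fun j _ => ?_
    have hp0 : (p j : ℂ) ≠ 0 := by exact_mod_cast (h.hp j).1.ne'
    rw [Complex.cpow_def_of_ne_zero hp0, Complex.cpow_def_of_ne_zero hp0,
      Complex.exp_eq_exp_iff_exists_int]
    refine ⟨-(e j * k), ?_⟩
    rw [← Complex.ofReal_log (h.hp j).1.le, hpe]
    have hd0 : (d : ℂ) ≠ 0 := by exact_mod_cast hd.ne'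
    simp only [hb]
    push_cast
    field_simp
    ring
  have hbij : Function.Bijective (fun k : ℤ => (⟨b k, hbmem k⟩ : roots M p ρ)) := by
    constructor
    · intro k l hkl
      have h1 := congrArg Complex.im (Subtype.mk.inj hkl)
      simp [hb] at h1
      field_simp at h1
      exact_mod_cast h1
    · rintro ⟨s, hs⟩
      -- Each multiple by e_j is an integer; as the e_j have no common factor, so is the number
      -- itself.
      have h1 : d * s.im / (2 * Real.pi) ∈ AddSubgroup.zmultiples (1 : ℝ) := by
        refine mem_of_gcd_mul_mem hgcd fun j => ?_
        obtain ⟨k, hk⟩ := h.exists_int_of_mem_roots hs j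
        refine ⟨-k, ?_⟩
        rw [hpe] at hk
        simp only [zsmul_eq_mul, mul_one, Int.cast_neg]
        field_simp
        linarith
      obtain ⟨k, hk⟩ := h1
      refine ⟨k, ?_⟩
      rw [Subtype.mk.injEq, Complex.ext_iff]
      refine ⟨by simp [hb, hs.2], ?_⟩
      simp only [zsmul_eq_mul, mul_one] at hk
      simp [hb]
      rw [hk]
      field_simp
  rw [← (Equiv.ofBijective _ hbij).hasSum_iff]
  set f : ℝ → ℂ := fun y => (gLim ρ atLeastTwo (y * d) : ℂ) with hf
  have hfc : Continuous f := by
    have := continuous_gLim_atLeastTwo (ρ := ρ)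
    exact Complex.continuous_ofReal.comp (this.comp (by fun_prop))
  set δ := min (2 - ρ) (ρ - 0) with hδdef
  have hδ : 0 < δ := lt_min (by linarith) (by linarith)
  have hbd := expBound_gLim_atLeastTwo hρ0 hρ2
  have hFour : ∀ k : ℤ, FourierTransform.fourier f (k : ℝ) =
      (d : ℂ)⁻¹ * (Complex.Gamma (2 - b k) / b k) := by
    intro k
    rw [Real.fourier_real_eq_integral_exp_smul]
    have h1 := integral_gLim_atLeastTwo hρ0 hρ2 (2 * Real.pi * k / d)
    rw [← h1]
    have h2 := Measure.integral_comp_mul_right (fun s : ℝ =>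
      Complex.exp (-((2 * Real.pi * k / d : ℝ) * Complex.I) * s) * gLim ρ atLeastTwo s) d
    rw [abs_of_pos (inv_pos.2 hd), Complex.real_smul, Complex.ofReal_inv] at h2
    rw [← h2]
    refine integral_congr_ae (Eventually.of_forall fun y => ?_)
    have hd0 : (d : ℂ) ≠ 0 := by exact_mod_cast hd.ne'
    simp only [smul_eq_mul, hf]
    congr 2
    push_cast
    field_simp
  have hFsum : Summable (fun k : ℤ => FourierTransform.fourier f (k : ℝ)) := by
    simp only [hFour]
    exact (summable_Gamma_div hρ2 hd).mul_left _
  have hdecay : f =O[cocompact ℝ] (|·| ^ (-(2 : ℝ))) := by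
    have h2 : f =O[cocompact ℝ] fun y => Real.exp (-(δ * d * |y|)) := by
      refine Asymptotics.IsBigO.of_bound (3 * 1) (Eventually.of_forall fun y => ?_)
      rw [hf, Complex.norm_real, Real.norm_eq_abs, Real.norm_eq_abs, Real.abs_exp]
      refine (hbd _).trans (le_of_eq ?_)
      rw [abs_mul, abs_of_pos hd, ← hδdef]
      congr 2
      ring
    refine h2.trans ?_
    have h3 := (isLittleO_exp_neg_mul_rpow_atTop (mul_pos hδ hd) (-2)).isBigO
    have h4 := h3.comp_tendsto (tendsto_norm_cocompact_atTop (E := ℝ))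
    refine (Asymptotics.isBigO_of_le _ fun y => ?_).trans h4
    simp [Function.comp]
  have hpoisson := Real.tsum_eq_tsum_fourier_of_rpow_decay_of_summable hfc one_lt_two hdecay
    hFsum x
  have hterm : ∀ k : ℤ, ((fun β : roots M p ρ =>
      GE M p β * Complex.exp (((β : ℂ) - ρ) * d * x)) ∘ Equiv.ofBijective _ hbij) k =
      (d / drift M p ρ : ℂ) * (FourierTransform.fourier f (k : ℝ) *
        fourier k (x : UnitAddCircle)) := by
    intro k
    have hd0 : (d : ℂ) ≠ 0 := by exact_mod_cast hd.ne'
    simp only [Function.comp, Equiv.ofBijective_apply]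
    rw [h.GE_eq_of_mem_roots (hbmem k), hFour, fourier_coe_apply]
    have h1 : ((b k) - ρ) * d * x = 2 * Real.pi * Complex.I * k * x / ((1 : ℝ) : ℂ) := by
      simp only [hb]
      push_cast
      field_simp
      ring
    rw [h1]
    field_simp
  have hfs : Summable (fun k : ℤ => FourierTransform.fourier f (k : ℝ) *
      fourier k (x : UnitAddCircle)) := by
    refine Summable.of_norm ?_
    refine hFsum.norm.congr fun k => ?_
    rw [norm_mul, fourier_apply, Circle.norm_coe, mul_one]
  have hfin := hfs.hasSum.mul_left (d / drift M p ρ : ℂ)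
  rw [← hpoisson] at hfin
  rw [funext hterm]
  convert! hfin using 1
  rw [limitFn, if_pos hper, Complex.ofReal_mul, Complex.ofReal_div, Complex.ofReal_tsum]
  congr 1
  -- Poisson summation has the shifts x + k, while `limitFn` has x - m.
  rw [← (Equiv.neg ℤ).tsum_eq]
  refine tsum_congr fun k => ?_
  simp only [hf, Equiv.neg_apply]
  congr 2
  push_cast
  ring

theorem hasSum_roots (x : ℝ) :
    HasSum (fun β : roots M p ρ =>
        GE M p β * Complex.exp (((β : ℂ) - ρ) * Real.log a * x))
      (limitFn M p ρ a (gLim ρ atLeastTwo) x : ℂ) := by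
  by_cases hper : PeriodicCase p
  · exact h.hasSum_roots_of_periodic hper x
  · exact h.hasSum_roots_of_not_periodic hper x

end IsSetting

end GTrie

end

noncomputable section

namespace GTrie

open Topology

/-! ### Independence of events depending on disjoint sets of labels -/

section Independence

variable {Ω : Type*} [MeasurableSpace Ω] {μ : Measure Ω} [IsProbabilityMeasure μ]
  {ι : Type*} {A : ℕ} {X : ι → Ω → Fin A}

/-- Coordinates outside S are irrelevant and may be frozen at their values at one sample point. The
event becomes the preimage of a subset of a finite space. -/
theorem exists_preimage_of_dependsOn (μ : Measure Ω) [IsProbabilityMeasure μ] {S : Finset ι}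
    {E : (ι → Fin A) → Prop} (hE : DependsOn E S) :
    ∃ B : Set (S → Fin A), {ω | E fun i => X i ω} = (fun ω (i : S) => X i ω) ⁻¹' B := by
  classical
  obtain ⟨ω₀⟩ : Nonempty Ω := μ.nonempty_of_neZero
  refine ⟨{t | E fun i => if h : i ∈ S then t ⟨i, h⟩ else X i ω₀}, ?_⟩
  ext ω
  have : E (fun i => X i ω) = E fun i => if _ : i ∈ S then X i ω else X i ω₀ :=
    hE fun i hi => by simp [Finset.mem_coe.1 hi]
  simp [this]

theorem measurableSet_of_dependsOn (μ : Measure Ω) [IsProbabilityMeasure μ]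
    (hm : ∀ i, Measurable (X i)) {S : Finset ι} {E : (ι → Fin A) → Prop} (hE : DependsOn E S) :
    MeasurableSet {ω | E fun i => X i ω} := by
  obtain ⟨B, hB⟩ := exists_preimage_of_dependsOn (X := X) μ hE
  rw [hB]
  have h : Measurable fun ω (i : S) => X i ω := measurable_pi_lambda _ fun i => hm i
  exact h (Set.toFinite B).measurableSet

/-- Events depending on disjoint sets of independent variables are independent. -/
theorem measureReal_and_of_dependsOn (hX : iIndepFun X μ) (hm : ∀ i, Measurable (X i))
    {S T : Finset ι} (hST : Disjoint S T) {E F : (ι → Fin A) → Prop} (hE : DependsOn E S)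
    (hF : DependsOn F T) :
    μ.real {ω | E (fun i => X i ω) ∧ F fun i => X i ω} =
      μ.real {ω | E fun i => X i ω} * μ.real {ω | F fun i => X i ω} := by
  obtain ⟨B, hB⟩ := exists_preimage_of_dependsOn (X := X) μ hE
  obtain ⟨C, hC⟩ := exists_preimage_of_dependsOn (X := X) μ hF
  have h1 := (hX.indepFun_finset S T hST hm).measure_inter_preimage_eq_mul _ _
    (Set.toFinite B).measurableSet (Set.toFinite C).measurableSet
  have h2 : {ω | E (fun i => X i ω) ∧ F fun i => X i ω} =
      {ω | E fun i => X i ω} ∩ {ω | F fun i => X i ω} := rfl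
  rw [h2, hB, hC, measureReal_def, measureReal_def, measureReal_def, ← ENNReal.toReal_mul, h1]

end Independence

/-! ### Occurrence probabilities of one and two paths -/

section Occurrence

variable {M A : ℕ}

/-- The edges along a labeled path. -/
def edges : List (Fin M × Fin A) → Finset (Edge M)
  | [] => ∅
  | x :: w => insert ([], x.1) ((edges w).image fun e => (x.1 :: e.1, e.2))

theorem occurs_congr {l l' : Labeling M A} {w : List (Fin M × Fin A)}
    (h : ∀ e ∈ edges w, l e = l' e) : Occurs l w = Occurs l' w := by
  induction w generalizing l l' with
  | nil => rfl
  | cons x w ih =>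
    simp only [Occurs]
    rw [h _ (Finset.mem_insert_self _ _), ih (l := l.subtree x.1) (l' := l'.subtree x.1)]
    intro e he
    exact h _ (Finset.mem_insert_of_mem (Finset.mem_image_of_mem _ he))

theorem dependsOn_occurs (w : List (Fin M × Fin A)) :
    DependsOn (fun l : Labeling M A => Occurs l w) (edges w : Set (Edge M)) :=
  fun _ _ h => occurs_congr h

/-- The probability that two labeled paths both occur in a random labeling. -/
def joint (c : Fin M × Fin A → ℝ) : List (Fin M × Fin A) → List (Fin M × Fin A) → ℝ
  | [], v => wt c v
  | x :: w, [] => wt c (x :: w)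
  | x :: w, y :: v => if x = y then c x * joint c w v else
      if x.1 = y.1 then 0 else wt c (x :: w) * wt c (y :: v)

/-- The labels of one random labeling are independent, and each is `j` with probability `p j`. -/
structure IsRandomLabeling {Ω : Type*} [MeasurableSpace Ω] (μ : Measure Ω) (p : Fin A → ℝ)
    (Y : Edge M → Ω → Fin A) : Prop where
  measurable : ∀ e, Measurable (Y e)
  law : ∀ e j, μ.real {ω | Y e ω = j} = p j
  indep : iIndepFun Y μ

variable {Ω : Type*} [MeasurableSpace Ω] {μ : Measure Ω} [IsProbabilityMeasure μ]
  {p : Fin A → ℝ} {Y : Edge M → Ω → Fin A}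

omit [IsProbabilityMeasure μ] in
theorem IsRandomLabeling.subtree (hY : IsRandomLabeling μ p Y) (i : Fin M) :
    IsRandomLabeling μ p (fun e => Y (i :: e.1, e.2)) where
  measurable e := hY.measurable _
  law e := hY.law _
  indep := by
    refine hY.indep.precomp (g := fun e : Edge M => (i :: e.1, e.2)) fun e e' h => ?_
    simpa [Prod.ext_iff] using h

theorem dependsOn_root (x : Fin M × Fin A) :
    DependsOn (fun l : Labeling M A => l ([], x.1) = x.2)
      (({([], x.1)} : Finset (Edge M)) : Set (Edge M)) :=
  fun _ _ h => by
    beta_reduce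
    rw [h _ (by simp)]

theorem disjoint_root_image (i : Fin M) (T : Finset (Edge M)) :
    Disjoint {([], i)} (T.image fun e => (i :: e.1, e.2)) := by
  rw [Finset.disjoint_singleton_left]
  simp

theorem dependsOn_subtree {i : Fin M} {E : Labeling M A → Prop} {T : Finset (Edge M)}
    (hE : DependsOn E (T : Set (Edge M))) :
    DependsOn (fun l : Labeling M A => E (l.subtree i))
      ((T.image fun e => (i :: e.1, e.2) : Finset (Edge M)) : Set (Edge M)) :=
  fun _ _ h => hE fun _ he => h _ (Finset.mem_coe.2 (Finset.mem_image_of_mem _ he))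

theorem IsRandomLabeling.occurs_prob (hY : IsRandomLabeling μ p Y) (w : List (Fin M × Fin A)) :
    μ.real {ω | Occurs (fun e => Y e ω) w} = wt (letterP M p) w := by
  induction w generalizing Y with
  | nil => simp [Occurs]
  | cons x w ih =>
    have h1 := measureReal_and_of_dependsOn hY.indep hY.measurable
      (disjoint_root_image x.1 (edges w)) (dependsOn_root x)
      (dependsOn_subtree (i := x.1) (dependsOn_occurs w))
    rw [hY.law] at h1
    rw [wt_cons, ← ih (hY.subtree x.1)]
    exact h1

/-- Compare the first letters. If they agree, the common root edge is independent of the subtree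
below it; different labels on the same edge exclude each other; different root edges lead to
disjoint sets of edges. -/
theorem IsRandomLabeling.joint_prob (hY : IsRandomLabeling μ p Y) (w w' : List (Fin M × Fin A)) :
    μ.real {ω | Occurs (fun e => Y e ω) w ∧ Occurs (fun e => Y e ω) w'} =
      joint (letterP M p) w w' := by
  induction w generalizing w' Y with
  | nil => simpa [Occurs, joint] using hY.occurs_prob w'
  | cons x w ih =>
    rcases w' with _ | ⟨y, w'⟩
    · simpa [Occurs, joint] using hY.occurs_prob (x :: w)
    rw [joint]
    split_ifs with h1 h2
    · subst h1
      have h3 := measureReal_and_of_dependsOn hY.indep hY.measurable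
        (disjoint_root_image x.1 (edges w ∪ edges w')) (dependsOn_root x)
        (dependsOn_subtree (i := x.1)
          (E := fun l : Labeling M A => Occurs l w ∧ Occurs l w') (fun l l' h => by
            beta_reduce
            rw [occurs_congr (w := w) fun e he => h e (by simp [he]),
              occurs_congr (w := w') fun e he => h e (by simp [he])]))
      rw [hY.law] at h3
      rw [← ih (hY.subtree x.1)]
      refine Eq.trans ?_ h3
      congr 1
      ext ω
      simp only [Occurs, Set.mem_ofPred_eq]
      tauto
    · have h3 : {ω | Occurs (fun e => Y e ω) (x :: w) ∧ Occurs (fun e => Y e ω) (y :: w')} = ∅ := by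
        ext ω
        simp only [Occurs, Set.mem_ofPred_eq, Set.mem_empty_iff_false, iff_false]
        rintro ⟨⟨h4, -⟩, h5, -⟩
        rw [← h2, h4] at h5
        exact h1 (Prod.ext h2 h5)
      rw [h3, measureReal_empty]
    · rw [← hY.occurs_prob, ← hY.occurs_prob]
      refine measureReal_and_of_dependsOn hY.indep hY.measurable ?_ (dependsOn_occurs (x :: w))
        (dependsOn_occurs (y :: w'))
      rw [Finset.disjoint_left]
      intro e he he'
      simp only [edges, Finset.mem_insert, Finset.mem_image] at he he'
      rcases he with rfl | ⟨f, -, rfl⟩ <;> rcases he' with h4 | ⟨f', -, h4⟩ <;>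
        simp_all

end Occurrence

/-! ### The joint law of two occurrence counts -/

section Counts

variable {M A : ℕ}

open Classical in
/-- The number of occurrences of a labeled path in the first `n` labelings. -/
def cnt (n : ℕ) (w : List (Fin M × Fin A)) (l : ℕ × Edge M → Fin A) : ℕ :=
  ∑ k ∈ Finset.range n, if Occurs (fun e => l (k, e)) w then 1 else 0

theorem cnt_congr {n : ℕ} {w : List (Fin M × Fin A)} {l l' : ℕ × Edge M → Fin A}
    (h : ∀ k < n, ∀ e ∈ edges w, l (k, e) = l' (k, e)) : cnt n w l = cnt n w l' := by
  classical
  refine Finset.sum_congr rfl fun k hk => ?_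
  rw [occurs_congr (h k (Finset.mem_range.1 hk))]

theorem cnt_succ_of_occurs {n : ℕ} {w : List (Fin M × Fin A)} {l : ℕ × Edge M → Fin A}
    (h : Occurs (fun e => l (n, e)) w) : cnt (n + 1) w l = cnt n w l + 1 := by
  rw [cnt, Finset.sum_range_succ, if_pos h, cnt]

theorem cnt_succ_of_not_occurs {n : ℕ} {w : List (Fin M × Fin A)} {l : ℕ × Edge M → Fin A}
    (h : ¬ Occurs (fun e => l (n, e)) w) : cnt (n + 1) w l = cnt n w l := by
  rw [cnt, Finset.sum_range_succ, if_neg h, cnt, add_zero]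

variable {Ω : Type*} [MeasurableSpace Ω] {μ : Measure Ω} [IsProbabilityMeasure μ]
  {p : Fin A → ℝ} {L : ℕ → Edge M → Ω → Fin A}

omit [IsProbabilityMeasure μ] in
theorem IsRandomLabelings.isRandomLabeling (hL : IsRandomLabelings μ p L) (k : ℕ) :
    IsRandomLabeling μ p (L k) where
  measurable := hL.measurable k
  law := hL.law k
  indep := hL.indep.precomp (g := fun e : Edge M => (k, e)) (Prod.mk_right_injective k)

theorem dependsOn_labelings {K : Finset ℕ} {F : Finset (Edge M)}
    {E : (ℕ × Edge M → Fin A) → Prop}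
    (hE : ∀ l l' : ℕ × Edge M → Fin A, (∀ k ∈ K, ∀ e ∈ F, l (k, e) = l' (k, e)) → (E l ↔ E l')) :
    DependsOn E ((K ×ˢ F : Finset (ℕ × Edge M)) : Set (ℕ × Edge M)) :=
  fun l l' h => propext (hE l l' fun k hk e he => h (k, e) (by simp [hk, he]))

open Classical in
/-- The joint law of the numbers of occurrences of two labeled paths. -/
theorem IsRandomLabelings.pair_law (hL : IsRandomLabelings μ p L) (w w' : List (Fin M × Fin A))
    (n : ℕ) (R : ℕ → ℕ → Prop) :
    μ.real {ω | R (cnt n w fun x => L x.1 x.2 ω) (cnt n w' fun x => L x.1 x.2 ω)} =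
      pairMean (joint (letterP M p) w w') (wt (letterP M p) w - joint (letterP M p) w w')
        (wt (letterP M p) w' - joint (letterP M p) w w') (fun k l => if R k l then 1 else 0) n := by
  induction n generalizing R with
  | zero =>
    simp only [cnt, Finset.range_zero, Finset.sum_empty, pairMean_zero]
    split_ifs with h <;> simp [h]
  | succ n ih =>
    set X : ℕ × Edge M → Ω → Fin A := fun x => L x.1 x.2 with hX
    have hm : ∀ x, Measurable (X x) := fun x => hL.measurable _ _
    set F := edges w ∪ edges w' with hF
    -- Labeling n involves other variables than the labelings before it, so it acts as an
    -- independent new trial.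
    have hdisj : Disjoint (({n} : Finset ℕ) ×ˢ F) (Finset.range n ×ˢ F) := by
      rw [Finset.disjoint_left]
      rintro ⟨k, e⟩ h1 h2
      simp only [Finset.mem_product, Finset.mem_singleton, Finset.mem_range] at h1 h2
      omega
    have hdep : ∀ R : ℕ → ℕ → Prop, DependsOn (fun l : ℕ × Edge M → Fin A =>
        R (cnt n w l) (cnt n w' l)) ((Finset.range n ×ˢ F : Finset _) : Set (ℕ × Edge M)) := by
      intro R
      refine dependsOn_labelings fun l l' h => ?_
      rw [cnt_congr (w := w) fun k hk e he => h k (by simpa using hk) e (by simp [hF, he]),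
        cnt_congr (w := w') fun k hk e he => h k (by simpa using hk) e (by simp [hF, he])]
    have hdepo : ∀ B : Prop → Prop → Prop, DependsOn (fun l : ℕ × Edge M → Fin A =>
        B (Occurs (fun e => l (n, e)) w) (Occurs (fun e => l (n, e)) w'))
        ((({n} : Finset ℕ) ×ˢ F : Finset _) : Set (ℕ × Edge M)) := by
      intro B
      refine dependsOn_labelings fun l l' h => ?_
      rw [occurs_congr (w := w) (l := fun e => l (n, e)) (l' := fun e => l' (n, e))
          fun e he => h n (by simp) e (by simp [hF, he]),
        occurs_congr (w := w') (l := fun e => l (n, e)) (l' := fun e => l' (n, e))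
          fun e he => h n (by simp) e (by simp [hF, he])]
    have hind : ∀ (B : Prop → Prop → Prop) (R : ℕ → ℕ → Prop),
        μ.real {ω | B (Occurs (fun e => L n e ω) w) (Occurs (fun e => L n e ω) w') ∧
          R (cnt n w fun x => L x.1 x.2 ω) (cnt n w' fun x => L x.1 x.2 ω)} =
        μ.real {ω | B (Occurs (fun e => L n e ω) w) (Occurs (fun e => L n e ω) w')} *
        μ.real {ω | R (cnt n w fun x => L x.1 x.2 ω) (cnt n w' fun x => L x.1 x.2 ω)} :=
      fun B R => measureReal_and_of_dependsOn hL.indep hm hdisj (hdepo B) (hdep R)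
    have hmeasC : MeasurableSet {ω | Occurs (fun e => L n e ω) w} :=
      measurableSet_of_dependsOn (X := X) μ hm (hdepo fun a _ => a)
    have hmeasC' : MeasurableSet {ω | Occurs (fun e => L n e ω) w'} :=
      measurableSet_of_dependsOn (X := X) μ hm (hdepo fun _ b => b)
    have hocc := (hL.isRandomLabeling n).occurs_prob w
    have hocc' := (hL.isRandomLabeling n).occurs_prob w'
    have hjoint := (hL.isRandomLabeling n).joint_prob w w'
    have hP10 : μ.real {ω | Occurs (fun e => L n e ω) w ∧ ¬ Occurs (fun e => L n e ω) w'} =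
        wt (letterP M p) w - joint (letterP M p) w w' := by
      rw [← hocc, ← hjoint, ← measureReal_inter_add_sdiff (s := {ω | Occurs (fun e => L n e ω) w})
        hmeasC']
      exact (add_sub_cancel_left _ _).symm
    have hP01 : μ.real {ω | ¬ Occurs (fun e => L n e ω) w ∧ Occurs (fun e => L n e ω) w'} =
        wt (letterP M p) w' - joint (letterP M p) w w' := by
      rw [← hocc', ← hjoint, ← measureReal_inter_add_sdiff
        (s := {ω | Occurs (fun e => L n e ω) w'}) hmeasC, Set.inter_comm]
      rw [show {ω | ¬ Occurs (fun e => L n e ω) w ∧ Occurs (fun e => L n e ω) w'} =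
        {ω | Occurs (fun e => L n e ω) w'} \ {ω | Occurs (fun e => L n e ω) w} by
          ext ω; simp [and_comm]]
      exact (add_sub_cancel_left _ _).symm
    have hP00 : μ.real {ω | ¬ Occurs (fun e => L n e ω) w ∧ ¬ Occurs (fun e => L n e ω) w'} =
        1 - joint (letterP M p) w w' - (wt (letterP M p) w - joint (letterP M p) w w')
          - (wt (letterP M p) w' - joint (letterP M p) w w') := by
      have h1 := measureReal_inter_add_sdiff (μ := μ)
        (s := {ω | ¬ Occurs (fun e => L n e ω) w}) hmeasC'
      have h2 : μ.real {ω | ¬ Occurs (fun e => L n e ω) w} = 1 - wt (letterP M p) w := by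
        rw [← hocc, ← probReal_compl_eq_one_sub hmeasC]
        rfl
      rw [h2] at h1
      have h3 : μ.real ({ω | ¬ Occurs (fun e => L n e ω) w} ∩ {ω | Occurs (fun e => L n e ω) w'})
        = wt (letterP M p) w' - joint (letterP M p) w w' := hP01
      have h4 : μ.real {ω | ¬ Occurs (fun e => L n e ω) w ∧ ¬ Occurs (fun e => L n e ω) w'} =
        μ.real ({ω | ¬ Occurs (fun e => L n e ω) w} \ {ω | Occurs (fun e => L n e ω) w'}) := rfl
      rw [h4]
      linarith
    set E := {ω | R (cnt (n + 1) w fun x => L x.1 x.2 ω) (cnt (n + 1) w' fun x => L x.1 x.2 ω)}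
      with hE
    -- Four cases, by which of the two paths occur in labeling n; they match the four masses in the
    -- recursion of `pairMean`.
    have hsplit : μ.real E =
        (μ.real (E ∩ {ω | Occurs (fun e => L n e ω) w} ∩ {ω | Occurs (fun e => L n e ω) w'})
        + μ.real ((E ∩ {ω | Occurs (fun e => L n e ω) w}) \ {ω | Occurs (fun e => L n e ω) w'}))
        + (μ.real ((E \ {ω | Occurs (fun e => L n e ω) w}) ∩ {ω | Occurs (fun e => L n e ω) w'})
        + μ.real ((E \ {ω | Occurs (fun e => L n e ω) w}) \
          {ω | Occurs (fun e => L n e ω) w'})) := by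
      rw [measureReal_inter_add_sdiff hmeasC', measureReal_inter_add_sdiff hmeasC',
        measureReal_inter_add_sdiff hmeasC]
    have e11 : E ∩ {ω | Occurs (fun e => L n e ω) w} ∩ {ω | Occurs (fun e => L n e ω) w'} =
        {ω | (Occurs (fun e => L n e ω) w ∧ Occurs (fun e => L n e ω) w') ∧
          R (cnt n w (fun x => L x.1 x.2 ω) + 1) (cnt n w' (fun x => L x.1 x.2 ω) + 1)} := by
      ext ω
      by_cases h1 : Occurs (fun e => L n e ω) w <;> by_cases h2 : Occurs (fun e => L n e ω) w' <;>
        simp [h1, h2, hE, cnt_succ_of_occurs]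
    have e10 : (E ∩ {ω | Occurs (fun e => L n e ω) w}) \ {ω | Occurs (fun e => L n e ω) w'} =
        {ω | (Occurs (fun e => L n e ω) w ∧ ¬ Occurs (fun e => L n e ω) w') ∧
          R (cnt n w (fun x => L x.1 x.2 ω) + 1) (cnt n w' (fun x => L x.1 x.2 ω))} := by
      ext ω
      by_cases h1 : Occurs (fun e => L n e ω) w <;> by_cases h2 : Occurs (fun e => L n e ω) w' <;>
        simp [h1, h2, hE, cnt_succ_of_occurs, cnt_succ_of_not_occurs]
    have e01 : (E \ {ω | Occurs (fun e => L n e ω) w}) ∩ {ω | Occurs (fun e => L n e ω) w'} =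
        {ω | (¬ Occurs (fun e => L n e ω) w ∧ Occurs (fun e => L n e ω) w') ∧
          R (cnt n w (fun x => L x.1 x.2 ω)) (cnt n w' (fun x => L x.1 x.2 ω) + 1)} := by
      ext ω
      by_cases h1 : Occurs (fun e => L n e ω) w <;> by_cases h2 : Occurs (fun e => L n e ω) w' <;>
        simp [h1, h2, hE, cnt_succ_of_occurs, cnt_succ_of_not_occurs]
    have e00 : (E \ {ω | Occurs (fun e => L n e ω) w}) \ {ω | Occurs (fun e => L n e ω) w'} =
        {ω | (¬ Occurs (fun e => L n e ω) w ∧ ¬ Occurs (fun e => L n e ω) w') ∧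
          R (cnt n w (fun x => L x.1 x.2 ω)) (cnt n w' (fun x => L x.1 x.2 ω))} := by
      ext ω
      by_cases h1 : Occurs (fun e => L n e ω) w <;> by_cases h2 : Occurs (fun e => L n e ω) w' <;>
        simp [h1, h2, hE, cnt_succ_of_not_occurs]
    rw [hsplit, e11, e10, e01, e00, hind (fun a b => a ∧ b) (fun k l => R (k + 1) (l + 1)),
      hind (fun a b => a ∧ ¬ b) (fun k l => R (k + 1) l),
      hind (fun a b => ¬ a ∧ b) (fun k l => R k (l + 1)),
      hind (fun a b => ¬ a ∧ ¬ b) R, hjoint, hP10, hP01, hP00,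
      ih (fun k l => R (k + 1) (l + 1)), ih (fun k l => R (k + 1) l),
      ih (fun k l => R k (l + 1)), ih R, pairMean_succ]
    ring

end Counts

end GTrie

end

noncomputable section

namespace GTrie

open Topology

/-! ### Mixed factorial moments of two counts -/

section PairMeans

variable {r p p' : ℝ}

theorem pairMean_fst (a b c : ℝ) (τ : ℕ → ℝ) (n : ℕ) :
    pairMean a b c (fun k _ => τ k) n = binomMean (a + b) τ n := by
  induction n generalizing τ with
  | zero => rfl
  | succ n ih => rw [pairMean_succ, binomMean_succ, ih, ih τ]; ring

theorem pairMean_snd (a b c : ℝ) (τ : ℕ → ℝ) (n : ℕ) :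
    pairMean a b c (fun _ l => τ l) n = binomMean (a + c) τ n := by
  induction n generalizing τ with
  | zero => rfl
  | succ n ih => rw [pairMean_succ, binomMean_succ, ih, ih τ]; ring

theorem pairMean_le {a b c : ℝ} (ha : 0 ≤ a) (hb : 0 ≤ b) (hc : 0 ≤ c) (h1 : a + b + c ≤ 1)
    {φ ψ : ℕ → ℕ → ℝ} (h : ∀ k l, φ k l ≤ ψ k l) (n : ℕ) :
    pairMean a b c φ n ≤ pairMean a b c ψ n := by
  induction n generalizing φ ψ with
  | zero => exact h 0 0
  | succ n ih =>
    have e1 := mul_le_mul_of_nonneg_left (ih fun k l => h (k + 1) (l + 1)) ha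
    have e2 := mul_le_mul_of_nonneg_left (ih fun k l => h (k + 1) l) hb
    have e3 := mul_le_mul_of_nonneg_left (ih fun k l => h k (l + 1)) hc
    have e4 := mul_le_mul_of_nonneg_left (ih h) (by linarith : 0 ≤ 1 - a - b - c)
    rw [pairMean_succ, pairMean_succ]
    linarith

theorem pairMean_nonneg {a b c : ℝ} (ha : 0 ≤ a) (hb : 0 ≤ b) (hc : 0 ≤ c) (h1 : a + b + c ≤ 1)
    {φ : ℕ → ℕ → ℝ} (h : ∀ k l, 0 ≤ φ k l) (n : ℕ) : 0 ≤ pairMean a b c φ n := by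
  have h2 := pairMean_le ha hb hc h1 (φ := fun _ _ => 0) h n
  rwa [pairMean_fst a b c (fun _ => 0), binomMean_const] at h2

/-- The increment of `pairMean` in terms of the partial differences of the function. -/
theorem pairMean_succ_of_diff {φ α β γ : ℕ → ℕ → ℝ} (hα : ∀ k l, φ (k + 1) l = φ k l + α k l)
    (hβ : ∀ k l, φ k (l + 1) = φ k l + β k l)
    (hγ : ∀ k l, φ (k + 1) (l + 1) = φ k l + (α k l + (β k l + γ k l))) (n : ℕ) :
    pairMean r (p - r) (p' - r) φ (n + 1) = pairMean r (p - r) (p' - r) φ n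
      + p * pairMean r (p - r) (p' - r) α n + p' * pairMean r (p - r) (p' - r) β n
      + r * pairMean r (p - r) (p' - r) γ n := by
  rw [pairMean_succ]
  have e1 : (fun k l => φ (k + 1) (l + 1)) = fun k l => φ k l + (α k l + (β k l + γ k l)) :=
    funext₂ hγ
  have e2 : (fun k l => φ (k + 1) l) = fun k l => φ k l + α k l := funext₂ hα
  have e3 : (fun k l => φ k (l + 1)) = fun k l => φ k l + β k l := funext₂ hβ
  rw [e1, e2, e3]
  simp only [pairMean_add]
  ring

theorem binomMean_id (p : ℝ) (n : ℕ) : binomMean p (fun k => (k : ℝ)) n = n * p := by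
  have h : (fun k : ℕ => (k : ℝ)) =
      fun k : ℕ => 1 / 2 * (((k : ℝ) + 1) ^ 2 - ((k : ℝ) + 0) ^ 2) - 1 / 2 := by funext k; ring
  rw [h, binomMean_sub, binomMean_const_mul, binomMean_sub, binomMean_add_sq, binomMean_add_sq,
    binomMean_const]
  ring

/-- The first of four mixed-moment bounds leading to k(k-1)l(l-1). Adding a trial changes each
moment by moments of lower degree, bounded before, so all are inductions on n. -/
theorem pairMean_mul_le (hr : 0 ≤ r) (hp : 0 ≤ p) (hp' : 0 ≤ p') (n : ℕ) :
    pairMean r (p - r) (p' - r) (fun k l => (k : ℝ) * l) n ≤ n ^ 2 * (r + p * p') := by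
  induction n with
  | zero => simp
  | succ n ih =>
    rw [pairMean_succ_of_diff (α := fun _ l => (l : ℝ)) (β := fun k _ => (k : ℝ))
      (γ := fun _ _ => 1) (fun k l => by push_cast; ring) (fun k l => by push_cast; ring)
      (fun k l => by push_cast; ring)]
    rw [pairMean_fst _ _ _ (fun k => (k : ℝ)), pairMean_snd _ _ _ (fun k => (k : ℝ)),
      pairMean_fst _ _ _ (fun _ => 1), binomMean_const, binomMean_id, binomMean_id]
    push_cast
    nlinarith [mul_nonneg (Nat.cast_nonneg (α := ℝ) n) hr, mul_nonneg hp hp']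

theorem pairMean_mul_choose_le (hr : 0 ≤ r) (hp : 0 ≤ p) (hp' : 0 ≤ p') (n : ℕ) :
    pairMean r (p - r) (p' - r) (fun k l => (k : ℝ) * (l * (l - 1))) n ≤
      2 * n ^ 3 * (p' * (r + p * p')) := by
  induction n with
  | zero => simp
  | succ n ih =>
    rw [pairMean_succ_of_diff (α := fun _ l => (l : ℝ) * (l - 1))
      (β := fun k l => 2 * ((k : ℝ) * l)) (γ := fun _ l => 2 * (l : ℝ))
      (fun k l => by push_cast; ring) (fun k l => by push_cast; ring)
      (fun k l => by push_cast; ring)]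
    rw [pairMean_snd _ _ _ (fun k => (k : ℝ) * (k - 1)), pairMean_snd _ _ _ (fun k => 2 * (k : ℝ)),
      pairMean_const_mul, binomMean_const_mul, binomMean_id, binomMean_mul_sub_one]
    have h1 := mul_le_mul_of_nonneg_left (pairMean_mul_le hr hp hp' n) hp'
    have hn : (0 : ℝ) ≤ n := Nat.cast_nonneg n
    have h2 : 0 ≤ p' * r := by positivity
    have h3 : 0 ≤ p' * (p * p') := by positivity
    have h4 : 0 ≤ n * (p' * r) := by positivity
    have h5 : 0 ≤ n * (p' * (p * p')) := by positivity
    have h6 : 0 ≤ (n : ℝ) ^ 2 * (p' * r) := by positivity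
    have h7 : 0 ≤ (n : ℝ) ^ 2 * (p' * (p * p')) := by positivity
    push_cast
    rw [add_sub_cancel]
    linarith

theorem pairMean_choose_mul_le (hr : 0 ≤ r) (hp : 0 ≤ p) (hp' : 0 ≤ p') (n : ℕ) :
    pairMean r (p - r) (p' - r) (fun k l => (k : ℝ) * (k - 1) * l) n ≤
      2 * n ^ 3 * (p * (r + p * p')) := by
  induction n with
  | zero => simp
  | succ n ih =>
    rw [pairMean_succ_of_diff (β := fun k _ => (k : ℝ) * (k - 1))
      (α := fun k l => 2 * ((k : ℝ) * l)) (γ := fun k _ => 2 * (k : ℝ))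
      (fun k l => by push_cast; ring) (fun k l => by push_cast; ring)
      (fun k l => by push_cast; ring)]
    rw [pairMean_fst _ _ _ (fun k => (k : ℝ) * (k - 1)), pairMean_fst _ _ _ (fun k => 2 * (k : ℝ)),
      pairMean_const_mul, binomMean_const_mul, binomMean_id, binomMean_mul_sub_one]
    have h1 := mul_le_mul_of_nonneg_left (pairMean_mul_le hr hp hp' n) hp
    have hn : (0 : ℝ) ≤ n := Nat.cast_nonneg n
    have h2 : 0 ≤ p * r := by positivity
    have h3 : 0 ≤ p * (p * p') := by positivity
    have h4 : 0 ≤ n * (p * r) := by positivity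
    have h5 : 0 ≤ n * (p * (p * p')) := by positivity
    have h6 : 0 ≤ (n : ℝ) ^ 2 * (p * r) := by positivity
    have h7 : 0 ≤ (n : ℝ) ^ 2 * (p * (p * p')) := by positivity
    push_cast
    rw [add_sub_cancel]
    linarith

theorem pairMean_choose_choose_le (hr : 0 ≤ r) (hp : 0 ≤ p) (hp' : 0 ≤ p') (n : ℕ) :
    pairMean r (p - r) (p' - r) (fun k l => (k : ℝ) * (k - 1) * (l * (l - 1))) n ≤
      4 * n ^ 4 * (r + p * p') ^ 2 := by
  induction n with
  | zero => simp
  | succ n ih =>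
    rw [pairMean_succ_of_diff (α := fun k l => 2 * ((k : ℝ) * (l * (l - 1))))
      (β := fun k l => 2 * ((k : ℝ) * (k - 1) * l)) (γ := fun k l => 4 * ((k : ℝ) * l))
      (fun k l => by push_cast; ring) (fun k l => by push_cast; ring)
      (fun k l => by push_cast; ring), pairMean_const_mul, pairMean_const_mul, pairMean_const_mul]
    have h1 := mul_le_mul_of_nonneg_left (pairMean_mul_le hr hp hp' n) hr
    have h2 := mul_le_mul_of_nonneg_left (pairMean_mul_choose_le hr hp hp' n) hp
    have h3 := mul_le_mul_of_nonneg_left (pairMean_choose_mul_le hr hp hp' n) hp'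
    have hn : (0 : ℝ) ≤ n := Nat.cast_nonneg n
    have hq : 0 ≤ p * p' := by positivity
    have h4 : (r + p * p') * (p * p') ≤ (r + p * p') ^ 2 := by nlinarith
    have h5 : (r + p * p') * r ≤ (r + p * p') ^ 2 := by nlinarith
    have h6 := mul_le_mul_of_nonneg_left h4 (by positivity : 0 ≤ 8 * (n : ℝ) ^ 3)
    have h7 := mul_le_mul_of_nonneg_left h5 (by positivity : 0 ≤ 4 * (n : ℝ) ^ 2)
    have h8 : 0 ≤ (8 * (n : ℝ) ^ 3 + 20 * n ^ 2 + 16 * n + 4) * (r + p * p') ^ 2 := by positivity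
    push_cast
    linarith

theorem atLeastTwo_le_mul_sub_one (k : ℕ) : atLeastTwo k ≤ (k : ℝ) * (k - 1) := by
  unfold atLeastTwo
  split_ifs with h
  · have : (2 : ℝ) ≤ k := by exact_mod_cast h
    nlinarith
  · interval_cases k <;> simp

/-- The probability of at least two occurrences of each of two labeled paths is small. -/
theorem pairMean_atLeastTwo_le (hr : 0 ≤ r) (hp : r ≤ p) (hp' : r ≤ p') (h1 : p + p' - r ≤ 1)
    (n : ℕ) : pairMean r (p - r) (p' - r) (fun k l => atLeastTwo k * atLeastTwo l) n ≤
      8 * n ^ 4 * (r ^ 2 + p ^ 2 * p' ^ 2) := by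
  refine (pairMean_le hr (sub_nonneg.2 hp) (sub_nonneg.2 hp') (by linarith)
    (ψ := fun k l => (k : ℝ) * (k - 1) * (l * (l - 1))) (fun k l => ?_) n).trans ?_
  · exact mul_le_mul (atLeastTwo_le_mul_sub_one k) (atLeastTwo_le_mul_sub_one l)
      (atLeastTwo_nonneg l) ((atLeastTwo_nonneg k).trans (atLeastTwo_le_mul_sub_one k))
  · refine (pairMean_choose_choose_le hr (hr.trans hp) (hr.trans hp') n).trans ?_
    have h2 : (r + p * p') ^ 2 ≤ 2 * (r ^ 2 + p ^ 2 * p' ^ 2) := by nlinarith [sq_nonneg (r - p * p')]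
    have h3 := mul_le_mul_of_nonneg_left h2 (by positivity : 0 ≤ 4 * (n : ℝ) ^ 4)
    linarith

end PairMeans

/-! ### Summability over pairs of words -/

section Joint

variable {M A : ℕ} {p : Fin A → ℝ} {ρ a : ℝ}

/-- The common prefix of two words and their remainders. -/
def split : List (Fin M × Fin A) → List (Fin M × Fin A) →
    List (Fin M × Fin A) × List (Fin M × Fin A) × List (Fin M × Fin A)
  | [], w' => ([], [], w')
  | x :: w, [] => ([], x :: w, [])
  | x :: w, y :: w' => if x = y then (x :: (split w w').1, (split w w').2) else
      ([], x :: w, y :: w')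

theorem split_append (w w' : List (Fin M × Fin A)) :
    (split w w').1 ++ (split w w').2.1 = w ∧ (split w w').1 ++ (split w w').2.2 = w' := by
  induction w generalizing w' with
  | nil => simp [split]
  | cons x w ih =>
    rcases w' with _ | ⟨y, w'⟩
    · simp [split]
    · rw [split]
      split_ifs with h
      · subst h; simp [ih w']
      · simp

/-- Sums over pairs of words can therefore be dominated by sums over triples. -/
theorem injective_split : Function.Injective fun z : List (Fin M × Fin A) × List (Fin M × Fin A) =>
    split z.1 z.2 := by
  rintro ⟨w, w'⟩ ⟨v, v'⟩ h
  simp only at h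
  have h1 := split_append w w'
  have h2 := split_append v v'
  rw [h, h2.1, h2.2] at h1
  rw [h1.1, h1.2]

namespace IsSetting

variable (h : IsSetting M p ρ a)

include h

theorem joint_nonneg (w w' : List (Fin M × Fin A)) : 0 ≤ joint (letterP M p) w w' := by
  induction w generalizing w' with
  | nil => exact (h.wt_pos _).le
  | cons x w ih =>
    rcases w' with _ | ⟨y, w'⟩
    · exact (h.wt_pos _).le
    · rw [joint]
      split_ifs
      · exact mul_nonneg (h.letterP_pos x).le (ih w')
      · exact le_rfl
      · exact mul_nonneg (h.wt_pos _).le (h.wt_pos _).le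

/-- The common prefix is paid for only once; after it the two paths are independent or incompatible.
-/
theorem joint_le_split (w w' : List (Fin M × Fin A)) : joint (letterP M p) w w' ≤
    wt (letterP M p) (split w w').1 *
      (wt (letterP M p) (split w w').2.1 * wt (letterP M p) (split w w').2.2) := by
  induction w generalizing w' with
  | nil => simp [joint, split]
  | cons x w ih =>
    rcases w' with _ | ⟨y, w'⟩
    · simp [joint, split]
    · rw [joint, split]
      split_ifs with h1 h2
      · rw [wt_cons, mul_assoc]
        exact mul_le_mul_of_nonneg_left (ih w') (h.letterP_pos x).le
      · simpa using mul_nonneg (h.wt_pos (x :: w)).le (h.wt_pos (y :: w')).le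
      · simp

theorem joint_le_left (w w' : List (Fin M × Fin A)) :
    joint (letterP M p) w w' ≤ wt (letterP M p) w := by
  induction w generalizing w' with
  | nil => simpa [joint] using h.wt_le_one w'
  | cons x w ih =>
    rcases w' with _ | ⟨y, w'⟩
    · simp [joint]
    · rw [joint]
      split_ifs with h1 h2
      · rw [wt_cons]
        exact mul_le_mul_of_nonneg_left (ih w') (h.letterP_pos x).le
      · exact (h.wt_pos _).le
      · exact mul_le_of_le_one_right (h.wt_pos _).le (h.wt_le_one _)

theorem joint_le_right (w w' : List (Fin M × Fin A)) :
    joint (letterP M p) w w' ≤ wt (letterP M p) w' := by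
  induction w generalizing w' with
  | nil => simp [joint]
  | cons x w ih =>
    rcases w' with _ | ⟨y, w'⟩
    · simpa [joint] using h.wt_le_one (x :: w)
    · rw [joint]
      split_ifs with h1 h2
      · rw [← h1, wt_cons]
        exact mul_le_mul_of_nonneg_left (ih w') (h.letterP_pos x).le
      · exact (h.wt_pos _).le
      · exact mul_le_of_le_one_left (h.wt_pos _).le (h.wt_le_one _)

/-- The left side is the probability that at least one of the paths occurs. The bound makes the
fourth mass in `pairMean` nonnegative. -/
theorem wt_add_wt_sub_joint_le (w w' : List (Fin M × Fin A)) :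
    wt (letterP M p) w + wt (letterP M p) w' - joint (letterP M p) w w' ≤ 1 := by
  induction w generalizing w' with
  | nil => simp [joint]
  | cons x w ih =>
    rcases w' with _ | ⟨y, w'⟩
    · simp [joint]
    · rw [joint]
      split_ifs with h1 h2
      · subst h1
        rw [wt_cons, wt_cons]
        nlinarith [ih w', h.letterP_pos x, h.letterP_lt_one x]
      · have h3 : x.2 ≠ y.2 := fun h3 => h1 (Prod.ext h2 h3)
        have h4 : p x.2 + p y.2 ≤ 1 := by
          rw [← h.hsum, ← Finset.sum_pair h3]
          exact Finset.sum_le_sum_of_subset_of_nonneg (Finset.subset_univ _)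
            fun j _ _ => (h.hp j).1.le
        have h5 : wt (letterP M p) (x :: w) ≤ p x.2 := by
          rw [wt_cons]
          exact mul_le_of_le_one_right (h.letterP_pos x).le (h.wt_le_one w)
        have h6 : wt (letterP M p) (y :: w') ≤ p y.2 := by
          rw [wt_cons]
          exact mul_le_of_le_one_right (h.letterP_pos y).le (h.wt_le_one w')
        linarith
      · nlinarith [h.wt_le_one (x :: w), h.wt_le_one (y :: w')]

theorem summable_joint_sq :
    Summable fun z : List (Fin M × Fin A) × List (Fin M × Fin A) =>
      joint (letterP M p) z.1 z.2 ^ 2 := by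
  have h1 := h.summable_wt_sq
  have h2 := h1.mul_of_nonneg (h1.mul_of_nonneg h1 (fun _ => sq_nonneg _) fun _ => sq_nonneg _)
    (fun _ => sq_nonneg _) fun z => mul_nonneg (sq_nonneg _) (sq_nonneg _)
  refine Summable.of_nonneg_of_le (fun z => sq_nonneg _) (fun z => ?_)
    (h2.comp_injective injective_split)
  have h3 := pow_le_pow_left₀ (h.joint_nonneg z.1 z.2) (h.joint_le_split z.1 z.2) 2
  rwa [mul_pow, mul_pow] at h3

/-- The probabilities that two labeled paths both belong to the G-trie are summable. -/
theorem summable_pairMean (n : ℕ) :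
    Summable fun z : List (Fin M × Fin A) × List (Fin M × Fin A) =>
      pairMean (joint (letterP M p) z.1 z.2)
        (wt (letterP M p) z.1 - joint (letterP M p) z.1 z.2)
        (wt (letterP M p) z.2 - joint (letterP M p) z.1 z.2)
        (fun k l => atLeastTwo k * atLeastTwo l) n := by
  have h1 := h.summable_wt_sq
  have h2 := (h.summable_joint_sq.add
    (h1.mul_of_nonneg h1 (fun _ => sq_nonneg _) fun _ => sq_nonneg _)).mul_left (8 * (n : ℝ) ^ 4)
  refine Summable.of_nonneg_of_le (fun z => ?_) (fun z => ?_) h2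
  · have := h.wt_add_wt_sub_joint_le z.1 z.2
    exact pairMean_nonneg (h.joint_nonneg _ _) (sub_nonneg.2 (h.joint_le_left _ _))
      (sub_nonneg.2 (h.joint_le_right _ _)) (by linarith)
      (fun k l => mul_nonneg (atLeastTwo_nonneg k) (atLeastTwo_nonneg l)) n
  · exact pairMean_atLeastTwo_le (h.joint_nonneg _ _) (h.joint_le_left _ _)
      (h.joint_le_right _ _) (h.wt_add_wt_sub_joint_le _ _) n

end IsSetting

end Joint

end GTrie

end

noncomputable section

namespace GTrie

open Topology

/-! ### Mean, second moment and variance of the size -/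

section Moments

open scoped ENNReal

variable {M A : ℕ} {p : Fin A → ℝ} {ρ a : ℝ}

/-- The mean size of the G-trie built from `n` random labelings. -/
def meanSize (M : ℕ) {A : ℕ} (p : Fin A → ℝ) (n : ℕ) : ℝ :=
  ∑' w, binomMean (wt (letterP M p) w) atLeastTwo n

/-- The covariance of the indicators of two labeled paths in the G-trie. -/
def pairCov (M : ℕ) {A : ℕ} (p : Fin A → ℝ) (n : ℕ) (w w' : List (Fin M × Fin A)) : ℝ :=
  pairMean (joint (letterP M p) w w') (wt (letterP M p) w - joint (letterP M p) w w')
    (wt (letterP M p) w' - joint (letterP M p) w w') (fun k l => atLeastTwo k * atLeastTwo l) n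
    - binomMean (wt (letterP M p) w) atLeastTwo n * binomMean (wt (letterP M p) w') atLeastTwo n

theorem IsSetting.summable_meanSize (h : IsSetting M p ρ a) (n : ℕ) :
    Summable fun w => binomMean (wt (letterP M p) w) atLeastTwo n :=
  h.summable_binomMean atLeastTwo_zero atLeastTwo_one n

theorem IsSetting.binomMean_atLeastTwo_nonneg (h : IsSetting M p ρ a) (w : List (Fin M × Fin A))
    (n : ℕ) : 0 ≤ binomMean (wt (letterP M p) w) atLeastTwo n :=
  binomMean_nonneg (h.wt_pos w).le (h.wt_le_one w) fun k _ => atLeastTwo_nonneg k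

theorem IsSetting.summable_prod (h : IsSetting M p ρ a) (n m : ℕ) :
    Summable fun z : List (Fin M × Fin A) × List (Fin M × Fin A) =>
      binomMean (wt (letterP M p) z.1) atLeastTwo n *
        binomMean (wt (letterP M p) z.2) atLeastTwo m :=
  (h.summable_meanSize n).mul_of_nonneg (h.summable_meanSize m)
    (fun w => h.binomMean_atLeastTwo_nonneg w n) fun w => h.binomMean_atLeastTwo_nonneg w m

theorem IsSetting.summable_pairCov (h : IsSetting M p ρ a) (n : ℕ) :
    Summable fun z : List (Fin M × Fin A) × List (Fin M × Fin A) => pairCov M p n z.1 z.2 :=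
  (h.summable_pairMean n).sub (h.summable_prod n n)

variable {Ω : Type*} {L : ℕ → Edge M → Ω → Fin A}

theorem mem_randomNodes_iff (n : ℕ) (ω : Ω) (w : List (Fin M × Fin A)) :
    w ∈ randomNodes L n ω ↔ 2 ≤ cnt n w fun x => L x.1 x.2 ω := by
  classical
  have h1 : (cnt n w fun x => L x.1 x.2 ω) =
      ((Finset.range n).filter fun k => Occurs (fun e => L k e ω) w).card := by
    rw [Finset.card_filter]
    unfold cnt
    exact Finset.sum_congr rfl fun k _ => by congr
  rw [h1, Nat.succ_le_iff, Finset.one_lt_card]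
  constructor
  · rintro ⟨k, k', hk, h2, h3⟩
    exact ⟨k, by simpa using h2, k', by simpa using h3, fun h4 => hk (Fin.ext h4)⟩
  · rintro ⟨k, hk, l, hl, hne⟩
    simp only [Finset.mem_filter, Finset.mem_range] at hk hl
    exact ⟨⟨k, hk.1⟩, ⟨l, hl.1⟩, fun h4 => hne (congrArg Fin.val h4), hk.2, hl.2⟩

/-- The size of the G-trie as an extended nonnegative number. -/
def esize (L : ℕ → Edge M → Ω → Fin A) (n : ℕ) (ω : Ω) : ℝ≥0∞ :=
  ∑' w, Set.indicator {ω | 2 ≤ cnt n w fun x => L x.1 x.2 ω} 1 ω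

theorem esize_eq (n : ℕ) (ω : Ω) : esize L n ω = ((randomNodes L n ω).encard : ℝ≥0∞) := by
  classical
  rw [← ENNReal.tsum_set_one, tsum_subtype (randomNodes L n ω) fun _ => (1 : ℝ≥0∞), esize]
  congr 1
  funext w
  simp only [Set.indicator_apply, mem_randomNodes_iff, Set.mem_ofPred_eq, Pi.one_apply]

theorem size_eq_toReal (n : ℕ) (ω : Ω) : size L n ω = (esize L n ω).toReal := by
  rw [esize_eq, size]
  rcases (randomNodes L n ω).finite_or_infinite with hf | hf
  · rw [← hf.cast_ncard_eq]
    simp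
  · simp [hf.ncard, hf.encard_eq]

theorem finite_of_esize_ne_top {n : ℕ} {ω : Ω} (h : esize L n ω ≠ ⊤) :
    (randomNodes L n ω).Finite := by
  rw [esize_eq] at h
  by_contra hf
  rw [← Set.Infinite, ← Set.encard_eq_top_iff] at hf
  exact h (by simp [hf])

variable [MeasurableSpace Ω] {μ : Measure Ω} [IsProbabilityMeasure μ]

namespace IsRandomLabelings

variable (hL : IsRandomLabelings μ p L)

include hL

theorem measurableSet_two_le_cnt (n : ℕ) (w : List (Fin M × Fin A)) :
    MeasurableSet {ω | 2 ≤ cnt n w fun x => L x.1 x.2 ω} := by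
  refine measurableSet_of_dependsOn (X := fun x : ℕ × Edge M => L x.1 x.2) μ
    (fun x => hL.measurable _ _) (E := fun l => 2 ≤ cnt n w l)
    (S := Finset.range n ×ˢ edges w) (dependsOn_labelings fun l l' h => ?_)
  rw [cnt_congr fun k hk e he => h k (by simpa using hk) e he]

theorem measurable_indicator_cnt (n : ℕ) (w : List (Fin M × Fin A)) :
    Measurable (Set.indicator {ω | 2 ≤ cnt n w fun x => L x.1 x.2 ω} (1 : Ω → ℝ≥0∞)) :=
  measurable_one.indicator (hL.measurableSet_two_le_cnt n w)

theorem measurable_esize (n : ℕ) : Measurable (esize L n) :=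
  Measurable.tsum fun w => hL.measurable_indicator_cnt n w

theorem measureReal_two_le_cnt (n : ℕ) (w : List (Fin M × Fin A)) :
    μ.real {ω | 2 ≤ cnt n w fun x => L x.1 x.2 ω} =
      binomMean (wt (letterP M p) w) atLeastTwo n := by
  classical
  have h1 := hL.pair_law w w n fun k _ => 2 ≤ k
  rw [h1]
  convert! pairMean_fst (joint (letterP M p) w w) (wt (letterP M p) w - joint (letterP M p) w w)
    (wt (letterP M p) w - joint (letterP M p) w w) atLeastTwo n using 2
  · funext k l
    by_cases hk : 2 ≤ k <;> simp [atLeastTwo, hk]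
  · ring

theorem measureReal_two_le_cnt_and (n : ℕ) (w w' : List (Fin M × Fin A)) :
    μ.real ({ω | 2 ≤ cnt n w fun x => L x.1 x.2 ω} ∩ {ω | 2 ≤ cnt n w' fun x => L x.1 x.2 ω}) =
      pairMean (joint (letterP M p) w w') (wt (letterP M p) w - joint (letterP M p) w w')
        (wt (letterP M p) w' - joint (letterP M p) w w')
        (fun k l => atLeastTwo k * atLeastTwo l) n := by
  classical
  have h1 := hL.pair_law w w' n fun k l => 2 ≤ k ∧ 2 ≤ l
  refine Eq.trans h1 ?_
  congr 1
  funext k l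
  by_cases hk : 2 ≤ k <;> by_cases hl : 2 ≤ l <;> simp [atLeastTwo, hk, hl]

theorem lintegral_esize (h : IsSetting M p ρ a) (n : ℕ) :
    ∫⁻ ω, esize L n ω ∂μ = ENNReal.ofReal (meanSize M p n) := by
  unfold esize
  rw [lintegral_tsum fun w => (hL.measurable_indicator_cnt n w).aemeasurable, meanSize,
    ENNReal.ofReal_tsum_of_nonneg (fun w => h.binomMean_atLeastTwo_nonneg w n)
      (h.summable_meanSize n)]
  congr 1
  funext w
  rw [lintegral_indicator_one (hL.measurableSet_two_le_cnt n w), ← hL.measureReal_two_le_cnt,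
    ofReal_measureReal]

/-- The square of a sum of indicators is the sum over pairs of indicators of intersections. Working
with extended nonnegative values, Tonelli applies before finiteness is known. -/
theorem lintegral_esize_sq (h : IsSetting M p ρ a) (n : ℕ) :
    ∫⁻ ω, esize L n ω ^ 2 ∂μ = ENNReal.ofReal
      (∑' z : List (Fin M × Fin A) × List (Fin M × Fin A), (pairCov M p n z.1 z.2 +
        binomMean (wt (letterP M p) z.1) atLeastTwo n *
        binomMean (wt (letterP M p) z.2) atLeastTwo n)) := by
  have h1 : ∀ ω, esize L n ω ^ 2 = ∑' z : List (Fin M × Fin A) × List (Fin M × Fin A),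
      Set.indicator ({ω | 2 ≤ cnt n z.1 fun x => L x.1 x.2 ω} ∩
        {ω | 2 ≤ cnt n z.2 fun x => L x.1 x.2 ω}) (1 : Ω → ℝ≥0∞) ω := by
    intro ω
    rw [ENNReal.tsum_prod', sq]
    conv_lhs => rw [esize, ← ENNReal.tsum_mul_right]
    congr 1
    funext w
    rw [← ENNReal.tsum_mul_left]
    congr 1
    funext w'
    rw [Set.inter_indicator_one, Pi.mul_apply]
  have h2 : ∀ z : List (Fin M × Fin A) × List (Fin M × Fin A), AEMeasurable
      (Set.indicator ({ω | 2 ≤ cnt n z.1 fun x => L x.1 x.2 ω} ∩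
        {ω | 2 ≤ cnt n z.2 fun x => L x.1 x.2 ω}) (1 : Ω → ℝ≥0∞)) μ := fun z =>
    (measurable_one.indicator ((hL.measurableSet_two_le_cnt n z.1).inter
      (hL.measurableSet_two_le_cnt n z.2))).aemeasurable
  simp only [pairCov, sub_add_cancel]
  rw [lintegral_congr h1, lintegral_tsum h2]
  rw [ENNReal.ofReal_tsum_of_nonneg _ (h.summable_pairMean n)]
  · congr 1
    funext z
    rw [lintegral_indicator_one ((hL.measurableSet_two_le_cnt n z.1).inter
      (hL.measurableSet_two_le_cnt n z.2)), ← hL.measureReal_two_le_cnt_and, ofReal_measureReal]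
  · intro z
    rw [← hL.measureReal_two_le_cnt_and]
    exact measureReal_nonneg

theorem ae_esize_lt_top (h : IsSetting M p ρ a) (n : ℕ) : ∀ᵐ ω ∂μ, esize L n ω < ⊤ :=
  ae_lt_top (hL.measurable_esize n) (by rw [hL.lintegral_esize h]; exact ENNReal.ofReal_ne_top)

theorem ae_finite (h : IsSetting M p ρ a) (n : ℕ) : ∀ᵐ ω ∂μ, (randomNodes L n ω).Finite :=
  (hL.ae_esize_lt_top h n).mono fun _ hω => finite_of_esize_ne_top hω.ne

theorem integral_size (h : IsSetting M p ρ a) (n : ℕ) :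
    ∫ ω, size L n ω ∂μ = meanSize M p n := by
  simp only [size_eq_toReal]
  rw [integral_toReal (hL.measurable_esize n).aemeasurable (hL.ae_esize_lt_top h n),
    hL.lintegral_esize h, ENNReal.toReal_ofReal]
  exact tsum_nonneg fun w => h.binomMean_atLeastTwo_nonneg w n

theorem memLp_size (h : IsSetting M p ρ a) (n : ℕ) : MemLp (size L n) 2 μ := by
  have h0 : size L n = fun ω => (esize L n ω).toReal := funext fun ω => size_eq_toReal n ω
  have h1 : AEStronglyMeasurable (size L n) μ := by
    rw [h0]
    exact (hL.measurable_esize n).ennreal_toReal.aestronglyMeasurable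
  rw [memLp_two_iff_integrable_sq h1]
  have h2 : (fun ω => size L n ω ^ 2) = fun ω => (esize L n ω ^ 2).toReal := by
    funext ω
    rw [size_eq_toReal, ENNReal.toReal_pow]
  rw [h2]
  refine integrable_toReal_of_lintegral_ne_top ((hL.measurable_esize n).pow_const 2).aemeasurable ?_
  rw [hL.lintegral_esize_sq h]
  exact ENNReal.ofReal_ne_top

theorem variance_size (h : IsSetting M p ρ a) (n : ℕ) : variance (size L n) μ =
    ∑' z : List (Fin M × Fin A) × List (Fin M × Fin A), pairCov M p n z.1 z.2 := by
  have h2 : ∀ ω, (size L n ^ 2) ω = (esize L n ω ^ 2).toReal := by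
    intro ω
    rw [Pi.pow_apply, size_eq_toReal, ENNReal.toReal_pow]
  rw [variance_eq_sub (hL.memLp_size h n), hL.integral_size h]
  simp only [h2]
  rw [integral_toReal ((hL.measurable_esize n).pow_const 2).aemeasurable
    ((hL.ae_esize_lt_top h n).mono fun ω hω => ENNReal.pow_lt_top hω), hL.lintegral_esize_sq h,
    ENNReal.toReal_ofReal, (h.summable_pairCov n).tsum_add (h.summable_prod n n),
    ← (h.summable_meanSize n).tsum_mul_tsum (h.summable_meanSize n) (h.summable_prod n n), meanSize]
  · ring
  · refine tsum_nonneg fun z => ?_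
    rw [pairCov, sub_add_cancel, ← hL.measureReal_two_le_cnt_and]
    exact measureReal_nonneg

end IsRandomLabelings

end Moments

end GTrie

end

/-! ### The recursion for the variance -/

noncomputable section

namespace GTrie

open Topology

theorem tsum_list_pair {ι : Type*} [Fintype ι] {F : List ι → List ι → ℝ}
    (hF : Summable fun z : List ι × List ι => F z.1 z.2) (h1 : ∀ w', F [] w' = 0)
    (h2 : ∀ w, F w [] = 0) : ∑' z : List ι × List ι, F z.1 z.2 =
      ∑ x, ∑ y, ∑' z : List ι × List ι, F (x :: z.1) (y :: z.2) := by
  have hin : ∀ x y, Summable fun z : List ι × List ι => F (x :: z.1) (y :: z.2) := fun x y =>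
    hF.comp_injective (i := fun z : List ι × List ι => (x :: z.1, y :: z.2)) fun z z' h => by
      simpa [Prod.ext_iff] using h
  rw [hF.tsum_prod, tsum_list hF.prod]
  simp only [h1, tsum_zero, zero_add]
  refine Finset.sum_congr rfl fun x _ => ?_
  have h3 : ∀ w, ∑' w', F (x :: w) w' = ∑ y, ∑' w', F (x :: w) (y :: w') := by
    intro w
    rw [tsum_list (hF.prod_factor (x :: w)), h2, zero_add]
  simp only [h3]
  rw [Summable.tsum_finsetSum fun y _ => (hin x y).prod]
  exact Finset.sum_congr rfl fun y _ => ((hin x y).tsum_prod).symm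

variable {M A : ℕ} {p : Fin A → ℝ} {ρ a : ℝ}

/-- The variance of the size of the G-trie built from `n` random labelings. -/
def varSize (M : ℕ) {A : ℕ} (p : Fin A → ℝ) (n : ℕ) : ℝ :=
  ∑' z : List (Fin M × Fin A) × List (Fin M × Fin A), pairCov M p n z.1 z.2

/-- The toll function of the recursion for `varSize`. -/
def varToll (M : ℕ) {A : ℕ} (p : Fin A → ℝ) (n : ℕ) : ℝ :=
  M * multVar p (fun x => ∑ j, meanSize M p (x j)) n

theorem multVar_sum_eq (hsum : ∑ j, p j = 1) (E : ℕ → ℝ) (n : ℕ) :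
    multVar p (fun x => ∑ j, E (x j)) n = ∑ j, ∑ j',
      ((if j = j' then binomMean (p j) (fun k => E k ^ 2) n else
        pairMean 0 (p j) (p j') (fun k l => E k * E l) n)
        - binomMean (p j) E n * binomMean (p j') E n) := by
  rw [multVar]
  simp only [Finset.sum_sub_distrib, ← Finset.mul_sum, ← Finset.sum_mul, multMean_sum,
    multMean_apply hsum]
  rw [← sq]
  congr 1
  have h1 : (fun x : Fin A → ℕ => (∑ j, E (x j)) ^ 2) =
      fun x => ∑ j, ∑ j', E (x j) * E (x j') := by
    funext x
    rw [sq, Finset.sum_mul_sum]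
  rw [h1]
  simp only [multMean_sum]
  refine Finset.sum_congr rfl fun j _ => Finset.sum_congr rfl fun j' _ => ?_
  split_ifs with h
  · subst h
    rw [← multMean_apply hsum j fun k => E k ^ 2]
    simp only [sq]
  · exact multMean_apply₂ hsum h (fun k l => E k * E l) n

theorem pairCov_of_joint_eq {n : ℕ} {w w' : List (Fin M × Fin A)}
    (h : joint (letterP M p) w w' = wt (letterP M p) w * wt (letterP M p) w') :
    pairCov M p n w w' = 0 := by
  rw [pairCov, h, pairMean_indep, sub_self]

theorem pairCov_nil_left (n : ℕ) (w : List (Fin M × Fin A)) : pairCov M p n [] w = 0 :=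
  pairCov_of_joint_eq (by simp [joint])

theorem pairCov_nil_right (n : ℕ) (w : List (Fin M × Fin A)) : pairCov M p n w [] = 0 :=
  pairCov_of_joint_eq (by cases w <;> simp [joint])

/-- Both paths only see the labelings whose first letter is x: conditionally on that binomial number
k, the product mean is that of the two tails for k labelings. -/
theorem pairCov_cons_self (n : ℕ) (x : Fin M × Fin A) (w w' : List (Fin M × Fin A)) :
    pairCov M p n (x :: w) (x :: w') =
      binomMean (letterP M p x) (fun k => pairCov M p k w w' +
        binomMean (wt (letterP M p) w) atLeastTwo k *
          binomMean (wt (letterP M p) w') atLeastTwo k) n -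
      binomMean (letterP M p x) (binomMean (wt (letterP M p) w) atLeastTwo) n *
      binomMean (letterP M p x) (binomMean (wt (letterP M p) w') atLeastTwo) n := by
  rw [pairCov, joint, if_pos rfl, wt_cons, wt_cons, ← mul_sub, ← mul_sub, pairMean_thin,
    binomMean_binomMean, binomMean_binomMean]
  simp only [pairCov, sub_add_cancel]

theorem pairCov_cons_of_ne (n : ℕ) {x y : Fin M × Fin A} (h1 : x.1 = y.1) (h2 : x.2 ≠ y.2)
    (w w' : List (Fin M × Fin A)) :
    pairCov M p n (x :: w) (y :: w') =
      pairMean 0 (letterP M p x) (letterP M p y) (fun k l =>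
        binomMean (wt (letterP M p) w) atLeastTwo k *
          binomMean (wt (letterP M p) w') atLeastTwo l) n -
      binomMean (letterP M p x) (binomMean (wt (letterP M p) w) atLeastTwo) n *
      binomMean (letterP M p y) (binomMean (wt (letterP M p) w') atLeastTwo) n := by
  have h3 : x ≠ y := fun h => h2 (congrArg Prod.snd h)
  rw [pairCov, joint, if_neg h3, if_pos h1, wt_cons, wt_cons, sub_zero, sub_zero, pairMean_excl,
    binomMean_binomMean, binomMean_binomMean]

theorem pairCov_cons_of_fst_ne (n : ℕ) {x y : Fin M × Fin A} (h1 : x.1 ≠ y.1)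
    (w w' : List (Fin M × Fin A)) : pairCov M p n (x :: w) (y :: w') = 0 := by
  have h3 : x ≠ y := fun h => h1 (congrArg Prod.fst h)
  exact pairCov_of_joint_eq (by rw [joint, if_neg h3, if_neg h1])

namespace IsSetting

variable (h : IsSetting M p ρ a)

include h

theorem hasSum_meanSize (n : ℕ) :
    HasSum (fun w => binomMean (wt (letterP M p) w) atLeastTwo n) (meanSize M p n) :=
  (h.summable_meanSize n).hasSum

theorem hasSum_varSize (n : ℕ) :
    HasSum (fun z : List (Fin M × Fin A) × List (Fin M × Fin A) => pairCov M p n z.1 z.2)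
      (varSize M p n) :=
  (h.summable_pairCov n).hasSum

theorem hasSum_prod (n m : ℕ) :
    HasSum (fun z : List (Fin M × Fin A) × List (Fin M × Fin A) =>
      binomMean (wt (letterP M p) z.1) atLeastTwo n *
        binomMean (wt (letterP M p) z.2) atLeastTwo m) (meanSize M p n * meanSize M p m) :=
  (h.hasSum_meanSize n).mul (h.hasSum_meanSize m) (h.summable_prod n m)

theorem hasSum_binomMean_prod (x y : Fin M × Fin A) (n : ℕ) :
    HasSum (fun z : List (Fin M × Fin A) × List (Fin M × Fin A) =>
      binomMean (letterP M p x) (binomMean (wt (letterP M p) z.1) atLeastTwo) n *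
        binomMean (letterP M p y) (binomMean (wt (letterP M p) z.2) atLeastTwo) n)
      (binomMean (letterP M p x) (meanSize M p) n *
        binomMean (letterP M p y) (meanSize M p) n) := by
  have h1 : ∀ x, HasSum (fun w => binomMean (letterP M p x)
      (binomMean (wt (letterP M p) w) atLeastTwo) n)
      (binomMean (letterP M p x) (meanSize M p) n) := fun x =>
    hasSum_binomMean _ h.hasSum_meanSize n
  have h0 : ∀ x w, 0 ≤ binomMean (letterP M p x)
      (binomMean (wt (letterP M p) w) atLeastTwo) n := fun x w =>
    binomMean_nonneg (h.letterP_pos x).le (h.letterP_lt_one x).le fun k _ =>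
      h.binomMean_atLeastTwo_nonneg w k
  exact (h1 x).mul (h1 y) ((h1 x).summable.mul_of_nonneg (h1 y).summable (h0 x) (h0 y))

/-- Equal first letters give the mean of the variance after thinning. Equal directions also
contribute the covariance of the conditional means in two letter classes; different directions are
independent. -/
theorem tsum_pairCov_cons (x y : Fin M × Fin A) (n : ℕ) :
    ∑' z : List (Fin M × Fin A) × List (Fin M × Fin A), pairCov M p n (x :: z.1) (y :: z.2) =
      (if x = y then binomMean (letterP M p x) (varSize M p) n else 0) +
      if x.1 = y.1 then
        (if x.2 = y.2 then binomMean (p x.2) (fun k => meanSize M p k ^ 2) n else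
          pairMean 0 (p x.2) (p y.2) (fun k l => meanSize M p k * meanSize M p l) n)
          - binomMean (p x.2) (meanSize M p) n * binomMean (p y.2) (meanSize M p) n
      else 0 := by
  by_cases h1 : x.1 = y.1
  · by_cases h2 : x.2 = y.2
    · obtain rfl : x = y := Prod.ext h1 h2
      rw [if_pos rfl, if_pos rfl, if_pos rfl, ← add_sub_assoc,
        show binomMean (p x.2) (fun k => meanSize M p k ^ 2) n =
          binomMean (letterP M p x) (fun k => meanSize M p k ^ 2) n from rfl, ← binomMean_add]
      simp only [pairCov_cons_self]
      refine ((hasSum_binomMean _ (fun k => (h.hasSum_varSize k).add ?_) n).sub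
        (h.hasSum_binomMean_prod x x n)).tsum_eq
      rw [sq]
      exact h.hasSum_prod k k
    · have h3 : x ≠ y := fun h => h2 (congrArg Prod.snd h)
      rw [if_neg h3, if_pos h1, if_neg h2, zero_add]
      simp only [pairCov_cons_of_ne n h1 h2]
      exact ((hasSum_pairMean _ _ _ (fun k l => h.hasSum_prod k l) n).sub
        (h.hasSum_binomMean_prod x y n)).tsum_eq
  · have h3 : x ≠ y := fun h => h1 (congrArg Prod.fst h)
    simp [pairCov_cons_of_fst_ne n h1, h1, h3]

/-- The recursion for the variance. -/
theorem varSize_eq (n : ℕ) : varSize M p n =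
    varToll M p n + ∑ x, binomMean (letterP M p x) (varSize M p) n := by
  rw [varSize, tsum_list_pair (h.summable_pairCov n) (pairCov_nil_left n) (pairCov_nil_right n)]
  simp only [h.tsum_pairCov_cons, Finset.sum_add_distrib, Finset.sum_ite_eq, Finset.mem_univ,
    if_true]
  rw [add_comm, varToll, multVar_sum_eq h.hsum]
  congr 1
  simp only [Fintype.sum_prod_type]
  rw [show (M : ℝ) = ∑ i : Fin M, (1 : ℝ) by simp, Finset.sum_mul]
  refine Finset.sum_congr rfl fun i _ => ?_
  rw [one_mul]
  refine Finset.sum_congr rfl fun j _ => ?_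
  rw [Finset.sum_eq_single i]
  · simp
  · intro b _ hb
    simp [hb.symm]
  · simp

omit h in
theorem meanSize_zero : meanSize M p 0 = 0 := by simp [meanSize]

omit h in
theorem meanSize_one : meanSize M p 1 = 0 := by simp [meanSize, binomMean_succ]

omit h in
theorem varSize_zero : varSize M p 0 = 0 := by simp [varSize, pairCov]

omit h in
theorem varSize_one : varSize M p 1 = 0 := by
  simp [varSize, pairCov, pairMean_succ, binomMean_succ]

theorem hasSum_varToll (n : ℕ) :
    HasSum (fun w => binomMean (wt (letterP M p) w) (varToll M p) n) (varSize M p n) :=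
  h.hasSum_of_recursion varSize_zero varSize_one h.varSize_eq n

theorem varToll_nonneg (n : ℕ) : 0 ≤ varToll M p n :=
  mul_nonneg h.M_pos.le (multVar_nonneg (fun j => (h.hp j).1.le) h.hsum _ n)

theorem meanSize_two_pos : 0 < meanSize M p 2 := by
  refine lt_of_lt_of_le ?_ ((h.summable_meanSize 2).le_tsum []
    fun w _ => h.binomMean_atLeastTwo_nonneg w 2)
  simp [binomMean_one, atLeastTwo]

/-- For two labelings the sum of conditional means is `meanSize M p 2` if the two letters agree and
0 otherwise. This is a multiple of a Bernoulli variable with parameter ∑ p_j² strictly between 0 and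
1. -/
theorem varToll_two_pos : 0 < varToll M p 2 := by
  refine mul_pos h.M_pos ?_
  have hE := h.meanSize_two_pos
  have h1 : ∀ i j : Fin A, ∑ k, meanSize M p ((0 + Pi.single j 1 + Pi.single i 1 : Fin A → ℕ) k)
      = if i = j then meanSize M p 2 else 0 := by
    intro i j
    rcases eq_or_ne i j with rfl | hij
    · rw [if_pos rfl, Finset.sum_eq_single i]
      · simp
      · intro k _ hk
        simp [Pi.single_eq_of_ne hk, meanSize_zero]
      · simp
    · rw [if_neg hij]
      refine Finset.sum_eq_zero fun k _ => ?_
      rcases eq_or_ne k i with rfl | hk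
      · simp [Pi.single_eq_of_ne hij, meanSize_one]
      · rcases eq_or_ne k j with rfl | hk'
        · simp [Pi.single_eq_of_ne hk, meanSize_one]
        · simp [Pi.single_eq_of_ne hk, Pi.single_eq_of_ne hk', meanSize_zero]
  have h2 : ∀ m : ℕ, m ≠ 0 → multMean p (fun x => (∑ j, meanSize M p (x j)) ^ m) 2 =
      meanSize M p 2 ^ m * ∑ i, p i ^ 2 := by
    intro m hm
    simp only [multMean_succ, multMean_zero, h1, Finset.mul_sum]
    refine Finset.sum_congr rfl fun i _ => ?_
    rw [Finset.sum_eq_single i]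
    · simp; ring
    · intro j _ hj
      simp [hj.symm, hm]
    · simp
  have h3 := h2 1 one_ne_zero
  simp only [pow_one] at h3
  rw [multVar, h2 2 two_ne_zero, h3]
  have h4 : 0 < ∑ i, p i ^ 2 := Finset.sum_pos (fun i _ => pow_pos (h.hp i).1 2) h.univ_nonempty
  have h5 : ∑ i, p i ^ 2 < 1 := by
    refine h.hne.trans_le ?_
    rw [div_le_one h.M_pos]
    exact_mod_cast h.hM
  have h6 : 0 < meanSize M p 2 ^ 2 * ((∑ i, p i ^ 2) * (1 - ∑ i, p i ^ 2)) :=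
    mul_pos (pow_pos hE 2) (mul_pos h4 (by linarith))
  linarith

end IsSetting

end GTrie

end

noncomputable section

namespace GTrie

open Topology

/-! ### Differences of the mean size -/

section SingleTerms

variable {t : ℝ}

theorem binomMean_single_le_one (h0 : 0 ≤ t) (h1 : t ≤ 1) (j n : ℕ) :
    n.choose j * t ^ j * (1 - t) ^ (n - j) ≤ 1 := by
  rw [← binomMean_single]
  exact (binomMean_le h0 h1 (σ := fun _ => 1) fun k _ => by split_ifs <;> norm_num).trans_eq
    (binomMean_const t 1 n)

/-- The bound by a constant holds because the left side is, up to a constant, a single binomial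
probability, here of the value 2 in n + 2 trials; the quadratic bound drops the power of 1 - t. The
next two lemmas use the same device. -/
theorem sq_mul_one_sub_pow_le (h0 : 0 ≤ t) (h1 : t ≤ 1) (n : ℕ) :
    ((n + 1 : ℕ) : ℝ) ^ 2 * (t ^ 2 * (1 - t) ^ n) ≤ 2 * min ((((n + 1 : ℕ) : ℝ) * t) ^ 2) 1 := by
  have hb0 : 0 ≤ (1 - t) ^ n := pow_nonneg (by linarith) n
  have hb1 : (1 - t) ^ n ≤ 1 := pow_le_one₀ (by linarith) (by linarith)
  rw [mul_min_of_nonneg _ _ zero_le_two, le_min_iff]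
  constructor
  · have : ((n + 1 : ℕ) : ℝ) ^ 2 * (t ^ 2 * (1 - t) ^ n) ≤ (((n + 1 : ℕ) : ℝ) * t) ^ 2 := by
      rw [mul_pow, ← mul_assoc]
      exact mul_le_of_le_one_right (by positivity) hb1
    nlinarith [sq_nonneg (((n + 1 : ℕ) : ℝ) * t)]
  · have h2 := binomMean_single_le_one h0 h1 2 (n + 2)
    rw [Nat.add_sub_cancel, Nat.cast_choose_two] at h2
    have h3 : 0 ≤ t ^ 2 * (1 - t) ^ n := by positivity
    push_cast at h2 ⊢
    nlinarith [mul_nonneg (Nat.cast_nonneg (α := ℝ) n) h3]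

theorem sq_mul_single_one_le (h0 : 0 ≤ t) (h1 : t ≤ 1) (n : ℕ) :
    ((n + 1 : ℕ) : ℝ) ^ 2 * (t ^ 2 * (n * t * (1 - t) ^ (n - 1))) ≤
      6 * min ((((n + 1 : ℕ) : ℝ) * t) ^ 2) 1 := by
  have hu : 0 ≤ (1 - t) ^ (n - 1) := pow_nonneg (by linarith) _
  have hb0 : 0 ≤ n * t * (1 - t) ^ (n - 1) := by positivity
  have hb1 : n * t * (1 - t) ^ (n - 1) ≤ 1 := by simpa using binomMean_single_le_one h0 h1 1 n
  rw [mul_min_of_nonneg _ _ (by norm_num), le_min_iff]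
  constructor
  · have : ((n + 1 : ℕ) : ℝ) ^ 2 * (t ^ 2 * (n * t * (1 - t) ^ (n - 1))) ≤
        (((n + 1 : ℕ) : ℝ) * t) ^ 2 := by
      rw [mul_pow, ← mul_assoc]
      exact mul_le_of_le_one_right (by positivity) hb1
    nlinarith [sq_nonneg (((n + 1 : ℕ) : ℝ) * t)]
  · have h2 := binomMean_single_le_one h0 h1 3 (n + 2)
    have h3 : ((n + 2 : ℕ) : ℝ) * (n + 1 : ℕ) * n = (n + 2).choose 3 * 6 := by
      have e1 : (n + 2) * (n + 1).choose 2 = (n + 2).choose 3 * 3 :=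
        Nat.add_one_mul_choose_eq (n + 1) 2
      have e2 : (n + 1) * n.choose 1 = (n + 1).choose 2 * 2 := Nat.add_one_mul_choose_eq n 1
      rw [Nat.choose_one_right] at e2
      have e3 : (n + 2) * (n + 1) * n = (n + 2).choose 3 * 6 := by
        rw [mul_assoc, e2, ← mul_assoc, e1]; ring
      exact_mod_cast e3
    rw [show n + 2 - 3 = n - 1 by omega] at h2
    have h4 : ((n + 2 : ℕ) : ℝ) * (n + 1 : ℕ) * n * t ^ 3 * (1 - t) ^ (n - 1) ≤ 6 := by
      rw [h3]; linarith
    refine le_trans ?_ (h4.trans (by norm_num))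
    have h5 : 0 ≤ ((n : ℝ) + 1) * (n * t ^ 3 * (1 - t) ^ (n - 1)) := by positivity
    push_cast
    linarith

theorem mul_single_one_le (h0 : 0 ≤ t) (h1 : t ≤ 1) (n : ℕ) :
    ((n + 1 : ℕ) : ℝ) * (t * (n * t * (1 - t) ^ (n - 1))) ≤
      2 * min ((((n + 1 : ℕ) : ℝ) * t) ^ 2) 1 := by
  have hu : 0 ≤ (1 - t) ^ (n - 1) := pow_nonneg (by linarith) _
  have hu1 : (1 - t) ^ (n - 1) ≤ 1 := pow_le_one₀ (by linarith) (by linarith)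
  rw [mul_min_of_nonneg _ _ (by norm_num), le_min_iff]
  constructor
  · have h2 : 0 ≤ ((n + 1 : ℕ) : ℝ) * n * t ^ 2 := by positivity
    have h3 := mul_le_of_le_one_right h2 hu1
    have h4 : 0 ≤ ((n : ℝ) + 1) * t ^ 2 := by positivity
    have h5 : 0 ≤ (((n : ℝ) + 1) * t) ^ 2 := by positivity
    push_cast at h3 ⊢
    linarith
  · have h2 := binomMean_single_le_one h0 h1 2 (n + 1)
    rw [show n + 1 - 2 = n - 1 by omega, Nat.cast_choose_two] at h2
    push_cast at h2 ⊢
    linarith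

end SingleTerms

variable {M A : ℕ} {p : Fin A → ℝ} {ρ a : ℝ}

/-- Puts the bound by min(y², 1) into the form required by `exists_renewal_bound` at y = x π_w. -/
theorem min_sq_one_le {δ y : ℝ} (hδ : ρ + δ ≤ 2) (hδ' : δ ≤ ρ) (hy : 0 < y) :
    min (y ^ 2) 1 ≤ y ^ ρ * Real.exp (-(δ * |Real.log y|)) := by
  rcases le_total y 1 with h1 | h1
  · rw [abs_of_nonpos (Real.log_nonpos hy.le h1), show -(δ * -Real.log y) = Real.log y * δ by ring,
      ← Real.rpow_def_of_pos hy, ← Real.rpow_add hy]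
    refine (min_le_left _ _).trans ?_
    rw [← Real.rpow_natCast]
    exact Real.rpow_le_rpow_of_exponent_ge hy h1 (by exact_mod_cast hδ)
  · rw [abs_of_nonneg (Real.log_nonneg h1), show -(δ * Real.log y) = Real.log y * (-δ) by ring,
      ← Real.rpow_def_of_pos hy, ← Real.rpow_add hy]
    exact (min_le_right _ _).trans (Real.one_le_rpow h1 (by linarith))

namespace IsSetting

variable (h : IsSetting M p ρ a)

include h

theorem exists_min_sum_bound : ∃ C > 0, ∀ x : ℝ, 0 < x →
    Summable (fun w => min ((x * wt (letterP M p) w) ^ 2) 1) ∧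
      ∑' w, min ((x * wt (letterP M p) w) ^ 2) 1 ≤ C * x ^ ρ := by
  have hρ := h.one_le_rho
  have hρ2 := h.rho_lt_two
  obtain ⟨C, hC, hb⟩ := exists_renewal_bound (fun x => (h.q_pos x).le) h.sum_letterP_rpow h.log_neg
    (δ := 2 - ρ) (by linarith)
  refine ⟨C, hC, fun x hx => ?_⟩
  obtain ⟨hs, hle⟩ := hb (Real.log x)
  have hs' := hs.mul_left (x ^ ρ)
  have hterm : ∀ w, min ((x * wt (letterP M p) w) ^ 2) 1 ≤
      x ^ ρ * (wt (fun x => letterP M p x ^ ρ) w * Real.exp (-((2 - ρ) *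
        |Real.log x - len (fun x => -Real.log (letterP M p x)) w|))) := by
    intro w
    have hw := h.wt_pos w
    refine (min_sq_one_le (ρ := ρ) (δ := 2 - ρ) (by linarith) (by linarith)
      (mul_pos hx hw)).trans_eq ?_
    rw [wt_rpow (fun x => (h.letterP_pos x).le), h.len_eq, sub_neg_eq_add,
      Real.log_mul hx.ne' hw.ne', Real.mul_rpow hx.le hw.le, mul_assoc]
  have hsum : Summable (fun w => min ((x * wt (letterP M p) w) ^ 2) 1) :=
    Summable.of_nonneg_of_le (fun w => by positivity) hterm hs'
  refine ⟨hsum, (hsum.tsum_le_tsum hterm hs').trans ?_⟩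
  rw [tsum_mul_left, mul_comm]
  exact mul_le_mul_of_nonneg_right hle (by positivity)

/-- The first difference of 1_{k ≥ 2} is 1_{k = 1}, so one more labeling adds a node w exactly when
it contains w and w occurred once before. -/
theorem hasSum_meanSize_diff (n : ℕ) :
    HasSum (fun w => wt (letterP M p) w *
      (n * wt (letterP M p) w * (1 - wt (letterP M p) w) ^ (n - 1)))
      (meanSize M p (n + 1) - meanSize M p n) := by
  convert! (h.hasSum_meanSize (n + 1)).sub (h.hasSum_meanSize n) using 2 with w
  rw [binomMean_succ_sub]
  have h1 := binomMean_single (wt (letterP M p) w) 1 n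
  rw [Nat.choose_one_right, pow_one] at h1
  rw [← h1]
  congr 2
  funext k
  rcases k with _ | _ | k <;> simp [atLeastTwo]

theorem hasSum_meanSize_diff_diff (n : ℕ) :
    HasSum (fun w => wt (letterP M p) w ^ 2 * (1 - wt (letterP M p) w) ^ n -
      wt (letterP M p) w ^ 2 * (n * wt (letterP M p) w * (1 - wt (letterP M p) w) ^ (n - 1)))
      ((meanSize M p (n + 2) - meanSize M p (n + 1)) -
        (meanSize M p (n + 1) - meanSize M p n)) := by
  convert! (h.hasSum_meanSize_diff (n + 1)).sub (h.hasSum_meanSize_diff n) using 2 with w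
  rcases n with _ | n
  · simp; ring
  · push_cast
    simp only [pow_succ]
    ring

/-- The second differences of the mean size are of order `n ^ (ρ - 2)`. -/
theorem exists_diff_bounds : ∃ C > 0, ∀ n : ℕ,
    |meanSize M p (n + 1) - meanSize M p n| ≤ C * ((n + 1 : ℕ) : ℝ) ^ (ρ - 1) ∧
    |(meanSize M p (n + 2) - meanSize M p (n + 1)) - (meanSize M p (n + 1) - meanSize M p n)| ≤
      C * ((n + 1 : ℕ) : ℝ) ^ (ρ - 2) := by
  obtain ⟨C, hC, hb⟩ := h.exists_min_sum_bound
  refine ⟨8 * C, by positivity, fun n => ?_⟩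
  have hn : (0 : ℝ) < (n + 1 : ℕ) := by positivity
  obtain ⟨hs, hle⟩ := hb _ hn
  -- Used with m = 1 and m = 2. The constant 8 = 2 + 6 adds the bounds for the two parts of the
  -- second difference.
  have key : ∀ {f : List (Fin M × Fin A) → ℝ} {s : ℝ} {K : ℝ} (m : ℕ), 0 ≤ K → K ≤ 8 →
      HasSum f s → (∀ w, ((n + 1 : ℕ) : ℝ) ^ m * |f w| ≤
        K * min ((((n + 1 : ℕ) : ℝ) * wt (letterP M p) w) ^ 2) 1) →
      |s| ≤ 8 * C * ((n + 1 : ℕ) : ℝ) ^ (ρ - m) := by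
    intro f s K m hK hK8 hf hfb
    have h1 := (hf.mul_left (((n + 1 : ℕ) : ℝ) ^ m)).norm_le_of_bounded
      (hs.hasSum.mul_left K) fun w => by
        rw [norm_mul, Real.norm_eq_abs, Real.norm_eq_abs, abs_of_pos (by positivity)]
        exact hfb w
    rw [norm_mul, Real.norm_eq_abs, Real.norm_eq_abs, abs_of_pos (by positivity)] at h1
    rw [Real.rpow_sub_natCast hn.ne', ← mul_div_assoc, le_div_iff₀ (by positivity)]
    have h2 : K * ∑' w, min ((((n + 1 : ℕ) : ℝ) * wt (letterP M p) w) ^ 2) 1 ≤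
        8 * (C * ((n + 1 : ℕ) : ℝ) ^ ρ) :=
      mul_le_mul hK8 hle (tsum_nonneg fun w => by positivity) (by norm_num)
    linarith
  have hnn : ∀ w, 0 ≤ n * wt (letterP M p) w * (1 - wt (letterP M p) w) ^ (n - 1) := fun w =>
    mul_nonneg (mul_nonneg (Nat.cast_nonneg n) (h.wt_pos w).le)
      (pow_nonneg (sub_nonneg.2 (h.wt_le_one w)) _)
  constructor
  · have h1 := key 1 zero_le_two (by norm_num) (h.hasSum_meanSize_diff n) fun w => by
      rw [pow_one, abs_of_nonneg (mul_nonneg (h.wt_pos w).le (hnn w))]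
      exact mul_single_one_le (h.wt_pos w).le (h.wt_le_one w) n
    exact_mod_cast h1
  · have h1 := key (K := 8) 2 (by norm_num) le_rfl (h.hasSum_meanSize_diff_diff n) fun w => by
      have e1 := sq_mul_one_sub_pow_le (h.wt_pos w).le (h.wt_le_one w) n
      have e2 := sq_mul_single_one_le (h.wt_pos w).le (h.wt_le_one w) n
      have e3 : 0 ≤ wt (letterP M p) w ^ 2 * (1 - wt (letterP M p) w) ^ n :=
        mul_nonneg (sq_nonneg _) (pow_nonneg (sub_nonneg.2 (h.wt_le_one w)) _)
      have e4 := mul_nonneg (sq_nonneg (wt (letterP M p) w)) (hnn w)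
      refine (mul_le_mul_of_nonneg_left (abs_sub _ _) (by positivity)).trans ?_
      rw [abs_of_nonneg e3, abs_of_nonneg e4]
      linarith
    exact_mod_cast h1

end IsSetting

end GTrie

end

noncomputable section

namespace GTrie

open Topology

/-! ### Discrete Taylor remainder -/

section Taylor

variable {E : ℕ → ℝ} {C ρ : ℝ}

/-- The remainder in the linear approximation of `E` at `m`. -/
def rem (E : ℕ → ℝ) (m k : ℕ) : ℝ := E k - E m - (E m - E (m - 1)) * ((k : ℝ) - m)

theorem rem_self (k : ℕ) : rem E k k = 0 := by simp [rem]

theorem rem_succ (m k : ℕ) : rem E (m + 1) k =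
    rem E m k - ((k : ℝ) - m) * ((E (m + 1) - E m) - (E m - E (m - 1))) := by
  simp only [rem, Nat.add_sub_cancel]
  push_cast
  ring

/-- Equivalently, y^(ρ-1)·(1 - k/y) increases in y ≥ k. It compensates for the decreasing factor
m^(ρ-2) when the base point moves away from k. -/
theorem rpow_sub_two_mul_le (h1 : 1 ≤ ρ) {m : ℕ} (hm : 1 ≤ m) {k : ℕ} (hk : k ≤ m) :
    (m : ℝ) ^ (ρ - 2) * ((m : ℝ) - k) ≤ ((m + 1 : ℕ) : ℝ) ^ (ρ - 2) * (((m + 1 : ℕ) : ℝ) - k) := by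
  have hm0 : (0 : ℝ) < m := by exact_mod_cast hm
  have hm1 : (0 : ℝ) < (m + 1 : ℕ) := by positivity
  have hk' : (k : ℝ) ≤ m := by exact_mod_cast hk
  have e : ∀ y : ℝ, 0 < y → y ^ (ρ - 2) * (y - k) = y ^ (ρ - 1) * ((y - k) / y) := by
    intro y hy
    rw [show ρ - 1 = (ρ - 2) + 1 by ring, Real.rpow_add_one hy.ne']
    field_simp
  rw [e _ hm0, e _ hm1]
  refine mul_le_mul (Real.rpow_le_rpow hm0.le (by push_cast; linarith) (by linarith)) ?_
    (div_nonneg (by linarith) hm0.le) (by positivity)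
  rw [div_le_div_iff₀ hm0 hm1]
  push_cast
  nlinarith [Nat.cast_nonneg (α := ℝ) k]

/-- The induction moves the base point m with k fixed: by `rem_succ` one step changes the remainder
by k - m times a second difference. For k ≥ m this descends to m = k, and for k ≤ m it ascends from
there. -/
theorem abs_rem_le (h1 : 1 ≤ ρ) (h2 : ρ ≤ 2) (hC : 0 ≤ C)
    (hE : ∀ i : ℕ, 1 ≤ i → |(E (i + 1) - E i) - (E i - E (i - 1))| ≤ C * (i : ℝ) ^ (ρ - 2))
    {m : ℕ} (hm : 1 ≤ m) (k : ℕ) :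
    |rem E m k| ≤ C * ((m : ℝ) ^ (ρ - 2) * ((k : ℝ) - m) ^ 2) := by
  rcases le_total m k with hmk | hmk
  · obtain ⟨t, rfl⟩ := Nat.exists_eq_add_of_le hmk
    clear hmk
    induction t generalizing m with
    | zero => simp [rem_self]
    | succ t ih =>
      have h3 := ih (m := m + 1) (by omega)
      rw [show m + 1 + t = m + (t + 1) by ring] at h3
      have h4 := rem_succ (E := E) m (m + (t + 1))
      have h5 : rem E m (m + (t + 1)) = rem E (m + 1) (m + (t + 1)) +
          (((m + (t + 1) : ℕ) : ℝ) - m) * ((E (m + 1) - E m) - (E m - E (m - 1))) := by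
        rw [h4]; ring
      have hm0 : (0 : ℝ) < m := by exact_mod_cast hm
      have h6 : ((m + 1 : ℕ) : ℝ) ^ (ρ - 2) ≤ (m : ℝ) ^ (ρ - 2) :=
        Real.rpow_le_rpow_of_nonpos hm0 (by push_cast; linarith) (by linarith)
      have h7 : ((m + (t + 1) : ℕ) : ℝ) - m = t + 1 := by push_cast; ring
      have h8 : ((m + (t + 1) : ℕ) : ℝ) - (m + 1 : ℕ) = t := by push_cast; ring
      rw [h5, h7]
      rw [h8] at h3
      refine (abs_add_le _ _).trans ?_
      rw [abs_mul, abs_of_nonneg (by positivity : (0 : ℝ) ≤ t + 1)]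
      have h9 := mul_le_mul_of_nonneg_left (hE m hm) (by positivity : (0 : ℝ) ≤ t + 1)
      have h10 : C * (((m + 1 : ℕ) : ℝ) ^ (ρ - 2) * (t : ℝ) ^ 2) ≤
          C * ((m : ℝ) ^ (ρ - 2) * (t : ℝ) ^ 2) := by gcongr
      have h11 : 0 ≤ C * (m : ℝ) ^ (ρ - 2) * t := by positivity
      linarith
  · have hk0 : rem E (max k 1) k = 0 := by
      rcases k with _ | k
      · simp [rem]
      · rw [max_eq_left (by omega), rem_self]
    have hle : max k 1 ≤ m := max_le hmk hm
    clear hmk hm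
    induction m, hle using Nat.le_induction with
    | base => rw [hk0, abs_zero]; positivity
    | succ m hm ih =>
      have hm1 : 1 ≤ m := (le_max_right _ _).trans hm
      have hkm : k ≤ m := (le_max_left _ _).trans hm
      have hkm' : (k : ℝ) ≤ m := by exact_mod_cast hkm
      rw [rem_succ]
      refine (abs_sub _ _).trans ?_
      rw [abs_mul, abs_of_nonpos (by linarith : (k : ℝ) - m ≤ 0)]
      have h3 := mul_le_mul_of_nonneg_left (hE m hm1) (by linarith : 0 ≤ -((k : ℝ) - m))
      have h4 := mul_le_mul_of_nonneg_left (rpow_sub_two_mul_le h1 hm1 hkm)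
        (mul_nonneg hC (by linarith : 0 ≤ (m : ℝ) + 1 - k))
      push_cast at h4 ⊢
      linarith

end Taylor

/-! ### Binomial moments about an integer centre -/

section Moments

variable {t : ℝ}

/-- A positive integer close to `n * t`. -/
def center (t : ℝ) (n : ℕ) : ℕ := ⌊n * t⌋₊ + 1

theorem one_le_center (t : ℝ) (n : ℕ) : 1 ≤ center t n := Nat.le_add_left _ _

theorem lt_center (t : ℝ) (n : ℕ) : n * t < center t n := by
  unfold center
  exact_mod_cast Nat.lt_floor_add_one _

theorem center_le (h0 : 0 ≤ t) (n : ℕ) : (center t n : ℝ) ≤ n * t + 1 := by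
  have := Nat.floor_le (mul_nonneg (Nat.cast_nonneg (α := ℝ) n) h0)
  unfold center
  push_cast
  linarith

theorem binomMean_sub_center_pow_four_le (h0 : 0 ≤ t) (h1 : t ≤ 1) {n : ℕ} (hn : 1 ≤ n) :
    binomMean t (fun k => ((k : ℝ) - center t n) ^ 4) n ≤ 15 * (n : ℝ) ^ 2 := by
  have hn' : (1 : ℝ) ≤ n := by exact_mod_cast hn
  have h2 := lt_center t n
  have h3 := center_le h0 n
  simp only [sub_eq_add_neg]
  rw [binomMean_add_pow_four]
  set e := n * t + -(center t n : ℝ) with he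
  have he1 : e ≤ 0 := by linarith
  have he2 : -1 ≤ e := by linarith
  have hv0 : 0 ≤ t * (1 - t) := mul_nonneg h0 (by linarith)
  have hv1 : t * (1 - t) ≤ 1 := by nlinarith
  have hes : e ^ 2 ≤ 1 := by nlinarith
  have he4 : e ^ 4 ≤ 1 := by nlinarith [sq_nonneg e]
  have hw0 : 0 ≤ n * t * (1 - t) := by rw [mul_assoc]; positivity
  have hw1 : n * t * (1 - t) ≤ n := by
    rw [mul_assoc]; exact mul_le_of_le_one_right (by positivity) hv1
  have k1 : 6 * (n * t * (1 - t)) * e ^ 2 ≤ 6 * n := by nlinarith [sq_nonneg e]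
  have k2 : 4 * (n * t * (1 - t) * (1 - 2 * t)) * e ≤ 4 * n := by
    have : (1 - 2 * t) * e ≤ 1 := by nlinarith
    nlinarith
  have k3 : n * t * (1 - t) * (1 + 3 * ((n : ℝ) - 2) * t * (1 - t)) ≤ n * (1 + 3 * n) := by
    have h4 : 1 + 3 * ((n : ℝ) - 2) * t * (1 - t) ≤ 1 + 3 * n := by nlinarith
    have h5 : 0 ≤ 1 + 3 * (n : ℝ) := by linarith
    nlinarith
  nlinarith

theorem binomMean_sub_center_sq_le (h0 : 0 ≤ t) (h1 : t ≤ 1) {n : ℕ} (hn : 1 ≤ n) :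
    binomMean t (fun k => ((k : ℝ) - center t n) ^ 2) n ≤ 2 * (n : ℝ) := by
  have hn' : (1 : ℝ) ≤ n := by exact_mod_cast hn
  have h2 := lt_center t n
  have h3 := center_le h0 n
  simp only [sub_eq_add_neg]
  rw [binomMean_add_sq]
  have hv1 : t * (1 + -t) ≤ 1 := by nlinarith
  nlinarith

theorem binomMean_abs_sub_center_le (h0 : 0 ≤ t) (h1 : t ≤ 1) {n : ℕ} (hn : 1 ≤ n) :
    binomMean t (fun k => |(k : ℝ) - center t n|) n ≤ 3 * Real.sqrt n := by
  have hn' : (0 : ℝ) < n := by exact_mod_cast hn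
  have hs : 0 < Real.sqrt n := Real.sqrt_pos.2 hn'
  have hss : Real.sqrt n * Real.sqrt n = n := Real.mul_self_sqrt hn'.le
  -- Pointwise y ≤ y²/√n + √n, by completing the square.
  have h2 : binomMean t (fun k => |(k : ℝ) - center t n|) n ≤
      binomMean t (fun k => (Real.sqrt n)⁻¹ * ((k : ℝ) - center t n) ^ 2 + Real.sqrt n) n := by
    refine binomMean_le h0 h1 fun k _ => ?_
    set y := |(k : ℝ) - center t n|
    rw [← sq_abs]
    have h3 : (Real.sqrt n)⁻¹ * y ^ 2 + Real.sqrt n - y =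
        (Real.sqrt n)⁻¹ * ((y - Real.sqrt n / 2) ^ 2 + 3 / 4 * n) := by
      field_simp
      nlinarith
    have h4 : 0 ≤ (Real.sqrt n)⁻¹ * ((y - Real.sqrt n / 2) ^ 2 + 3 / 4 * n) := by positivity
    linarith
  refine h2.trans ?_
  rw [binomMean_add, binomMean_const, binomMean_const_mul]
  have h3 := mul_le_mul_of_nonneg_left (binomMean_sub_center_sq_le h0 h1 hn) (inv_pos.2 hs).le
  have h4 : (Real.sqrt n)⁻¹ * (2 * n) = 2 * Real.sqrt n := by
    field_simp
    nlinarith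
  linarith

end Moments

end GTrie

end

/-! ### Bounds for the toll of the variance -/

noncomputable section

namespace GTrie

open Topology

variable {M A : ℕ} {p : Fin A → ℝ} {ρ a : ℝ}

theorem sum_eq_linear_add_rem (E : ℕ → ℝ) (m : Fin A → ℕ) (x : Fin A → ℕ) :
    ∑ j, E (x j) = (∑ j, (E (m j) - E (m j - 1)) * (x j : ℝ) + ∑ j, rem E (m j) (x j)) +
      ∑ j, (E (m j) - (E (m j) - E (m j - 1)) * m j) := by
  rw [← Finset.sum_add_distrib, ← Finset.sum_add_distrib]
  refine Finset.sum_congr rfl fun j _ => ?_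
  rw [rem]
  ring

theorem abs_sub_le_of_diff_le {e : ℕ → ℝ} {C : ℝ} (he : ∀ k, |e (k + 1) - e k| ≤ C) (k m : ℕ) :
    |e k - e m| ≤ C * |(k : ℝ) - m| := by
  have key : ∀ m t : ℕ, |e (m + t) - e m| ≤ C * t := by
    intro m t
    induction t with
    | zero => simp
    | succ t ih =>
      have h1 := abs_add_le (e (m + t + 1) - e (m + t)) (e (m + t) - e m)
      rw [sub_add_sub_cancel] at h1
      have h2 := he (m + t)
      rw [← add_assoc]
      push_cast
      linarith
  rcases le_total m k with h | h
  · obtain ⟨t, rfl⟩ := Nat.exists_eq_add_of_le h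
    simpa using key m t
  · obtain ⟨t, rfl⟩ := Nat.exists_eq_add_of_le h
    rw [abs_sub_comm, abs_sub_comm (k : ℝ)]
    simpa using key k t

namespace IsSetting

variable (h : IsSetting M p ρ a)

include h

omit h in
theorem abs_diff_diff_le {C : ℝ} (hC : ∀ n : ℕ,
    |(meanSize M p (n + 2) - meanSize M p (n + 1)) - (meanSize M p (n + 1) - meanSize M p n)| ≤
      C * ((n + 1 : ℕ) : ℝ) ^ (ρ - 2)) (i : ℕ) (hi : 1 ≤ i) :
    |(meanSize M p (i + 1) - meanSize M p i) - (meanSize M p i - meanSize M p (i - 1))| ≤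
      C * (i : ℝ) ^ (ρ - 2) := by
  obtain ⟨i, rfl⟩ := Nat.exists_eq_add_of_le' hi
  exact hC i

/-- The remainders are at most a multiple of n^(ρ-2) times the squared deviation from the centre,
and fourth moments of the deviation are O(n²). -/
theorem exists_multVar_rem_le : ∃ K > 0, ∀ n : ℕ, 1 ≤ n →
    multVar p (fun x => ∑ j, rem (meanSize M p) (center (p j) n) (x j)) n ≤
      K * (n : ℝ) ^ (2 * ρ - 2) := by
  obtain ⟨C, hC, hb⟩ := h.exists_diff_bounds
  have hρ := h.one_le_rho
  have hρ2 := h.rho_lt_two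
  obtain ⟨j₀, -⟩ := h.univ_nonempty
  have hA : (0 : ℝ) < A := by exact_mod_cast Fin.pos j₀
  refine ⟨A * ∑ j, 15 * (C * p j ^ (ρ - 2)) ^ 2, mul_pos hA (Finset.sum_pos (fun j _ => ?_)
    h.univ_nonempty), fun n hn => ?_⟩
  · have := Real.rpow_pos_of_pos (h.hp j).1 (ρ - 2)
    positivity
  have hn0 : (0 : ℝ) < n := by exact_mod_cast hn
  have h0 : ∀ j, 0 ≤ p j := fun j => (h.hp j).1.le
  refine (multVar_le h.hsum _ 0 n).trans ?_
  have h1 : multMean p (fun x => (∑ j, rem (meanSize M p) (center (p j) n) (x j) - 0) ^ 2) n ≤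
      multMean p (fun x => A * ∑ j, rem (meanSize M p) (center (p j) n) (x j) ^ 2) n :=
    multMean_le h0 fun x _ => by
      simpa using sq_sum_le_card_mul_sum_sq (s := Finset.univ)
        (f := fun j => rem (meanSize M p) (center (p j) n) (x j))
  refine h1.trans ?_
  rw [multMean_const_mul, multMean_sum, mul_assoc, Finset.sum_mul]
  refine mul_le_mul_of_nonneg_left (Finset.sum_le_sum fun j _ => ?_) hA.le
  rw [multMean_apply h.hsum j fun k => rem (meanSize M p) (center (p j) n) k ^ 2]
  set m := center (p j) n with hm
  have hpj := (h.hp j).1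
  -- As ρ < 2 the power decreases, so it matters that the centre lies above n p_j.
  have hm0 : (m : ℝ) ^ (ρ - 2) ≤ (n : ℝ) ^ (ρ - 2) * p j ^ (ρ - 2) := by
    rw [← Real.mul_rpow hn0.le hpj.le]
    exact Real.rpow_le_rpow_of_nonpos (mul_pos hn0 hpj) (lt_center _ _).le (by linarith)
  have h2 : binomMean (p j) (fun k => rem (meanSize M p) m k ^ 2) n ≤
      binomMean (p j) (fun k => (C * ((n : ℝ) ^ (ρ - 2) * p j ^ (ρ - 2))) ^ 2 *
        ((k : ℝ) - m) ^ 4) n := by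
    refine binomMean_le hpj.le (h.hp j).2.le fun k _ => ?_
    have h3 := abs_rem_le hρ hρ2.le hC.le (abs_diff_diff_le fun n => (hb n).2)
      (one_le_center (p j) n) k
    rw [← hm] at h3
    have h4 : C * ((m : ℝ) ^ (ρ - 2) * ((k : ℝ) - m) ^ 2) ≤
        C * ((n : ℝ) ^ (ρ - 2) * p j ^ (ρ - 2)) * ((k : ℝ) - m) ^ 2 := by
      rw [← mul_assoc]
      gcongr
    have h5 := pow_le_pow_left₀ (abs_nonneg _) (h3.trans h4) 2
    rw [sq_abs, mul_pow, ← pow_mul] at h5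
    exact h5
  refine h2.trans ?_
  rw [binomMean_const_mul]
  refine (mul_le_mul_of_nonneg_left (binomMean_sub_center_pow_four_le hpj.le (h.hp j).2.le hn)
    (sq_nonneg _)).trans_eq ?_
  have h6 : (n : ℝ) ^ (2 * ρ - 2) = ((n : ℝ) ^ (ρ - 2)) ^ 2 * (n : ℝ) ^ 2 := by
    rw [← Real.rpow_natCast, ← Real.rpow_natCast, ← Real.rpow_mul hn0.le, ← Real.rpow_add hn0]
    congr 1
    push_cast
    ring
  rw [h6]
  ring

theorem multVar_sum_meanSize (n : ℕ) (m : Fin A → ℕ) :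
    multVar p (fun x => ∑ j, meanSize M p (x j)) n =
    multVar p (fun x => ∑ j, (meanSize M p (m j) - meanSize M p (m j - 1)) * (x j : ℝ) +
      ∑ j, rem (meanSize M p) (m j) (x j)) n := by
  simp only [sum_eq_linear_add_rem (meanSize M p) m]
  exact multVar_add_const h.hsum _ _ n

omit h in
theorem varToll_zero : varToll M p 0 = 0 := by simp [varToll, multVar]

/-- In the uniform case the toll is of order `n ^ (2 * ρ - 2)`. -/
theorem exists_varToll_le_of_uniform (hu : ∀ j, p j = 1 / (A : ℝ)) :
    ∃ K > 0, ∀ n : ℕ, |varToll M p n| ≤ K * (n : ℝ) ^ (2 * ρ - 2) := by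
  obtain ⟨K, hK, hb⟩ := h.exists_multVar_rem_le
  have hM := h.M_pos
  refine ⟨M * K, by positivity, fun n => ?_⟩
  rcases Nat.eq_zero_or_pos n with rfl | hn
  · rw [varToll_zero, abs_zero]
    positivity
  rw [abs_of_nonneg (h.varToll_nonneg n), varToll, mul_assoc]
  refine mul_le_mul_of_nonneg_left ?_ hM.le
  refine le_of_eq_of_le ?_ (hb n hn)
  rw [h.multVar_sum_meanSize n fun j => center (p j) n]
  have h0 : ∀ j, 0 ≤ p j := fun j => (h.hp j).1.le
  -- All letters share this slope, so the linear part is D·∑ x_j = D·n, a constant without effect on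
  -- the variance.
  set D := meanSize M p (center (1 / A) n) - meanSize M p (center (1 / A) n - 1) with hD
  rw [← multVar_add_const h.hsum (fun x => ∑ j, rem (meanSize M p) (center (p j) n) (x j))
    (D * n) n]
  refine multVar_congr h0 fun x hx => ?_
  simp only [hu, ← hD]
  rw [← Finset.mul_sum, add_comm, ← hx]
  push_cast
  ring

/-- The sums over words satisfy a recursion with respect to the first letter. -/
theorem tsum_binomMean_eq {τ : ℕ → ℝ} (t0 : τ 0 = 0) (t1 : τ 1 = 0) (n : ℕ) :
    ∑' w, binomMean (wt (letterP M p) w) τ n = τ n + ∑ x, binomMean (letterP M p x)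
      (fun k => ∑' w, binomMean (wt (letterP M p) w) τ k) n := by
  rw [tsum_list (h.summable_binomMean t0 t1 n), wt_nil, binomMean_one]
  congr 1
  refine Finset.sum_congr rfl fun x _ => ?_
  rw [← (hasSum_binomMean (letterP M p x)
    (fun k => (h.summable_binomMean t0 t1 k).hasSum) n).tsum_eq]
  refine tsum_congr fun w => ?_
  rw [wt_cons]
  exact (binomMean_binomMean _ _ _ _).symm

/-- For each word, n t P(Bin(n-1, t) = 1) = 2 P(Bin(n, t) = 2). So n times the slope is itself a
word sum with a bounded toll and has a periodic factor. -/
theorem mul_diff_eq_tsum (n : ℕ) : n * (meanSize M p n - meanSize M p (n - 1)) =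
    ∑' w, binomMean (wt (letterP M p) w) (fun k => if k = 2 then 2 else 0) n := by
  have h1 : (fun k : ℕ => if k = 2 then (2 : ℝ) else 0) = fun k => 2 * if k = 2 then 1 else 0 := by
    funext k; simp
  simp only [h1, binomMean_const_mul, binomMean_single]
  rcases n with _ | n
  · simp
  · rw [Nat.add_sub_cancel, ← (h.hasSum_meanSize_diff n).tsum_eq, ← tsum_mul_left]
    refine tsum_congr fun w => ?_
    rw [Nat.cast_choose_two, show n + 1 - 2 = n - 1 by omega]
    push_cast
    ring

/-- The variance with a correction that makes its toll small if `ρ = 1`. -/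
theorem exists_toll_bound_of_rho_eq_one (h1 : ρ = 1) : ∃ K > 0, ∀ n : ℕ,
    |(varSize M p n + n * (meanSize M p n - meanSize M p (n - 1)) ^ 2) -
      ∑ x, binomMean (letterP M p x) (fun k => varSize M p k +
        k * (meanSize M p k - meanSize M p (k - 1)) ^ 2) n| ≤ K * (n : ℝ) ^ (1 / 2 : ℝ) := by
  obtain ⟨C, hC, hb⟩ := h.exists_diff_bounds
  obtain ⟨K, hK, hr⟩ := h.exists_multVar_rem_le
  have hM := h.M_eq_one h1
  have hM' : (M : ℝ) = 1 := by rw [hM, Nat.cast_one]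
  set d : ℕ → ℝ := fun k => meanSize M p k - meanSize M p (k - 1) with hd
  have hdC : ∀ k, |d k| ≤ C := by
    intro k
    rcases k with _ | k
    · simpa [hd] using hC.le
    · have := (hb k).1
      rw [h1, sub_self, Real.rpow_zero, mul_one] at this
      exact this
  -- For ρ = 1 the slopes d are bounded and their increments are O(1/k), so k·d k is Lipschitz.
  have hlip : ∀ k m : ℕ, |k * d k - m * d m| ≤ 2 * C * |(k : ℝ) - m| := by
    refine abs_sub_le_of_diff_le (e := fun k : ℕ => k * d k) fun k => ?_
    have e1 : ((k + 1 : ℕ) : ℝ) * d (k + 1) - k * d k = d (k + 1) + k * (d (k + 1) - d k) := by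
      push_cast; ring
    rw [e1]
    refine (abs_add_le _ _).trans ?_
    have e2 : |k * (d (k + 1) - d k)| ≤ C := by
      rcases Nat.eq_zero_or_pos k with rfl | hk
      · simpa using hC.le
      · have e3 := abs_diff_diff_le (fun n => (hb n).2) k hk
        have hk0 : (0 : ℝ) < k := by exact_mod_cast hk
        rw [h1, show (1 : ℝ) - 2 = -1 by norm_num, Real.rpow_neg_one, ← div_eq_mul_inv,
          le_div_iff₀ hk0] at e3
        rw [abs_mul, abs_of_pos hk0, mul_comm]
        exact e3
    have := hdC (k + 1)
    linarith
  have hlin : ∀ k m : ℕ, |k * d k - k * d m| ≤ 3 * C * |(k : ℝ) - m| := by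
    intro k m
    have e1 : k * d k - k * d m = (k * d k - m * d m) - ((k : ℝ) - m) * d m := by ring
    rw [e1]
    refine (abs_sub _ _).trans ?_
    rw [abs_mul]
    have e2 := mul_le_mul_of_nonneg_left (hdC m) (abs_nonneg ((k : ℝ) - m))
    have := hlip k m
    linarith
  have hsq : ∀ k m : ℕ, |k * d k ^ 2 - k * d m ^ 2| ≤ 6 * C ^ 2 * |(k : ℝ) - m| := by
    intro k m
    have e1 : k * d k ^ 2 - k * d m ^ 2 = (k * d k - k * d m) * (d k + d m) := by ring
    rw [e1, abs_mul]
    have e2 : |d k + d m| ≤ 2 * C := by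
      have := abs_add_le (d k) (d m)
      have := hdC k
      have := hdC m
      linarith
    have e3 := mul_le_mul (hlin k m) e2 (abs_nonneg _) (by positivity)
    linarith
  -- The constant collects the three error bounds `hvar`, `hcor1'` and `hcor2`.
  refine ⟨C ^ 2 + 2 * K + (2 + A * (9 * C)) * (2 * C) + A * (18 * C ^ 2), by positivity,
    fun n => ?_⟩
  have hsumx : ∀ f : ℝ → ℝ, ∑ x, f (letterP M p x) = ∑ j, f (p j) := by
    intro f
    simp only [letterP, Fintype.sum_prod_type, Finset.sum_const, Finset.card_univ,
      Fintype.card_fin, hM, one_smul]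
  rcases Nat.eq_zero_or_pos n with rfl | hn
  · simp [varSize_zero]
  have hn0 : (0 : ℝ) < n := by exact_mod_cast hn
  have hn1 : (1 : ℝ) ≤ n := by exact_mod_cast hn
  rw [← Real.sqrt_eq_rpow]
  set s := Real.sqrt n with hs
  have hs0 : 0 < s := Real.sqrt_pos.2 hn0
  have hs1 : 1 ≤ s := Real.one_le_sqrt.2 hn1
  have hss : s * s = n := Real.mul_self_sqrt hn0.le
  set D : Fin A → ℝ := fun j => d (center (p j) n) with hDdef
  set S1 := ∑ j, p j * D j with hS1
  set S2 := ∑ j, p j * D j ^ 2 with hS2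
  have h0 : ∀ j, 0 ≤ p j := fun j => (h.hp j).1.le
  have hmean : ∀ f : Fin A → ℝ, ∀ B : ℝ, (∀ j, |f j| ≤ B) → |∑ j, p j * f j| ≤ B := by
    intro f B hf
    calc |∑ j, p j * f j| ≤ ∑ j, |p j * f j| := Finset.abs_sum_le_sum_abs _ _
      _ ≤ ∑ j, p j * B := Finset.sum_le_sum fun j _ => by
          rw [abs_mul, abs_of_nonneg (h0 j)]
          exact mul_le_mul_of_nonneg_left (hf j) (h0 j)
      _ = B := by rw [← Finset.sum_mul, h.hsum, one_mul]
  have hS1C : |S1| ≤ C := hmean D C fun j => hdC _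
  have hS2C : |S2| ≤ C ^ 2 := hmean _ _ fun j => by
    rw [abs_pow]
    exact pow_le_pow_left₀ (abs_nonneg _) (hdC _) 2
  -- the toll of the variance
  have hvar : |varToll M p n - n * (S2 - S1 ^ 2)| ≤ (C ^ 2 + 2 * K) * s := by
    have e1 : varToll M p n = multVar p (fun x => ∑ j, D j * (x j : ℝ) +
        ∑ j, rem (meanSize M p) (center (p j) n) (x j)) n := by
      rw [varToll, h.multVar_sum_meanSize n fun j => center (p j) n, hM', one_mul]
    have e2 : multVar p (fun x => ∑ j, D j * (x j : ℝ)) n = n * (S2 - S1 ^ 2) := by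
      have e3 := multMean_linear_sq h.hsum D 0 n
      have e4 := multMean_linear h.hsum D 0 n
      simp only [add_zero] at e3 e4
      rw [multVar, e3, e4]
      ring
    -- With r = √n the errors balance: the linear part has variance O(n) and the remainder O(1), so
    -- both contributions are O(√n).
    have e5 := abs_multVar_add_sub_le h0 h.hsum (fun x => ∑ j, D j * (x j : ℝ))
      (fun x => ∑ j, rem (meanSize M p) (center (p j) n) (x j)) n hs0
    rw [e2, ← e1] at e5
    refine e5.trans ?_
    have e6 := hr n hn
    rw [h1, show (2 : ℝ) * 1 - 2 = 0 by norm_num, Real.rpow_zero, mul_one] at e6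
    have e7 : s⁻¹ * (n * (S2 - S1 ^ 2)) ≤ C ^ 2 * s := by
      rw [← hss, mul_assoc, inv_mul_cancel_left₀ hs0.ne', mul_comm]
      refine mul_le_mul_of_nonneg_right ?_ hs0.le
      linarith [le_abs_self S2, sq_nonneg S1]
    have e8 := mul_le_mul_of_nonneg_left e6 (by linarith : 0 ≤ s + 1)
    have e9 := mul_le_mul_of_nonneg_right hs1 hK.le
    linarith
  -- the two corrections
  have hB : ∀ (f : ℕ → ℝ) (F : ℝ) (L : ℝ) (j : Fin A), 0 ≤ L →
      (∀ k : ℕ, |f k - k * F| ≤ L * |(k : ℝ) - center (p j) n|) →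
      |binomMean (p j) f n - n * (p j * F)| ≤ 3 * L * s := by
    intro f F L j hL hf
    have e1 : binomMean (p j) f n - n * (p j * F) = binomMean (p j) (fun k => f k - k * F) n := by
      have e2 : (fun k : ℕ => (k : ℝ) * F) = fun k : ℕ => F * (k : ℝ) := by funext k; ring
      rw [binomMean_sub, e2, binomMean_const_mul, binomMean_id]
      ring
    rw [e1]
    refine (abs_binomMean_le (h0 j) (h.hp j).2.le fun k _ => hf k).trans ?_
    rw [binomMean_const_mul]
    have := mul_le_mul_of_nonneg_left
      (binomMean_abs_sub_center_le (h0 j) (h.hp j).2.le hn) hL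
    linarith
  have hBsum : ∀ (f : ℕ → ℝ) (F : Fin A → ℝ) (L : ℝ), 0 ≤ L →
      (∀ j, ∀ k : ℕ, |f k - k * F j| ≤ L * |(k : ℝ) - center (p j) n|) →
      |∑ j, binomMean (p j) f n - n * ∑ j, p j * F j| ≤ A * (3 * L) * s := by
    intro f F L hL hf
    rw [Finset.mul_sum, ← Finset.sum_sub_distrib]
    refine (Finset.abs_sum_le_sum_abs _ _).trans ((Finset.sum_le_sum fun j _ =>
      hB f (F j) L j hL (hf j)).trans_eq ?_)
    simp [mul_assoc]
  have hcor2 : |∑ j, binomMean (p j) (fun k => k * d k ^ 2) n - n * S2| ≤ A * (18 * C ^ 2) * s := by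
    have := hBsum (fun k => k * d k ^ 2) (fun j => D j ^ 2) (6 * C ^ 2) (by positivity)
      fun j k => hsq k _
    linarith
  -- The recursion for n·d n has toll 2·1_{n=2}, so n·d n agrees up to O(√n) with n times the
  -- average slope S1.
  have hcor1 : |n * d n - n * S1| ≤ (2 + A * (9 * C)) * s := by
    have e1 := h.tsum_binomMean_eq (τ := fun k => if k = 2 then 2 else 0) (by simp) (by simp) n
    simp only [← h.mul_diff_eq_tsum] at e1
    rw [hsumx fun t => binomMean t
      (fun k => (k : ℝ) * (meanSize M p k - meanSize M p (k - 1))) n] at e1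
    have e2 := hBsum (fun k => k * d k) D (3 * C) (by positivity) fun j k => hlin k _
    have e3 : n * d n - n * S1 = (if n = 2 then 2 else 0) +
        (∑ j, binomMean (p j) (fun k => k * d k) n - n * S1) := by
      rw [← add_sub_assoc]
      exact congrArg (· - n * S1) e1
    rw [e3]
    refine (abs_add_le _ _).trans ?_
    have e4 : |if n = 2 then (2 : ℝ) else 0| ≤ 2 * s := by
      split_ifs
      · rw [abs_two]; linarith
      · rw [abs_zero]; positivity
    linarith
  have hcor1' : |n * d n ^ 2 - n * S1 ^ 2| ≤ (2 + A * (9 * C)) * (2 * C) * s := by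
    have e1 : n * d n ^ 2 - n * S1 ^ 2 = (n * d n - n * S1) * (d n + S1) := by ring
    have e2 : |d n + S1| ≤ 2 * C := by
      have := abs_add_le (d n) S1
      have := hdC n
      linarith
    rw [e1, abs_mul]
    have := mul_le_mul hcor1 e2 (abs_nonneg _) (by positivity)
    linarith
  -- The main terms n·S2 and n·S1² cancel between the toll of the variance and the toll of the
  -- correction.
  have hid : (varSize M p n + n * d n ^ 2) -
      ∑ x, binomMean (letterP M p x) (fun k => varSize M p k + k * d k ^ 2) n =
      (varToll M p n - n * (S2 - S1 ^ 2)) + (n * d n ^ 2 - n * S1 ^ 2)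
        - (∑ j, binomMean (p j) (fun k => k * d k ^ 2) n - n * S2) := by
    simp only [binomMean_add, Finset.sum_add_distrib]
    rw [hsumx fun t => binomMean t (fun k => k * d k ^ 2) n, h.varSize_eq n]
    ring
  rw [hid]
  refine (abs_sub _ _).trans ?_
  have := abs_add_le (varToll M p n - n * (S2 - S1 ^ 2)) (n * d n ^ 2 - n * S1 ^ 2)
  linarith

end IsSetting

end GTrie

end

/-! ### Periodic factors: uniqueness, positivity and the variance asymptotics -/

noncomputable section

namespace GTrie

open Topology

namespace IsPeriodicFactor

variable {a ρ : ℝ} {u v : ℕ → ℝ} {P Q : ℝ → ℝ}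

theorem tendsto_div_sub (hu : IsPeriodicFactor a ρ u P) :
    Tendsto (fun n : ℕ => u n / (n : ℝ) ^ ρ - P (Real.logb a n)) atTop (𝓝 0) := by
  refine hu.asymptotics.tendsto_div_nhds_zero.congr' ?_
  filter_upwards [eventually_ge_atTop 1] with n hn
  have hn0 : (0 : ℝ) < n := by exact_mod_cast hn
  have := (Real.rpow_pos_of_pos hn0 ρ).ne'
  field_simp

theorem of_tendsto (hc : Continuous P) (hp : Function.Periodic P 1)
    (ht : Tendsto (fun n : ℕ => u n / (n : ℝ) ^ ρ - P (Real.logb a n)) atTop (𝓝 0)) :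
    IsPeriodicFactor a ρ u P := by
  refine ⟨hc, hp, ?_⟩
  have hpos : ∀ᶠ n : ℕ in atTop, (n : ℝ) ^ ρ ≠ 0 := by
    filter_upwards [eventually_ge_atTop 1] with n hn
    have hn0 : (0 : ℝ) < n := by exact_mod_cast hn
    exact (Real.rpow_pos_of_pos hn0 ρ).ne'
  rw [Asymptotics.isLittleO_iff_tendsto' (hpos.mono fun n hn h0 => absurd h0 hn)]
  refine ht.congr' (hpos.mono fun n hn => ?_)
  field_simp

theorem exists_bound (hu : IsPeriodicFactor a ρ u P) : ∃ B, ∀ x, |P x| ≤ B := by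
  obtain ⟨B, hB⟩ := (isCompact_Icc (a := (0 : ℝ)) (b := 1)).exists_bound_of_continuousOn
    hu.continuous.continuousOn
  refine ⟨B, fun x => ?_⟩
  obtain ⟨y, hy, hxy⟩ := hu.periodic.exists_mem_Ico₀ one_pos x
  rw [hxy]
  exact hB y ⟨hy.1, hy.2.le⟩

theorem sub (hu : IsPeriodicFactor a ρ u P) (hv : IsPeriodicFactor a ρ v Q) :
    IsPeriodicFactor a ρ (fun n => u n - v n) fun x => P x - Q x := by
  refine of_tendsto (hu.continuous.sub hv.continuous) (hu.periodic.sub hv.periodic) ?_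
  have := hu.tendsto_div_sub.sub hv.tendsto_div_sub
  rw [sub_zero] at this
  exact this.congr fun n => by ring

/-- A sequence of integers along which the argument of the periodic factor converges. -/
theorem tendsto_along (ha : 1 < a) (hu : IsPeriodicFactor a ρ u P) (x : ℝ) :
    Tendsto (fun k : ℕ => u ⌈a ^ (x + k)⌉₊ / (⌈a ^ (x + k)⌉₊ : ℝ) ^ ρ) atTop (𝓝 (P x)) := by
  have ha0 : 0 < a := by linarith
  have h1 : Tendsto (fun k : ℕ => a ^ (x + k)) atTop atTop :=
    (tendsto_rpow_atTop_of_base_gt_one _ ha).comp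
      (tendsto_atTop_add_const_left _ _ tendsto_natCast_atTop_atTop)
  have h2 : Tendsto (fun k : ℕ => ⌈a ^ (x + k)⌉₊) atTop atTop := tendsto_nat_ceil_atTop.comp h1
  -- Rounding up changes a^(x+k) by a factor tending to 1, so the logarithms to base a are x + k +
  -- o(1), and the period removes k.
  have h3 : Tendsto (fun k : ℕ => Real.logb a ⌈a ^ (x + k)⌉₊ - k) atTop (𝓝 x) := by
    have h4 := (tendsto_nat_ceil_div_atTop (R := ℝ)).comp h1
    have h5 : Tendsto (fun y : ℝ => Real.log y / Real.log a + x) (𝓝 1) (𝓝 x) := by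
      have : ContinuousAt (fun y : ℝ => Real.log y / Real.log a + x) 1 :=
        ((Real.continuousAt_log one_ne_zero).div_const _).add continuousAt_const
      simpa [ContinuousAt] using this
    refine (h5.comp h4).congr fun k => ?_
    have h6 : (0 : ℝ) < a ^ (x + k) := Real.rpow_pos_of_pos ha0 _
    have h7 : (0 : ℝ) < ⌈a ^ (x + k)⌉₊ := by exact_mod_cast Nat.ceil_pos.2 h6
    have h8 := Real.log_pos ha
    simp only [Function.comp, Real.logb]
    rw [Real.log_div h7.ne' h6.ne', Real.log_rpow ha0]
    field_simp
    ring
  have h4 := hu.tendsto_div_sub.comp h2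
  have h5 := (hu.continuous.tendsto x).comp h3
  have h6 := h4.add h5
  rw [zero_add] at h6
  refine h6.congr fun k => ?_
  simp only [Function.comp]
  have := hu.periodic.sub_nat_mul_eq (x := Real.logb a ⌈a ^ (x + k)⌉₊) k
  rw [mul_one] at this
  rw [this, sub_add_cancel]

/-- Dividing by n^ρ along the integers ⌈a^(x+k)⌉ recovers both factors at x. Uniqueness and
positivity follow from this comparison. -/
theorem le (ha : 1 < a) (hu : IsPeriodicFactor a ρ u P) (hv : IsPeriodicFactor a ρ v Q)
    (h : ∀ n, u n ≤ v n) (x : ℝ) : P x ≤ Q x :=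
  le_of_tendsto_of_tendsto' (hu.tendsto_along ha x) (hv.tendsto_along ha x) fun k =>
    div_le_div_of_nonneg_right (h _) (by positivity)

theorem unique (ha : 1 < a) (hu : IsPeriodicFactor a ρ u P) (hv : IsPeriodicFactor a ρ u Q) :
    Q = P :=
  funext fun x => le_antisymm (hv.le ha hu (fun _ => le_rfl) x) (hu.le ha hv (fun _ => le_rfl) x)

end IsPeriodicFactor

variable {M A : ℕ} {p : Fin A → ℝ} {ρ a : ℝ}

namespace IsSetting

variable (h : IsSetting M p ρ a)

include h

theorem isPeriodicFactor_meanSize :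
    IsPeriodicFactor a ρ (meanSize M p) (limitFn M p ρ a (gLim ρ atLeastTwo)) := by
  have := h.one_le_rho
  exact h.isPeriodicFactor_tsum le_rfl (by linarith) zero_le_one atLeastTwo_zero
    atLeastTwo_one abs_atLeastTwo_le

theorem limitFn_atLeastTwo_pos (x : ℝ) : 0 < limitFn M p ρ a (gLim ρ atLeastTwo) x := by
  have := h.one_le_rho
  exact h.limitFn_gLim_pos le_rfl (by linarith) zero_le_one atLeastTwo_zero
    atLeastTwo_one abs_atLeastTwo_le atLeastTwo_nonneg (by simp [atLeastTwo]) x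

omit h in
theorem abs_single_two_le {c : ℝ} (hc : 0 ≤ c) (k : ℕ) :
    |if k = 2 then c else 0| ≤ c * (k : ℝ) ^ (0 : ℝ) := by
  rw [Real.rpow_zero, mul_one]
  split_ifs
  · rw [abs_of_nonneg hc]
  · rwa [abs_zero]

theorem isPeriodicFactor_single_two {c : ℝ} (hc : 0 ≤ c) :
    IsPeriodicFactor a ρ
      (fun n => ∑' w, binomMean (wt (letterP M p) w) (fun k => if k = 2 then c else 0) n)
      (limitFn M p ρ a (gLim ρ fun k => if k = 2 then c else 0)) := by
  have := h.one_le_rho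
  exact h.isPeriodicFactor_tsum le_rfl (by linarith) hc (by simp) (by simp)
    (abs_single_two_le hc)

theorem varToll_one : varToll M p 1 = 0 := by
  have := (h.varSize_eq 1).symm
  simpa [varSize_one, varSize_zero, binomMean_succ] using this

/-- A periodic factor of the variance is positive. -/
theorem pos_of_isPeriodicFactor_varSize {P : ℝ → ℝ} (hP : IsPeriodicFactor a ρ (varSize M p) P)
    (x : ℝ) : 0 < P x := by
  have hρ := h.one_le_rho
  have hc := h.varToll_two_pos
  -- The toll is nonnegative, so keeping only its positive value at 2 gives a lower bound whose
  -- factor is positive.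
  refine lt_of_lt_of_le (h.limitFn_gLim_pos le_rfl (by linarith) hc.le (by simp) (by simp)
    (abs_single_two_le hc.le) (fun k => by split_ifs <;> linarith) (by simpa using hc) x)
    ((h.isPeriodicFactor_single_two hc.le).le h.one_lt_a hP (fun n => ?_) x)
  refine hasSum_le (fun w => ?_)
    (h.summable_binomMean (τ := fun k => if k = 2 then varToll M p 2 else 0)
      (by simp) (by simp) n).hasSum (h.hasSum_varToll n)
  refine binomMean_le (h.wt_pos w).le (h.wt_le_one w) fun k _ => ?_
  split_ifs with hk
  · rw [hk]
  · exact h.varToll_nonneg k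

/-- The toll has exponent 2ρ - 2, which is below ρ because ρ < 2. -/
theorem exists_isPeriodicFactor_of_uniform (hu : ∀ j, p j = 1 / (A : ℝ)) :
    ∃ P, IsPeriodicFactor a ρ (varSize M p) P := by
  obtain ⟨K, hK, hb⟩ := h.exists_varToll_le_of_uniform hu
  have hρ := h.one_le_rho
  have hρ2 := h.rho_lt_two
  have h1 := h.isPeriodicFactor_tsum (by linarith) (by linarith) hK.le varToll_zero
    h.varToll_one hb
  have h2 : (fun n => ∑' w, binomMean (wt (letterP M p) w) (varToll M p) n) = varSize M p :=
    funext fun n => (h.hasSum_varToll n).tsum_eq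
  rw [h2] at h1
  exact ⟨_, h1⟩

/-- The corrected variance W has toll O(√n) and hence a periodic factor. The correction has one as
well, and subtracting it leaves the variance. -/
theorem exists_isPeriodicFactor_of_rho_eq_one (h1 : ρ = 1) :
    ∃ P, IsPeriodicFactor a ρ (varSize M p) P := by
  obtain ⟨K, hK, hb⟩ := h.exists_toll_bound_of_rho_eq_one h1
  set W : ℕ → ℝ := fun n => varSize M p n + n * (meanSize M p n - meanSize M p (n - 1)) ^ 2
    with hW
  set τ : ℕ → ℝ := fun n => W n - ∑ x, binomMean (letterP M p x) W n with hτ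
  have w0 : W 0 = 0 := by simp [hW, varSize_zero]
  have w1 : W 1 = 0 := by simp [hW, varSize_one, meanSize_one, meanSize_zero]
  have t0 : τ 0 = 0 := by simp [hτ, w0]
  have t1 : τ 1 = 0 := by simp [hτ, w0, w1, binomMean_succ]
  have hPW := h.isPeriodicFactor_tsum (τ := τ) (σ := 1 / 2) (by norm_num) (by linarith) hK.le
    t0 t1 hb
  have hWsum : (fun n => ∑' w, binomMean (wt (letterP M p) w) τ n) = W :=
    funext fun n => (h.hasSum_of_recursion w0 w1 (fun n => by simp [hτ]) n).tsum_eq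
  rw [hWsum] at hPW
  have hPD := h.isPeriodicFactor_single_two (c := 2) zero_le_two
  simp only [← h.mul_diff_eq_tsum] at hPD
  set PD := limitFn M p ρ a (gLim ρ fun k => if k = 2 then 2 else 0) with hPDdef
  obtain ⟨B, hB⟩ := hPD.exists_bound
  -- For ρ = 1 the correction divided by n is the square of (n·d_n)/n, so its factor is the square
  -- of that of n·d_n.
  have hT : IsPeriodicFactor a ρ
      (fun n : ℕ => n * (meanSize M p n - meanSize M p (n - 1)) ^ 2) fun x => PD x ^ 2 := by
    refine IsPeriodicFactor.of_tendsto (hPD.continuous.pow 2)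
      (fun x => by simp only [hPD.periodic x]) ?_
    have h2 := hPD.tendsto_div_sub
    -- From u² - P² = (u - P)² + 2P(u - P), where P is bounded.
    have h3 : Tendsto (fun n : ℕ => 2 * PD (Real.logb a n) *
        (n * (meanSize M p n - meanSize M p (n - 1)) / (n : ℝ) ^ ρ - PD (Real.logb a n)))
        atTop (𝓝 0) := by
      refine bdd_le_mul_tendsto_zero' (2 * B) (Eventually.of_forall fun n => ?_) h2
      rw [abs_mul, abs_two]
      exact mul_le_mul_of_nonneg_left (hB _) zero_le_two
    have h4 := (h2.pow 2).add h3
    simp only [ne_eq, OfNat.ofNat_ne_zero, not_false_eq_true, zero_pow, add_zero] at h4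
    refine h4.congr' ?_
    filter_upwards [eventually_ge_atTop 1] with n hn
    have hn0 : (n : ℝ) ≠ 0 := by
      have : (0 : ℝ) < n := by exact_mod_cast hn
      exact this.ne'
    rw [h1, Real.rpow_one, mul_div_cancel_left₀ _ hn0, mul_div_cancel_left₀ _ hn0]
    ring
  have h5 := hPW.sub hT
  simp only [hW, add_sub_cancel_right] at h5
  exact ⟨_, h5⟩

end IsSetting

end GTrie

end

theorem corollary1 {Ω : Type*} [MeasurableSpace Ω] (μ : Measure Ω) [IsProbabilityMeasure μ]
    (M A : ℕ) (hM : 1 ≤ M) (p : Fin A → ℝ) (hp : ∀ j, 0 < p j ∧ p j < 1)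
    (hsum : ∑ j, p j = 1) (hne : ∑ j, p j ^ 2 < 1 / (M : ℝ))
    (ρ : ℝ) (hρ : ∑ j, p j ^ ρ = 1 / (M : ℝ))
    (a : ℝ) (ha : GTrie.IsBase p a)
    (L : ℕ → GTrie.Edge M → Ω → Fin A) (hL : GTrie.IsRandomLabelings μ p L) :
    (∀ n, (∀ᵐ ω ∂μ, (GTrie.randomNodes L n ω).Finite) ∧ MemLp (GTrie.size L n) 2 μ) ∧
    (∃ PE : ℝ → ℝ,
      GTrie.IsPeriodicFactor a ρ (fun n => ∫ ω, GTrie.size L n ω ∂μ) PE ∧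
      (∀ Q, GTrie.IsPeriodicFactor a ρ (fun n => ∫ ω, GTrie.size L n ω ∂μ) Q → Q = PE) ∧
      (∀ x : ℝ, HasSum (fun β : GTrie.roots M p ρ =>
        GTrie.GE M p β * Complex.exp (((β : ℂ) - ρ) * Real.log a * x)) (PE x : ℂ)) ∧
      ∀ x, 0 < PE x) ∧
    ((∀ j, p j = 1 / (A : ℝ)) ∨ ρ = 1 →
      ∃ PV : ℝ → ℝ,
        GTrie.IsPeriodicFactor a ρ (fun n => variance (GTrie.size L n) μ) PV ∧
        (∀ Q, GTrie.IsPeriodicFactor a ρ (fun n => variance (GTrie.size L n) μ) Q → Q = PV) ∧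
        ∀ x, 0 < PV x) := by
  have h : GTrie.IsSetting M p ρ a := ⟨hM, hp, hsum, hne, hρ, ha⟩
  have hE : (fun n => ∫ ω, GTrie.size L n ω ∂μ) = GTrie.meanSize M p :=
    funext fun n => hL.integral_size h n
  have hV : (fun n => variance (GTrie.size L n) μ) = GTrie.varSize M p :=
    funext fun n => hL.variance_size h n
  rw [hE, hV]
  refine ⟨fun n => ⟨hL.ae_finite h n, hL.memLp_size h n⟩,
    ⟨_, h.isPeriodicFactor_meanSize, fun Q hQ => h.isPeriodicFactor_meanSize.unique h.one_lt_a hQ,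
      h.hasSum_roots, h.limitFn_atLeastTwo_pos⟩, fun hcase => ?_⟩
  obtain ⟨P, hP⟩ : ∃ P, GTrie.IsPeriodicFactor a ρ (GTrie.varSize M p) P :=
    hcase.elim h.exists_isPeriodicFactor_of_uniform h.exists_isPeriodicFactor_of_rho_eq_one
  exact ⟨P, hP, fun Q hQ => hP.unique h.one_lt_a hQ, h.pos_of_isPeriodicFactor_varSize hP⟩
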